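/- Let $n\ge 1$ be an integer and let $\mathbb B_n$ be the open unit ball of $\mathbb C^n$, with $\langle z,w\rangle=\sum_{j=1}^n z_j\overline{w_j}$ and $|z|=\sqrt{\langle z,z\rangle}$. For real $a>-1$ and $b>-n$ let $\mu_{a,b}$ be the probability measure on $\mathbb B_n$ $$d\mu_{a,b}(z)=\frac{(n-1)!}{\pi^n\,\beta(a+1,b+n)}\,|z|^{2b}(1-|z|^2)^a\,d\lambda_n(z),\qquad \beta(s,t)=\frac{\Gamma(s)\Gamma(t)}{\Gamma(s+t)},$$ where $\lambda_n$ is Lebesgue measure on $\mathbb C^n$, and for $1\le p<\infty$ let $\mathcal A^p_{a,b}$ be the space of holomorphic functions on $\mathbb B_n$ that belong to $L^p(\mathbb B_n,d\mu_{a,b})$. For $|\xi|<1$ put $\mathcal K_{a,b}(\xi)={}_2F_1(n,\,a+b+n+1;\,b+n;\,\xi)$, and for $|\xi|\le 1$ put $Q_{a,b}(\xi)={}_2F_1(b,\,-(a+1);\,b+n;\,\xi)$. The Bergman projection $\mathbb P_{a,b}$ is the operator with domain $L^1(\mathbb B_n,d\mu_{a,b})$ given by $$\mathbb P_{a,b}f(z)=\int_{\mathbb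 B_n} f(w)\,\mathcal K_{a,b}(\langle z,w\rangle)\,d\mu_{a,b}(w),\qquad z\in\mathbb B_n .$$ For real $c>-1$ and $d>-n$, we say that $\mathbb P_{a,b}$ is bounded on $L^p(d\mu_{c,d})$ if there is a constant $M$ such that $\mathbb P_{a,b}f\in L^p(d\mu_{c,d})$ and $\|\mathbb P_{a,b}f\|_{L^p(d\mu_{c,d})}\le M\|f\|_{L^p(d\mu_{c,d})}$ for every $f\in L^p(d\mu_{c,d})\cap L^1(d\mu_{a,b})$. Let $a,c>-1$, $b,d>-n$ and $1\le p<\infty$, and consider the conditions $$(C)\qquad c+1<p(a+1)\quad\text{and}\quad \begin{cases} d+n<p(b+n) & \text{if } p>1,\\ d\le b & \text{if } p=1.\end{cases}$$ 1. If (C) holds, then $\mathbb P_{a,b}$ is bounded from $L^p(\mathbb B_n,d\mu_{c,d})$ onto $\mathcal A^p_{c,d}$: one has $L^p(d\mu_{c,d})\subseteq L^1(d\mu_{a,b})$, so that $\mathbb P_{a,b}$ is defined on all of $L^p(d\mu_{c,d})$; it is bounded on $L^p(d\mu_{c,d})$; and the image of $L^p(d\mu_{c,d})$ under $\mathbb P_{a,b}$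 is exactly $\mathcal A^p_{c,d}$. 2. Conversely, if $Q_{a,b}$ has no zeros in the closed unit disk $\overline{\mathbb D}$ and $\mathbb P_{a,b}$ is bounded on $L^p(d\mu_{c,d})$, then (C) holds. -/

import Mathlib

open MeasureTheory
open scoped ENNReal NNReal

namespace ModBergman

noncomputable section

/-- The space `ℂⁿ` with its Euclidean norm. -/
abbrev Cn (n : ℕ) : Type := EuclideanSpace ℂ (Fin n)

/-- The open unit ball of `ℂⁿ`. -/
def unitBall (n : ℕ) : Set (Cn n) := Metric.ball 0 1

/-- The density `(n-1)! / (π ^ n * β (a+1, b+n)) * |z| ^ (2b) * (1 - |z|²) ^ a`. -/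
def density (n : ℕ) (a b : ℝ) (z : Cn n) : ℝ :=
  ((n - 1).factorial : ℝ) / (Real.pi ^ n * ProbabilityTheory.beta (a + 1) (b + n)) *
    (‖z‖ ^ (2 * b) * (1 - ‖z‖ ^ 2) ^ a)

/-- The measure `μ_{a,b}`, carried by the unit ball: the density above times Lebesgue measure. -/
def mu (n : ℕ) (a b : ℝ) : Measure (Cn n) :=
  (volume.restrict (unitBall n)).withDensity fun z => ENNReal.ofReal (density n a b z)

/-- `f` represents an element of `L^p(B_n, dμ_{a,b})`. Values off the ball are irrelevant. -/
def InLp (n : ℕ) (a b p : ℝ) (f : Cn n → ℂ) : Prop :=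
  MemLp f (ENNReal.ofReal p) (mu n a b)

/-- The norm of `L^p(B_n, dμ_{a,b})`, with values in `[0, ∞]`. -/
def lpNorm (n : ℕ) (a b p : ℝ) (f : Cn n → ℂ) : ℝ≥0∞ :=
  eLpNorm f (ENNReal.ofReal p) (mu n a b)

/-- `f` belongs to the modified Bergman space `A^p_{a,b}`: it is holomorphic on the ball and
`p`-integrable for `μ_{a,b}`. -/
def InBergman (n : ℕ) (a b p : ℝ) (f : Cn n → ℂ) : Prop :=
  DifferentiableOn ℂ f (unitBall n) ∧ InLp n a b p f

/-- `𝒦_{a,b}(ξ) = ₂F₁(n, a+b+n+1; b+n; ξ)`; the Bergman kernel is `𝒦_{a,b}(⟨z, w⟩)`. -/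
def kernelFun (n : ℕ) (a b : ℝ) (ξ : ℂ) : ℂ :=
  ordinaryHypergeometric (n : ℂ) ((a + b + n + 1 : ℝ) : ℂ) ((b + n : ℝ) : ℂ) ξ

/-- `Q_{a,b}(ξ) = ₂F₁(b, -(a+1); b+n; ξ)`; the series converges absolutely for `|ξ| ≤ 1`. -/
def Q (n : ℕ) (a b : ℝ) (ξ : ℂ) : ℂ :=
  ordinaryHypergeometric (b : ℂ) ((-(a + 1) : ℝ) : ℂ) ((b + n : ℝ) : ℂ) ξ

/-- The Bergman projection `P_{a,b} f (z) = ∫ f(w) 𝒦_{a,b}(⟨z, w⟩) dμ_{a,b}(w)`, with domain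
`L^1(B_n, dμ_{a,b})`. Here `⟨z, w⟩ = ∑ z_j * conj w_j`, which is `inner ℂ w z` in Mathlib. -/
def proj (n : ℕ) (a b : ℝ) (f : Cn n → ℂ) (z : Cn n) : ℂ :=
  ∫ w, f w * kernelFun n a b (inner ℂ w z) ∂(mu n a b)

/-- `P_{a,b}` is bounded on `L^p(B_n, dμ_{c,d})`: for some constant `C`, every `f` in
`L^p(dμ_{c,d})` and in the domain `L^1(dμ_{a,b})` of `P_{a,b}` has its image in `L^p(dμ_{c,d})`,
of norm at most `C` times the norm of `f`. -/
def ProjBounded (n : ℕ) (a b c d p : ℝ) : Prop :=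
  ∃ C : ℝ≥0, ∀ f : Cn n → ℂ, InLp n c d p f → Integrable f (mu n a b) →
    InLp n c d p (proj n a b f) ∧ lpNorm n c d p (proj n a b f) ≤ C * lpNorm n c d p f

/-- The conditions (C). -/
def ConditionC (n : ℕ) (a b c d p : ℝ) : Prop :=
  c + 1 < p * (a + 1) ∧ (1 < p → d + n < p * (b + n)) ∧ (p = 1 → d ≤ b)

end

end ModBergman

open Filter Topology

namespace ModBergman

/-! Euler's transformation factors the kernel as `𝒦_{a,b}(ξ) = (1 - ξ)^{-(n+1+a)} Q_{a,b}(ξ)`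
(`kernelFun_eq_mul`). The series of `Q_{a,b}` converges absolutely on the closed disc, so `Q_{a,b}`
is continuous and bounded there, and bounded away from zero when it has no zeros. Hence
`|𝒦_{a,b}(ξ)|` is at most a constant times `|1 - ξ|^{-(n+1+a)}`, and is comparable to it in the
zero-free case.

Sufficiency. The positive operator with kernel `|1 - ⟨z, w⟩|^{-(n+1+a)}` is controlled by Schur's
test (`schur_test`) with a weight `|w|^{2y} (1 - |w|²)^x`; for `p = 1` Tonelli suffices. The
integrals that appear are Forelli–Rudin integrals: Parseval turns them into power series in `|z|²`,
whose coefficients are compared with those of `(1 - |z|²)^{-s}`. Condition (C) is what makes room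
for `x` and `y`. Finiteness of the positive operator at a single point already gives `L^p(μ_{c,d}) ⊆
L^1(μ_{a,b})`. Surjectivity holds because the projection reproduces holomorphic functions: pairing
such a function with `⟨z, w⟩^k` extracts one coefficient of its slice through `z` times the `k`-th
moment of `μ_{a,b}`, and the kernel coefficients are the reciprocals of these moments
(`hc_mul_moment`).

Necessity. A radial function is projected to its mean, a constant. Testing on powers of `|w|` and of
`1 - |w|²` whose exponents approach the limit of integrability compares a beta value of order `1/ε`
with the `p`-th root of another one (`not_forall_beta_le`). This rules out everything but the case
`p = 1`, `c = a`, `d ≤ b`. There indicators of small balls imitate point masses near the sphere, and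
boundedness would bound `∫ |𝒦_{a,b}(⟨z, w⟩)| dμ_{a,d}(z)` uniformly in `w`. By the lower bound on
the kernel, the only use of the zero-free hypothesis, this contradicts the divergence of the
harmonic series (`not_projBounded_one`). -/

/-! ### Growth of binomial and hypergeometric coefficients -/

/-- The rising factorial `x (x+1) ⋯ (x+k-1)`. -/
noncomputable def rp (x : ℝ) (k : ℕ) : ℝ := (ascPochhammer ℝ k).eval x

/-- The coefficients of `(1 - ξ) ^ (-x)`. -/
noncomputable def bc (x : ℝ) (k : ℕ) : ℝ := rp x k / k.factorial

/-- The coefficients of `₂F₁(A, B; C; ξ)`. -/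
noncomputable def hc (A B C : ℝ) (k : ℕ) : ℝ := bc A k * rp B k / rp C k

lemma rp_zero (x : ℝ) : rp x 0 = 1 := by simp [rp]

lemma rp_succ (x : ℝ) (k : ℕ) : rp x (k + 1) = rp x k * (x + k) := by
  simp [rp, ascPochhammer_succ_eval]

lemma rp_pos {x : ℝ} (hx : 0 < x) (k : ℕ) : 0 < rp x k := by
  induction k with
  | zero => simp [rp_zero]
  | succ k ih => rw [rp_succ]; positivity

lemma rp_eq_prod (x : ℝ) (k : ℕ) : rp x k = ∏ j ∈ Finset.range k, (x + j) := by
  induction k with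
  | zero => simp [rp_zero]
  | succ k ih => rw [rp_succ, ih, Finset.prod_range_succ]

lemma bc_zero (x : ℝ) : bc x 0 = 1 := by simp [bc, rp_zero]

lemma bc_succ (x : ℝ) (k : ℕ) : (k + 1) * bc x (k + 1) = (x + k) * bc x k := by
  have : (k.factorial : ℝ) ≠ 0 := by positivity
  have h2 : (k + 1 : ℝ) ≠ 0 := by positivity
  rw [bc, bc, rp_succ, Nat.factorial_succ]; push_cast; field_simp

lemma bc_pos {x : ℝ} (hx : 0 < x) (k : ℕ) : 0 < bc x k :=
  div_pos (rp_pos hx k) (by positivity)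

lemma hc_zero (A B C : ℝ) : hc A B C 0 = 1 := by simp [hc, bc_zero, rp_zero]

lemma hc_succ (A B : ℝ) {C : ℝ} (hC : 0 < C) (k : ℕ) :
    (k + 1) * (C + k) * hc A B C (k + 1) = (A + k) * (B + k) * hc A B C k := by
  have h1 := (rp_pos hC k).ne'
  have h2 : C + k ≠ 0 := by positivity
  have h3 : (k + 1 : ℝ) ≠ 0 := by positivity
  have h4 := bc_succ A k
  have : bc A (k + 1) = (A + k) * bc A k / (k + 1) := by field_simp; linarith
  rw [hc, hc, this, rp_succ, rp_succ]; field_simp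

/-- Gauss's limit for `Γ(x)`, inverted: `GammaSeq x k` has the product `x (x+1) ⋯ (x+k)` in its
denominator, which is why the index is `k + 1`. The excluded values of `x` are the poles of `Γ`. -/
lemma bc_div_rpow_tendsto {x : ℝ} (hx : ∀ m : ℕ, x ≠ -m) :
    Tendsto (fun k : ℕ => bc x (k + 1) / (k : ℝ) ^ (x - 1)) atTop (𝓝 (Real.Gamma x)⁻¹) := by
  have h := (Real.GammaSeq_tendsto_Gamma x).inv₀ (Real.Gamma_ne_zero hx)
  have h2 : Tendsto (fun k : ℕ => (k : ℝ) / (k + 1)) atTop (𝓝 1) :=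
    tendsto_natCast_div_add_atTop 1
  have h3 := h.mul h2
  rw [mul_one] at h3
  refine h3.congr' ?_
  filter_upwards [eventually_gt_atTop 0] with k hk
  have hk' : (0 : ℝ) < k := by exact_mod_cast hk
  rw [Real.GammaSeq, ← rp_eq_prod, bc, Nat.factorial_succ, Real.rpow_sub_one hk'.ne']
  have : (k : ℝ) ^ x ≠ 0 := (Real.rpow_pos_of_pos hk' x).ne'
  have : (k.factorial : ℝ) ≠ 0 := by positivity
  push_cast
  field_simp

/-- Absorbs the index shift between Gauss's limit, stated in powers of `k`, and bounds in powers of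
one plus the coefficient's index, here `k + 2`. It holds because `(k + 2) / k` lies between 1 and 3.
-/
lemma rpow_ratio_bounds (s : ℝ) (k : ℕ) (hk : 1 ≤ k) :
    (k : ℝ) ^ s ≤ 2 ^ |s| * ((k : ℝ) + 2) ^ s * 2 ^ |s| ∧
      ((k : ℝ) + 2) ^ s ≤ 3 ^ |s| * (k : ℝ) ^ s := by
  have hk' : (1 : ℝ) ≤ k := by exact_mod_cast hk
  have h0 : (0 : ℝ) < k := by linarith
  have e1 : (k : ℝ) ^ s = ((k : ℝ) / (k + 2)) ^ s * ((k : ℝ) + 2) ^ s := by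
    rw [← Real.mul_rpow (by positivity) (by positivity)]
    congr 1; field_simp
  have e2 : ((k : ℝ) + 2) ^ s = (((k : ℝ) + 2) / k) ^ s * (k : ℝ) ^ s := by
    rw [← Real.mul_rpow (by positivity) (by positivity)]
    congr 1; field_simp
  have b1 : 1 ≤ ((k : ℝ) + 2) / k := by rw [le_div_iff₀ h0]; linarith
  have b2 : ((k : ℝ) + 2) / k ≤ 3 := by rw [div_le_iff₀ h0]; linarith
  constructor
  · have : ((k : ℝ) / (k + 2)) ^ s ≤ 3 ^ |s| := by
      have : (k : ℝ) / (k + 2) = (((k : ℝ) + 2) / k)⁻¹ := by rw [inv_div]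
      rw [this, Real.inv_rpow (by positivity), ← Real.rpow_neg (by positivity)]
      calc _ ≤ (((k : ℝ) + 2) / k) ^ |s| :=
            Real.rpow_le_rpow_of_exponent_le b1 (neg_le_abs s)
        _ ≤ _ := Real.rpow_le_rpow (by positivity) b2 (abs_nonneg s)
    have h4 : (3 : ℝ) ^ |s| ≤ 2 ^ |s| * 2 ^ |s| := by
      rw [← Real.mul_rpow (by norm_num) (by norm_num)]
      exact Real.rpow_le_rpow (by norm_num) (by norm_num) (abs_nonneg s)
    rw [e1]
    calc _ ≤ (2 ^ |s| * 2 ^ |s|) * ((k : ℝ) + 2) ^ s := by gcongr; linarith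
      _ = _ := by ring
  · rw [e2]
    gcongr
    calc _ ≤ (((k : ℝ) + 2) / k) ^ |s| :=
            Real.rpow_le_rpow_of_exponent_le b1 (le_abs_self s)
        _ ≤ _ := Real.rpow_le_rpow (by positivity) b2 (abs_nonneg s)

/-- A real sequence that is eventually bounded by a positive sequence is bounded by a multiple. -/
lemma exists_le_mul_of_eventually {u v : ℕ → ℝ} (hv : ∀ k, 0 < v k) {M : ℝ}
    (h : ∀ᶠ k in atTop, u k ≤ M * v k) : ∃ C, 0 < C ∧ ∀ k, u k ≤ C * v k := by
  obtain ⟨N, hN⟩ := eventually_atTop.1 h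
  refine ⟨|M| + 1 + ∑ j ∈ Finset.range N, |u j / v j|, by positivity, fun k => ?_⟩
  by_cases hk : N ≤ k
  · refine (hN k hk).trans ?_
    have : 0 ≤ ∑ j ∈ Finset.range N, |u j / v j| := by positivity
    have := hv k
    gcongr
    linarith [le_abs_self M]
  · have h1 : |u k / v k| ≤ ∑ j ∈ Finset.range N, |u j / v j| :=
      Finset.single_le_sum (f := fun j => |u j / v j|) (fun _ _ => abs_nonneg _)
        (Finset.mem_range.2 (not_le.1 hk))
    have h2 : u k = u k / v k * v k := by rw [div_mul_cancel₀ _ (hv k).ne']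
    rw [h2]
    have := hv k
    gcongr
    linarith [le_abs_self (u k / v k), abs_nonneg M]

lemma exists_bc_le (x : ℝ) : ∃ C, 0 < C ∧ ∀ k : ℕ, |bc x k| ≤ C * ((k : ℝ) + 1) ^ (x - 1) := by
  have hv : ∀ k : ℕ, 0 < ((k : ℝ) + 1) ^ (x - 1) := fun k => by positivity
  by_cases hx : ∀ m : ℕ, x ≠ -m
  · refine exists_le_mul_of_eventually (M := (|(Real.Gamma x)⁻¹| + 1) * (2 ^ |x - 1| * 2 ^ |x - 1|)) hv ?_
    have h := (bc_div_rpow_tendsto hx).abs.eventually (gt_mem_nhds (lt_add_one _))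
    obtain ⟨N, hN⟩ := eventually_atTop.1 h
    refine eventually_atTop.2 ⟨N + 2, fun k hk => ?_⟩
    obtain ⟨j, rfl⟩ : ∃ j, k = j + 1 := ⟨k - 1, by omega⟩
    have hj := hN j (by omega)
    have hj0 : 1 ≤ j := by omega
    have hj1 : (0 : ℝ) < j := by exact_mod_cast hj0
    have hp : 0 < (j : ℝ) ^ (x - 1) := by positivity
    rw [abs_div, abs_of_pos hp, div_lt_iff₀ hp] at hj
    have := (rpow_ratio_bounds (x - 1) j hj0).1
    have e : ((j + 1 : ℕ) : ℝ) + 1 = j + 2 := by push_cast; ring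
    rw [e]
    calc _ ≤ _ := hj.le
      _ ≤ (|(Real.Gamma x)⁻¹| + 1) * _ := mul_le_mul_of_nonneg_left this (by positivity)
      _ = _ := by ring
  -- At a pole of `Γ` the binomial series is a polynomial, so its coefficients vanish eventually.
  · push Not at hx
    obtain ⟨m, hm⟩ := hx
    refine exists_le_mul_of_eventually (M := 0) hv ?_
    filter_upwards [eventually_gt_atTop m] with k hk
    have : bc x k = 0 := by
      rw [bc, rp_eq_prod, Finset.prod_eq_zero (Finset.mem_range.2 hk) (by rw [hm]; ring), zero_div]
    simp [this]

lemma exists_le_bc {x : ℝ} (hx : 0 < x) :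
    ∃ c, 0 < c ∧ ∀ k : ℕ, c * ((k : ℝ) + 1) ^ (x - 1) ≤ bc x k := by
  have hx' : ∀ m : ℕ, x ≠ -m := fun m h => by
    have : (0 : ℝ) ≤ m := by positivity
    linarith
  have hG : 0 < (Real.Gamma x)⁻¹ := inv_pos.2 (Real.Gamma_pos_of_pos hx)
  obtain ⟨C, hC, h⟩ : ∃ C, 0 < C ∧ ∀ k : ℕ, ((k : ℝ) + 1) ^ (x - 1) ≤ C * bc x k := by
    refine exists_le_mul_of_eventually (M := 3 ^ |x - 1| * ((Real.Gamma x)⁻¹ / 2)⁻¹)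
      (bc_pos hx) ?_
    have h := (bc_div_rpow_tendsto hx').eventually (lt_mem_nhds (half_lt_self hG))
    obtain ⟨N, hN⟩ := eventually_atTop.1 h
    refine eventually_atTop.2 ⟨N + 2, fun k hk => ?_⟩
    obtain ⟨j, rfl⟩ : ∃ j, k = j + 1 := ⟨k - 1, by omega⟩
    have hj := hN j (by omega)
    have hj0 : 1 ≤ j := by omega
    have hj1 : (0 : ℝ) < j := by exact_mod_cast hj0
    have hp : 0 < (j : ℝ) ^ (x - 1) := by positivity
    rw [lt_div_iff₀ hp] at hj
    have h2 := (rpow_ratio_bounds (x - 1) j hj0).2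
    have e : ((j + 1 : ℕ) : ℝ) + 1 = j + 2 := by push_cast; ring
    rw [e]
    refine h2.trans ?_
    rw [mul_assoc]
    gcongr
    rw [inv_mul_eq_div, le_div_iff₀ (by positivity)]
    linarith
  refine ⟨C⁻¹, inv_pos.2 hC, fun k => ?_⟩
  rw [inv_mul_le_iff₀ hC]; exact h k

/-- The coefficient is `bc A k * bc B k / bc C k`, so the growth exponents add and subtract. -/
lemma exists_hc_le (A B : ℝ) {C : ℝ} (hC : 0 < C) :
    ∃ M, 0 < M ∧ ∀ k : ℕ, |hc A B C k| ≤ M * ((k : ℝ) + 1) ^ (A + B - C - 1) := by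
  obtain ⟨c1, hc1, h1⟩ := exists_bc_le A
  obtain ⟨c2, hc2, h2⟩ := exists_bc_le B
  obtain ⟨c3, hc3, h3⟩ := exists_le_bc hC
  refine ⟨c1 * c2 / c3, by positivity, fun k => ?_⟩
  have e : hc A B C k = bc A k * bc B k / bc C k := by
    have : (k.factorial : ℝ) ≠ 0 := by positivity
    have := (rp_pos hC k).ne'
    rw [hc, bc, bc, bc]; field_simp
  have hk : (0 : ℝ) < (k : ℝ) + 1 := by positivity
  rw [e, abs_div, abs_mul, abs_of_pos (bc_pos hC k), div_le_iff₀ (bc_pos hC k)]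
  calc _ ≤ (c1 * ((k : ℝ) + 1) ^ (A - 1)) * (c2 * ((k : ℝ) + 1) ^ (B - 1)) := by
        gcongr
        · exact h1 k
        · exact h2 k
    _ = c1 * c2 / c3 * ((k : ℝ) + 1) ^ (A + B - C - 1) * (c3 * ((k : ℝ) + 1) ^ (C - 1)) := by
        have : ((k : ℝ) + 1) ^ (A - 1) * ((k : ℝ) + 1) ^ (B - 1) =
            ((k : ℝ) + 1) ^ (A + B - C - 1) * ((k : ℝ) + 1) ^ (C - 1) := by
          rw [← Real.rpow_add hk, ← Real.rpow_add hk]; congr 1; ring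
        field_simp
        linear_combination this
    _ ≤ _ := by gcongr; exact h3 k

lemma summable_hc {A B C : ℝ} (hC : 0 < C) (h : A + B < C) : Summable fun k => |hc A B C k| := by
  obtain ⟨M, hM, key⟩ := exists_hc_le A B hC
  refine Summable.of_nonneg_of_le (fun _ => abs_nonneg _) key (Summable.mul_left _ ?_)
  have := (summable_nat_add_iff 1).2 (Real.summable_nat_rpow.2 (show A + B - C - 1 < -1 by linarith))
  simpa using this

lemma summable_hc_mul_pow {A B C : ℝ} (hC : 0 < C) {r : ℝ} (hr0 : 0 ≤ r) (hr : r < 1) :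
    Summable fun k => |hc A B C k| * r ^ k := by
  obtain ⟨M, hM, key⟩ := exists_hc_le A B hC
  obtain ⟨N, hN⟩ := exists_nat_ge (A + B - C - 1)
  have key' : ∀ k : ℕ, |hc A B C k| * r ^ k ≤ M * (((k : ℝ) + 1) ^ N * r ^ k) := by
    intro k
    rw [← mul_assoc]
    refine mul_le_mul_of_nonneg_right ((key k).trans ?_) (by positivity)
    rw [← Real.rpow_natCast]
    gcongr
    linarith [(Nat.cast_nonneg k : (0 : ℝ) ≤ k)]
  refine Summable.of_nonneg_of_le (fun _ => by positivity) key' (Summable.mul_left _ ?_)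
  -- The ratio `r` is replaced by `(r + 1) / 2`, which is still below 1 but at least `1/2`, so that
  -- shifting the power by one costs at most a factor 2, even at `r = 0`.
  have h3 : Summable fun k : ℕ => (k : ℝ) ^ N * ((r + 1) / 2) ^ k :=
    summable_pow_mul_geometric_of_norm_lt_one N
      (by rw [Real.norm_of_nonneg (by linarith)]; linarith)
  have h4 : Summable fun k : ℕ => ((k : ℝ) + 1) ^ N * ((r + 1) / 2) ^ (k + 1) := by
    have := (summable_nat_add_iff (f := fun k : ℕ => (k : ℝ) ^ N * ((r + 1) / 2) ^ k) 1).2 h3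
    simpa only [Nat.cast_add, Nat.cast_one] using this
  refine Summable.of_nonneg_of_le (fun _ => by positivity) (fun k => ?_) (h4.mul_left 2)
  calc ((k : ℝ) + 1) ^ N * r ^ k ≤ ((k : ℝ) + 1) ^ N * ((r + 1) / 2) ^ k := by
        gcongr; linarith
    _ ≤ 2 * (((k : ℝ) + 1) ^ N * ((r + 1) / 2) ^ (k + 1)) := by
        rw [pow_succ]
        have h0 : 0 ≤ (r + 1) / 2 := by linarith
        have h1 : 0 ≤ ((k : ℝ) + 1) ^ N * ((r + 1) / 2) ^ k := by positivity
        have h2 := mul_nonneg h1 hr0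
        linarith

lemma hc_self (A : ℝ) {C : ℝ} (hC : 0 < C) (k : ℕ) : hc A C C k = bc A k := by
  rw [hc, mul_div_assoc, div_self (rp_pos hC k).ne', mul_one]

lemma summable_bc_mul_pow (A : ℝ) {r : ℝ} (hr0 : 0 ≤ r) (hr : r < 1) :
    Summable fun k => |bc A k| * r ^ k := by
  simpa [hc_self] using summable_hc_mul_pow (A := A) (B := 1) (C := 1) one_pos hr0 hr

/-! ### Euler's transformation for formal power series -/

section Formal

open PowerSeries

local notation "∂" => PowerSeries.derivative ℝ

/-- Reads off the coefficients of the hypergeometric equation `X(1-X)Y'' + (C - (A+B+1)X)Y' - AB Y =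
0`. Its `k`-th coefficient is the two-term recursion of `₂F₁(A, B; C)`. -/
lemma hypergeometric_ode_iff (A B C : ℝ) (Y : PowerSeries ℝ) :
    X * ∂ (∂ Y) - X * (X * ∂ (∂ Y)) + C • ∂ Y - (A + B + 1) • (X * ∂ Y) - (A * B) • Y = 0 ↔
      ∀ k : ℕ, (k + 1) * (C + k) * coeff (k + 1) Y = (A + k) * (B + k) * coeff k Y := by
  rw [PowerSeries.ext_iff]
  refine forall_congr' fun k => ?_
  rcases k with _ | _ | k
  · have e : constantCoeff (∂ Y) = coeff 1 Y := by
      rw [← coeff_zero_eq_constantCoeff_apply, coeff_derivative]; simp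
    simp [e]
    constructor <;> intro h <;> linarith
  · have e : coeff 1 (X * (X * ∂ (∂ Y))) = 0 := by
      rw [show (1 : ℕ) = 0 + 1 from rfl, coeff_succ_X_mul]; simp
    simp only [zero_add, map_sub, map_add, map_smul, e, map_zero, smul_eq_mul]
    rw [show (1 : ℕ) = 0 + 1 from rfl, coeff_succ_X_mul, coeff_succ_X_mul]
    simp only [coeff_derivative]
    norm_num
    constructor <;> intro h <;> linarith
  · simp only [map_sub, map_add, map_smul, map_zero, smul_eq_mul, coeff_succ_X_mul,
      coeff_derivative]
    push_cast
    constructor <;> intro h <;> linear_combination h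

/-- With `m = A + B - C`, the product of `(1 - X)^{-m}` and `₂F₁(C-A, C-B; C)` satisfies the
hypergeometric equation of `₂F₁(A, B; C)`. Since `C > 0`, the recursion determines a solution from
its constant coefficient, so the two series agree. -/
lemma euler_transformation_coeff (A B : ℝ) {C : ℝ} (hC : 0 < C) (k : ℕ) :
    hc A B C k = ∑ p ∈ Finset.HasAntidiagonal.antidiagonal k, bc (A + B - C) p.1 * hc (C - A) (C - B) C p.2 := by
  set m := A + B - C with hm
  set G : PowerSeries ℝ := PowerSeries.mk (bc m) with hG
  set H : PowerSeries ℝ := PowerSeries.mk (hc (C - A) (C - B) C) with hH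
  have e1 : (1 - X) * ∂ G = m • G := by
    ext j
    rw [sub_mul, one_mul, map_sub]
    rcases j with _ | j
    · simp [coeff_derivative, hG, bc_zero]
      have := bc_succ m 0
      simp [bc_zero] at this
      exact this
    · rw [coeff_succ_X_mul]
      simp only [coeff_derivative, hG, coeff_mk, map_smul, smul_eq_mul]
      have := bc_succ m (j + 1)
      push_cast at this ⊢
      linarith
  have e2 : (1 - X) * ∂ (∂ G) = (m + 1) • ∂ G := by
    have := congrArg (∂) e1
    rw [Derivation.leibniz, map_sub, derivative_X, Derivation.map_smul] at this
    simp only [smul_eq_mul, Derivation.map_one_eq_zero, zero_sub, mul_neg, mul_one] at this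
    rw [add_smul, one_smul, ← this]; ring
  have e3 := (hypergeometric_ode_iff (C - A) (C - B) C H).2 fun j => by
    simpa [hH] using hc_succ (C - A) (C - B) hC j
  have hY : ∀ j : ℕ, (j + 1) * (C + j) * coeff (j + 1) (G * H) =
      (A + j) * (B + j) * coeff j (G * H) := by
    rw [← hypergeometric_ode_iff]
    -- Power series over a field form a domain, so the equation may be multiplied by `1 - X`; the
    -- first-order relations for `G` then apply without division.
    have h1X : (1 - X : PowerSeries ℝ) ≠ 0 := by
      intro h
      have := congrArg (coeff 0) h
      simp at this
    refine (mul_eq_zero.1 ?_).resolve_left h1X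
    have d1 : ∂ (G * H) = G * ∂ H + H * ∂ G := by
      rw [Derivation.leibniz]; simp
    have d2 : ∂ (∂ (G * H)) = G * ∂ (∂ H) + 2 * (∂ G * ∂ H) + H * ∂ (∂ G) := by
      rw [d1, map_add, Derivation.leibniz, Derivation.leibniz]
      simp only [smul_eq_mul]; ring
    rw [d2, d1]
    simp only [PowerSeries.smul_eq_C_mul] at e1 e2 e3 ⊢
    have hmC : (PowerSeries.C m : PowerSeries ℝ) =
      PowerSeries.C A + PowerSeries.C B - PowerSeries.C C := by rw [hm]; simp
    simp only [map_add, map_sub, map_mul, map_one, hmC] at e1 e2 e3 ⊢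
    generalize (PowerSeries.C A : PowerSeries ℝ) = a at *
    generalize (PowerSeries.C B : PowerSeries ℝ) = b at *
    generalize (PowerSeries.C C : PowerSeries ℝ) = c at *
    generalize ∂ (∂ G) = G2 at *
    generalize ∂ (∂ H) = H2 at *
    generalize ∂ G = G1 at *
    generalize ∂ H = H1 at *
    -- The first two terms eliminate `G''` and `G'`; what is left is `(1 - X) G` times the equation
    -- of `H`.
    linear_combination (X * (1 - X) * H) * e2 + (2 * X * (1 - X) * H1 + X * (a + b - c + 1) * H +
      (c - (a + b + 1) * X) * H) * e1 + (1 - X) * G * e3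
  have key : ∀ j : ℕ, hc A B C j = coeff j (G * H) := by
    intro j
    induction j with
    | zero => simp [hG, hH, hc_zero, bc_zero]
    | succ j ih =>
      have h1 := hY j
      have h2 := hc_succ A B hC j
      rw [ih, ← h1] at h2
      have : ((j : ℝ) + 1) * (C + j) ≠ 0 := by positivity
      exact mul_left_cancel₀ this h2
  rw [key, coeff_mul]
  simp [hG, hH]

end Formal

/-! ### Factorization and size of the Bergman kernel -/

/-- The power series `(1 - ξ) ^ (-m)`. -/
noncomputable def bs (m : ℝ) (ξ : ℂ) : ℂ := ∑' k : ℕ, (bc m k : ℂ) * ξ ^ k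

lemma ascPochhammer_eval_ofReal (x : ℝ) (k : ℕ) :
    (ascPochhammer ℂ k).eval (x : ℂ) = (rp x k : ℂ) := by
  induction k with
  | zero => simp [rp_zero]
  | succ k ih => rw [ascPochhammer_succ_eval, ih, rp_succ]; push_cast; rfl

lemma ordinaryHypergeometric_ofReal (A B C : ℝ) (ξ : ℂ) :
    ordinaryHypergeometric (A : ℂ) (B : ℂ) (C : ℂ) ξ = ∑' k : ℕ, (hc A B C k : ℂ) * ξ ^ k := by
  rw [ordinaryHypergeometric_eq_tsum]
  refine tsum_congr fun k => ?_
  rw [ascPochhammer_eval_ofReal, ascPochhammer_eval_ofReal, ascPochhammer_eval_ofReal, smul_eq_mul,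
    hc, bc]
  push_cast
  ring

lemma kernelFun_eq_tsum (n : ℕ) (a b : ℝ) (ξ : ℂ) :
    kernelFun n a b ξ = ∑' k : ℕ, (hc n (a + b + n + 1) (b + n) k : ℂ) * ξ ^ k := by
  rw [← ordinaryHypergeometric_ofReal]; simp [kernelFun]

lemma Q_eq_tsum (n : ℕ) (a b : ℝ) (ξ : ℂ) :
    Q n a b ξ = ∑' k : ℕ, (hc b (-(a + 1)) (b + n) k : ℂ) * ξ ^ k := by
  rw [← ordinaryHypergeometric_ofReal, Q]

lemma bs_hasSum (m : ℝ) {ξ : ℂ} (hξ : ‖ξ‖ < 1) :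
    HasSum (fun k : ℕ => (bc m k : ℂ) * ξ ^ k) (bs m ξ) := by
  refine Summable.hasSum (Summable.of_norm ?_)
  simpa using summable_bc_mul_pow m (norm_nonneg ξ) hξ

lemma choose_eq_bc (m : ℝ) (k : ℕ) : Ring.choose ((m : ℂ) + k - 1) k = (bc m k : ℂ) := by
  have h : Ring.choose ((m : ℂ) + k - 1) k = Ring.multichoose (m : ℂ) k := by
    rw [Ring.choose]; congr 1; ring
  have h2 := Ring.factorial_nsmul_multichoose_eq_ascPochhammer (m : ℂ) k
  rw [Polynomial.ascPochhammer_smeval_eq_eval, ascPochhammer_eval_ofReal, nsmul_eq_mul] at h2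
  have : (k.factorial : ℂ) ≠ 0 := by exact_mod_cast k.factorial_ne_zero
  rw [h, bc]; push_cast
  field_simp
  linear_combination h2

/-- Identifies the series with the principal branch. As the exponent is real, its modulus is then a
power of `|1 - ξ|` with no contribution from the argument. -/
lemma bs_eq (m : ℝ) {ξ : ℂ} (hξ : ‖ξ‖ < 1) : bs m ξ = 1 / (1 - ξ) ^ (m : ℂ) := by
  have h := (Complex.one_div_one_sub_cpow_hasFPowerSeriesOnBall_zero (m : ℂ)).hasSum
    (y := ξ) (by simpa [enorm_eq_nnnorm, ← NNReal.coe_lt_one] using hξ)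
  simp only [zero_add, FormalMultilinearSeries.ofScalars_apply_eq, choose_eq_bc, smul_eq_mul] at h
  exact (bs_hasSum m hξ).unique h

lemma one_sub_ne_zero {ξ : ℂ} (hξ : ‖ξ‖ < 1) : (1 - ξ) ≠ 0 := by
  intro h
  rw [← sub_eq_zero.1 h] at hξ
  simp at hξ

lemma norm_one_sub_pos {ξ : ℂ} (hξ : ‖ξ‖ < 1) : 0 < ‖1 - ξ‖ := norm_pos_iff.2 (one_sub_ne_zero hξ)

lemma norm_bs (m : ℝ) {ξ : ℂ} (hξ : ‖ξ‖ < 1) : ‖bs m ξ‖ = ‖1 - ξ‖ ^ (-m) := by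
  rw [bs_eq m hξ, norm_div, norm_one, Complex.norm_cpow_real, Real.rpow_neg (norm_nonneg _), one_div]

lemma bs_ofReal (m : ℝ) {x : ℝ} (h0 : 0 ≤ x) (hx : x < 1) :
    HasSum (fun k : ℕ => bc m k * x ^ k) ((1 - x) ^ (-m)) := by
  have h1 : ‖(x : ℂ)‖ < 1 := by simpa [abs_of_nonneg h0] using hx
  have h := bs_hasSum m h1
  rw [bs_eq m h1] at h
  have e : (1 : ℂ) / (1 - (x : ℂ)) ^ (m : ℂ) = (((1 - x) ^ (-m) : ℝ) : ℂ) := by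
    rw [Real.rpow_neg (by linarith), Complex.ofReal_inv, Complex.ofReal_cpow (by linarith)]
    simp
  rw [e] at h
  exact_mod_cast h

lemma conj_bs (m : ℝ) (ξ : ℂ) : (starRingEnd ℂ) (bs m ξ) = bs m ((starRingEnd ℂ) ξ) := by
  rw [bs, bs, Complex.conj_tsum]
  simp

/-- Euler's transformation with `A = n`, `B = a+b+n+1`, `C = b+n`, so that `A+B-C = a+n+1`, `C-A =
b` and `C-B = -(a+1)`, multiplied out as a Cauchy product. -/
lemma kernelFun_eq_mul (n : ℕ) {a b : ℝ} (hb : 0 < b + n) {ξ : ℂ} (hξ : ‖ξ‖ < 1) :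
    kernelFun n a b ξ = bs (a + n + 1) ξ * Q n a b ξ := by
  have h1 : Summable fun k : ℕ => ‖(bc (a + n + 1) k : ℂ) * ξ ^ k‖ := by
    simpa using summable_bc_mul_pow (a + n + 1) (norm_nonneg ξ) hξ
  have h2 : Summable fun k : ℕ => ‖(hc b (-(a + 1)) (b + n) k : ℂ) * ξ ^ k‖ := by
    simpa using summable_hc_mul_pow (A := b) (B := -(a + 1)) hb (norm_nonneg ξ) hξ
  rw [bs, Q_eq_tsum, tsum_mul_tsum_eq_tsum_sum_antidiagonal_of_summable_norm h1 h2,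
    kernelFun_eq_tsum]
  refine tsum_congr fun k => ?_
  rw [euler_transformation_coeff _ _ hb, Complex.ofReal_sum, Finset.sum_mul]
  refine Finset.sum_congr rfl fun p hp => ?_
  rw [← Finset.HasAntidiagonal.mem_antidiagonal.1 hp, pow_add]
  have e1 : (n : ℝ) + (a + b + n + 1) - (b + n) = a + n + 1 := by ring
  have e2 : b + n - (n : ℝ) = b := by ring
  have e3 : b + n - (a + b + n + 1) = -(a + 1) := by ring
  rw [e1, e2, e3]
  push_cast; ring

/-- The parameters satisfy `b - (a+1) < b + n`, which is the criterion for absolute convergence up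
to the unit circle. -/
lemma Q_summable (n : ℕ) {a b : ℝ} (ha : -1 < a) (hb : 0 < b + n) :
    Summable fun k => |hc b (-(a + 1)) (b + n) k| := by
  refine summable_hc hb ?_
  have : (0 : ℝ) ≤ n := by positivity
  linarith

lemma continuousOn_Q (n : ℕ) {a b : ℝ} (ha : -1 < a) (hb : 0 < b + n) :
    ContinuousOn (Q n a b) (Metric.closedBall 0 1) := by
  have : Q n a b = fun ξ => ∑' k : ℕ, (hc b (-(a + 1)) (b + n) k : ℂ) * ξ ^ k :=
    funext (Q_eq_tsum n a b)
  rw [this]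
  refine continuousOn_tsum (fun k => by fun_prop) (Q_summable n ha hb) fun k ξ hξ => ?_
  rw [norm_mul, norm_pow, Complex.norm_real, Real.norm_eq_abs]
  have : ‖ξ‖ ≤ 1 := by simpa using hξ
  exact mul_le_of_le_one_right (abs_nonneg _) (pow_le_one₀ (norm_nonneg _) this)

lemma exists_norm_kernelFun_le (n : ℕ) {a b : ℝ} (ha : -1 < a) (hb : 0 < b + n) :
    ∃ M, 0 < M ∧ ∀ ξ : ℂ, ‖ξ‖ < 1 → ‖kernelFun n a b ξ‖ ≤ M * ‖1 - ξ‖ ^ (-(a + n + 1)) := by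
  obtain ⟨M, hM⟩ := (isCompact_closedBall (0 : ℂ) 1).exists_bound_of_continuousOn
    (continuousOn_Q n ha hb)
  refine ⟨|M| + 1, by positivity, fun ξ hξ => ?_⟩
  rw [kernelFun_eq_mul n hb hξ, norm_mul, norm_bs _ hξ, mul_comm]
  gcongr
  exact (hM ξ (by simpa using hξ.le)).trans (by linarith [le_abs_self M])

/-- The continuous function `|Q|` attains a minimum on the compact closed disc, and this minimum is
positive when `Q` has no zeros there. -/
lemma exists_le_norm_kernelFun (n : ℕ) {a b : ℝ} (ha : -1 < a) (hb : 0 < b + n)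
    (hQ : ∀ ξ : ℂ, ‖ξ‖ ≤ 1 → Q n a b ξ ≠ 0) :
    ∃ c, 0 < c ∧ ∀ ξ : ℂ, ‖ξ‖ < 1 → c * ‖1 - ξ‖ ^ (-(a + n + 1)) ≤ ‖kernelFun n a b ξ‖ := by
  obtain ⟨x, hx, hmin⟩ := (isCompact_closedBall (0 : ℂ) 1).exists_isMinOn
    ⟨0, by simp⟩ (continuousOn_Q n ha hb).norm
  refine ⟨‖Q n a b x‖, norm_pos_iff.2 (hQ x (by simpa using hx)), fun ξ hξ => ?_⟩
  rw [kernelFun_eq_mul n hb hξ, norm_mul, norm_bs _ hξ, mul_comm]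
  gcongr
  exact hmin (by simpa using hξ.le)

lemma hasSum_kernelFun (n : ℕ) {a b : ℝ} (hb : 0 < b + n) {ξ : ℂ} (hξ : ‖ξ‖ < 1) :
    HasSum (fun k : ℕ => (hc n (a + b + n + 1) (b + n) k : ℂ) * ξ ^ k) (kernelFun n a b ξ) := by
  rw [kernelFun_eq_tsum]
  refine Summable.hasSum (Summable.of_norm ?_)
  simpa using summable_hc_mul_pow (A := n) (B := a + b + n + 1) hb (norm_nonneg ξ) hξ

/-! ### Averaging over circles -/

/-- Integrals over a measure are unchanged by averaging along a measure preserving loop. -/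
lemma integral_eq_integral_loop_average {E : Type*} [MeasurableSpace E] {μ : Measure E} [SFinite μ]
    {T : ℝ → E → E} (hT : Measurable (Function.uncurry T)) (hp : ∀ θ, MeasurePreserving (T θ) μ μ)
    {F G : E → ℂ} (hF : Integrable F μ)
    (hG : ∀ᵐ w ∂μ, ∫ θ in (0 : ℝ)..2 * Real.pi, F (T θ w) = 2 * Real.pi * G w) :
    Integrable G μ ∧ ∫ w, F w ∂μ = ∫ w, G w ∂μ := by
  have hpi : (0 : ℝ) ≤ 2 * Real.pi := by positivity
  have hpi' : (2 * Real.pi : ℂ) ≠ 0 := by exact_mod_cast (by positivity : (2 * Real.pi : ℝ) ≠ 0)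
  set ν : Measure ℝ := volume.restrict (Set.Ioc 0 (2 * Real.pi)) with hν
  -- The map `(θ, w) ↦ (θ, T θ w)` preserves the product measure, so Fubini applies to `F (T θ w)`.
  have hmp : MeasurePreserving (fun p : ℝ × E => (p.1, T p.1 p.2)) (ν.prod μ) (ν.prod μ) :=
    (MeasurePreserving.id ν).skew_product hT (ae_of_all _ fun θ => (hp θ).map_eq)
  have hI : Integrable (fun p : ℝ × E => F (T p.1 p.2)) (ν.prod μ) :=
    hmp.integrable_comp_of_integrable (hF.comp_snd ν)
  have hI2 := hI.integral_prod_right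
  have hG' : (fun w => ∫ θ, F (T θ w) ∂ν) =ᵐ[μ] fun w => 2 * Real.pi * G w := by
    filter_upwards [hG] with w hw
    rw [← hw, intervalIntegral.integral_of_le hpi]
  refine ⟨?_, ?_⟩
  · have := (hI2.congr hG').const_mul (2 * Real.pi : ℂ)⁻¹
    simpa [← mul_assoc, hpi'] using this
  · have h1 : ∫ θ, ∫ w, F (T θ w) ∂μ ∂ν = 2 * Real.pi * ∫ w, F w ∂μ := by
      have : ∀ θ, ∫ w, F (T θ w) ∂μ = ∫ w, F w ∂μ := fun θ => by
        have h := integral_map (hp θ).measurable.aemeasurable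
          (f := F) (by rw [(hp θ).map_eq]; exact hF.1)
        rw [(hp θ).map_eq] at h
        exact h.symm
      simp only [this, integral_const, hν, measureReal_restrict_apply_univ]
      simp [hpi]
    rw [integral_integral_swap hI, integral_congr_ae hG', integral_const_mul] at h1
    exact (mul_left_cancel₀ hpi' h1).symm

lemma integral_exp_int_mul {m : ℤ} (hm : m ≠ 0) :
    ∫ θ in (0 : ℝ)..2 * Real.pi, Complex.exp (m * (θ * Complex.I)) = 0 := by
  have hc : (m * Complex.I : ℂ) ≠ 0 := by simp [hm]
  have := integral_exp_mul_complex (a := 0) (b := 2 * Real.pi) hc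
  rw [show (fun θ : ℝ => Complex.exp (m * (θ * Complex.I))) =
    fun θ : ℝ => Complex.exp (m * Complex.I * θ) by ext; congr 1; ring, this]
  have e : Complex.exp (m * Complex.I * (2 * Real.pi : ℝ)) = 1 := by
    rw [Complex.exp_eq_one_iff]; exact ⟨m, by push_cast; ring⟩
  rw [e]; simp

/-- Cauchy's formula for the `k`-th term of a power series. -/
lemma integral_circle_of_hasSum {R : ℝ} {φ : ℂ → ℂ} {a : ℕ → ℂ}
    (h : ∀ t : ℂ, ‖t‖ < R → HasSum (fun k => a k * t ^ k) (φ t)) {s : ℂ} (hs : ‖s‖ < R) (k : ℕ) :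
    ∫ θ in (0 : ℝ)..2 * Real.pi,
      φ (Complex.exp (θ * Complex.I) * s) * Complex.exp (-(k * (θ * Complex.I))) =
      2 * Real.pi * (a k * s ^ k) := by
  have hsum : Summable fun j => ‖a j * s ^ j‖ := (h s hs).summable.norm
  have key := intervalIntegral.hasSum_integral_of_dominated_convergence (μ := volume)
    (a := 0) (b := 2 * Real.pi)
    (F := fun j (θ : ℝ) => a j * (Complex.exp (θ * Complex.I) * s) ^ j *
      Complex.exp (-(k * (θ * Complex.I))))
    (f := fun θ : ℝ => φ (Complex.exp (θ * Complex.I) * s) *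
      Complex.exp (-(k * (θ * Complex.I))))
    (fun j _ => ‖a j * s ^ j‖)
    (fun j => by
      refine Continuous.aestronglyMeasurable ?_
      fun_prop)
    (fun j => ae_of_all _ fun θ _ => by
      have : ‖Complex.exp (-(k * (θ * Complex.I)))‖ = 1 := by
        have := Complex.norm_exp_ofReal_mul_I (-(k * θ))
        rwa [show (((-(k * θ) : ℝ)) : ℂ) * Complex.I = -(k * (θ * Complex.I)) by
          push_cast; ring] at this
      rw [norm_mul, this, mul_one, mul_pow, norm_mul, norm_mul, norm_mul, norm_pow,
        Complex.norm_exp_ofReal_mul_I, one_pow, one_mul])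
    (ae_of_all _ fun θ _ => hsum)
    intervalIntegrable_const
    (ae_of_all _ fun θ _ => by
      refine (h _ ?_).mul_right _
      rwa [norm_mul, Complex.norm_exp_ofReal_mul_I, one_mul])
  have hterm : ∀ j, ∫ θ in (0 : ℝ)..2 * Real.pi, a j * (Complex.exp (θ * Complex.I) * s) ^ j *
      Complex.exp (-(k * (θ * Complex.I))) = if j = k then 2 * Real.pi * (a k * s ^ k) else 0 := by
    intro j
    have e : ∀ θ : ℝ, a j * (Complex.exp (θ * Complex.I) * s) ^ j *
        Complex.exp (-(k * (θ * Complex.I))) =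
        a j * s ^ j * Complex.exp (((j - k : ℤ) : ℂ) * (θ * Complex.I)) := by
      intro θ
      rw [mul_pow, ← Complex.exp_nat_mul,
        show a j * (Complex.exp (j * (θ * Complex.I)) * s ^ j) * Complex.exp (-(k * (θ * Complex.I)))
          = a j * s ^ j * (Complex.exp (j * (θ * Complex.I)) * Complex.exp (-(k * (θ * Complex.I))))
          by ring, ← Complex.exp_add]
      congr 2; push_cast; ring
    simp only [e, intervalIntegral.integral_const_mul]
    split_ifs with hjk
    · subst hjk; simp; ring
    · rw [integral_exp_int_mul (by omega), mul_zero]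
  simp only [hterm] at key
  rw [← key.tsum_eq, tsum_ite_eq]

/-- Mean value property on the unit circle. -/
lemma integral_circle_mean_value {φ : ℂ → ℂ} (h : DifferentiableOn ℂ φ (Metric.closedBall 0 1)) :
    ∫ θ in (0 : ℝ)..2 * Real.pi, φ (Complex.exp (θ * Complex.I)) = 2 * Real.pi * φ 0 := by
  have h1 : DiffContOnCl ℂ φ (Metric.ball 0 |1|) := by
    refine DifferentiableOn.diffContOnCl ?_
    rwa [abs_one, closure_ball _ one_ne_zero]
  have := h1.circleAverage
  rw [Real.circleAverage_def] at this
  simp only [circleMap, zero_add, Complex.ofReal_one, one_mul] at this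
  rw [← this]
  have hpi' : (2 * Real.pi : ℂ) ≠ 0 := by exact_mod_cast (by positivity : (2 * Real.pi : ℝ) ≠ 0)
  rw [Complex.real_smul]; push_cast; rw [← mul_assoc, mul_inv_cancel₀ hpi', one_mul]

/-! ### Rotations of the ball and slices of holomorphic functions -/

variable {n : ℕ}

/-- The coefficient of the orthogonal projection onto `ℂ z`. -/
noncomputable def lineCoeff (z w : Cn n) : ℂ := inner ℂ z w / (‖z‖ : ℂ) ^ 2

lemma continuous_lineCoeff (z : Cn n) : Continuous (lineCoeff z) := by
  unfold lineCoeff; fun_prop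

lemma inner_sub_line {z : Cn n} (hz : z ≠ 0) (w : Cn n) :
    inner ℂ z (w - lineCoeff z w • z) = (0 : ℂ) := by
  have : (‖z‖ : ℂ) ≠ 0 := by simpa using hz
  rw [inner_sub_right, inner_smul_right, inner_self_eq_norm_sq_to_K, lineCoeff]
  simp [this]

lemma norm_sq_line_add {z : Cn n} (hz : z ≠ 0) (w : Cn n) (t : ℂ) :
    ‖lineCoeff z w • z + t • (w - lineCoeff z w • z)‖ ^ 2 =
      ‖lineCoeff z w • z‖ ^ 2 + ‖t‖ ^ 2 * ‖w - lineCoeff z w • z‖ ^ 2 := by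
  have h := norm_add_sq_eq_norm_sq_add_norm_sq_of_inner_eq_zero (𝕜 := ℂ)
    (lineCoeff z w • z) (t • (w - lineCoeff z w • z))
    (by rw [inner_smul_left, inner_smul_right, inner_sub_line hz]; simp)
  rw [← sq, ← sq, ← sq] at h
  rw [h, norm_smul t, mul_pow]

/-- Fixing the line `ℂ z` and multiplying its orthogonal complement by a unit scalar preserves norms
by Pythagoras. -/
lemma exists_isometry_line {z : Cn n} (hz : z ≠ 0) {u : ℂ} (hu : ‖u‖ = 1) :
    ∃ T : Cn n ≃ₗᵢ[ℝ] Cn n, ∀ w, T w = lineCoeff z w • z + u • (w - lineCoeff z w • z) := by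
  let P : Cn n →ₗ[ℝ] Cn n :=
    { toFun := fun w => lineCoeff z w • z + u • (w - lineCoeff z w • z)
      map_add' := fun w v => by
        have : lineCoeff z (w + v) = lineCoeff z w + lineCoeff z v := by
          simp [lineCoeff, add_div]
        rw [this]; module
      map_smul' := fun r w => by
        have : lineCoeff z (r • w) = (r : ℂ) * lineCoeff z w := by
          rw [lineCoeff, lineCoeff, ← Complex.coe_smul, inner_smul_right, mul_div_assoc]
        simp only [this, RingHom.id_apply]
        simp only [← Complex.coe_smul]
        module }
  have hP : ∀ w, ‖P w‖ = ‖w‖ := by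
    intro w
    have h1 := norm_sq_line_add hz w u
    have h2 := norm_sq_line_add hz w 1
    rw [hu] at h1
    rw [norm_one, one_smul, add_sub_cancel, ← h1] at h2
    exact ((sq_eq_sq₀ (norm_nonneg _) (norm_nonneg _)).1 h2).symm
  exact ⟨LinearIsometry.toLinearIsometryEquiv ⟨P, hP⟩ rfl, fun w => rfl⟩

lemma exists_isometry_smul {u : ℂ} (hu : ‖u‖ = 1) :
    ∃ T : Cn n ≃ₗᵢ[ℝ] Cn n, ∀ w, T w = u • w := by
  let P : Cn n →ₗ[ℝ] Cn n :=
    { toFun := fun w => u • w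
      map_add' := fun w v => by module
      map_smul' := fun r w => by
        simp only [RingHom.id_apply]
        rw [smul_comm] }
  have hP : ∀ w, ‖P w‖ = ‖w‖ := fun w => by
    change ‖u • w‖ = _
    rw [norm_smul, hu, one_mul]
  exact ⟨LinearIsometry.toLinearIsometryEquiv ⟨P, hP⟩ rfl, fun w => rfl⟩

lemma measurable_rot (n : ℕ) :
    Measurable (Function.uncurry fun (θ : ℝ) (w : Cn n) => Complex.exp (θ * Complex.I) • w) := by
  refine Continuous.measurable ?_
  simp only [Function.uncurry_def]
  fun_prop

lemma norm_exp_I (θ : ℝ) : ‖Complex.exp (θ * Complex.I)‖ = 1 := Complex.norm_exp_ofReal_mul_I θ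

/-- A measure that is carried by the unit ball and invariant under linear isometries. -/
structure IsRotInvariant (μ : Measure (Cn n)) : Prop where
  sfinite : SFinite μ
  preserving : ∀ T : Cn n ≃ₗᵢ[ℝ] Cn n, MeasurePreserving T μ μ
  ae_mem : ∀ᵐ w ∂μ, w ∈ unitBall n

lemma mem_unitBall {w : Cn n} : w ∈ unitBall n ↔ ‖w‖ < 1 := by simp [unitBall]

lemma norm_inner_lt_one {z w : Cn n} (hz : ‖z‖ < 1) (hw : ‖w‖ < 1) : ‖inner ℂ w z‖ < 1 :=
  (norm_inner_le_norm w z).trans_lt (by nlinarith [norm_nonneg z, norm_nonneg w])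

/-- Integrating a holomorphic function against a power of `⟨z, w⟩` picks out one coefficient of its
restriction to the complex line through `z`. -/
lemma integral_mul_inner_pow {μ : Measure (Cn n)} (hμ : IsRotInvariant μ) {z : Cn n} (hz : z ≠ 0)
    {g : Cn n → ℂ} (hg : DifferentiableOn ℂ g (unitBall n)) (hint : Integrable g μ) {a : ℕ → ℂ}
    (ha : ∀ t : ℂ, ‖t‖ * ‖z‖ < 1 → HasSum (fun k => a k * t ^ k) (g (t • z))) (k : ℕ) :
    ∫ w, g w * (inner ℂ w z) ^ k ∂μ =
      a k * ((‖z‖ ^ (2 * k))⁻¹ * ∫ w, ‖(inner ℂ w z : ℂ)‖ ^ (2 * k) ∂μ : ℝ) := by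
  have := hμ.sfinite
  have hz0 : 0 < ‖z‖ := norm_pos_iff.2 hz
  have hzc : (‖z‖ : ℂ) ≠ 0 := by simpa using hz
  have hF : Integrable (fun w => g w * (inner ℂ w z) ^ k) μ := by
    refine hint.mul_bdd (c := ‖z‖ ^ k) (Continuous.aestronglyMeasurable (by fun_prop)) ?_
    filter_upwards [hμ.ae_mem] with w hw
    rw [norm_pow]
    gcongr
    refine (norm_inner_le_norm w z).trans ?_
    have := (mem_unitBall.1 hw).le
    nlinarith [norm_nonneg z]
  have hline : ∀ w : Cn n, w ∈ unitBall n → ‖lineCoeff z w • z‖ < 1 ∧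
      ∀ t : ℂ, ‖t‖ ≤ 1 → lineCoeff z w • z + t • (w - lineCoeff z w • z) ∈ unitBall n := by
    intro w hw
    have h2 := norm_sq_line_add hz w 1
    rw [norm_one, one_smul, add_sub_cancel, one_pow, one_mul] at h2
    have hw' := mem_unitBall.1 hw
    have h3 : ‖w‖ ^ 2 < 1 := by nlinarith [norm_nonneg w]
    constructor
    · have : ‖lineCoeff z w • z‖ ^ 2 < 1 := by nlinarith [sq_nonneg ‖w - lineCoeff z w • z‖]
      exact (sq_lt_one_iff₀ (norm_nonneg _)).1 this
    · intro t ht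
      rw [mem_unitBall, ← sq_lt_one_iff₀ (norm_nonneg _), norm_sq_line_add hz]
      have : ‖t‖ ^ 2 ≤ 1 := pow_le_one₀ (norm_nonneg _) ht
      nlinarith [sq_nonneg ‖w - lineCoeff z w • z‖]
  -- Rotating only the component of `w` orthogonal to `z` leaves `⟨z, w⟩` unchanged; the mean value
  -- property then replaces `g w` by its value at the projection of `w` onto `ℂ z`.
  obtain ⟨hI2, e1⟩ := integral_eq_integral_loop_average (μ := μ)
    (T := fun θ w => lineCoeff z w • z + Complex.exp (θ * Complex.I) • (w - lineCoeff z w • z))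
    (G := fun w => g (lineCoeff z w • z) * (inner ℂ w z) ^ k)
    (by
      refine Continuous.measurable ?_
      have := continuous_lineCoeff z
      simp only [Function.uncurry_def]
      fun_prop)
    (fun θ => by
      obtain ⟨T, hT⟩ := exists_isometry_line hz (norm_exp_I θ)
      rw [← funext hT]
      exact hμ.preserving T) hF
    (by
      filter_upwards [hμ.ae_mem] with w hw
      have hin : ∀ t : ℂ, inner ℂ (lineCoeff z w • z + t • (w - lineCoeff z w • z)) z =
          inner ℂ w z := by
        intro t
        have h0 : inner ℂ (w - lineCoeff z w • z) z = (0 : ℂ) := by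
          rw [← inner_conj_symm, inner_sub_line hz, map_zero]
        rw [inner_add_left, inner_smul_left _ _ t, h0, mul_zero, add_zero]
        rw [inner_sub_left, sub_eq_zero] at h0
        exact h0.symm
      have hd : DifferentiableOn ℂ (fun t : ℂ =>
          g (lineCoeff z w • z + t • (w - lineCoeff z w • z)) * (inner ℂ w z) ^ k)
          (Metric.closedBall 0 1) := by
        refine DifferentiableOn.mul_const ?_ _
        refine hg.comp (by fun_prop) fun t ht => (hline w hw).2 t (by simpa using ht)
      have := integral_circle_mean_value hd
      simp only [zero_smul, add_zero] at this
      simp only [hin]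
      exact this)
  -- Rotating all of `w` now acts on a function of one variable, and the factor `⟨z, w⟩^k` selects
  -- its `k`-th Taylor coefficient.
  obtain ⟨-, e2⟩ := integral_eq_integral_loop_average (μ := μ)
    (T := fun θ w => Complex.exp (θ * Complex.I) • w)
    (G := fun w => a k * (((‖z‖ ^ (2 * k))⁻¹ * ‖(inner ℂ w z : ℂ)‖ ^ (2 * k) : ℝ) : ℂ))
    (measurable_rot n)
    (fun θ => by
      obtain ⟨T, hT⟩ := exists_isometry_smul (n := n) (norm_exp_I θ)
      rw [← funext hT]
      exact hμ.preserving T) hI2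
    (by
      filter_upwards [hμ.ae_mem] with w hw
      have hs : ‖lineCoeff z w‖ < ‖z‖⁻¹ := by
        have := (hline w hw).1
        rw [norm_smul] at this
        rwa [inv_eq_one_div, lt_div_iff₀ hz0]
      have key := integral_circle_of_hasSum (R := ‖z‖⁻¹) (φ := fun t => g (t • z)) (a := a)
        (fun t ht => ha t (by rwa [← lt_div_iff₀ hz0, one_div])) hs k
      have hint : ∀ θ : ℝ, g (lineCoeff z (Complex.exp (θ * Complex.I) • w) • z) *
          (inner ℂ (Complex.exp (θ * Complex.I) • w) z) ^ k =
          g ((Complex.exp (θ * Complex.I) * lineCoeff z w) • z) *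
            Complex.exp (-(k * (θ * Complex.I))) * (inner ℂ w z) ^ k := by
        intro θ
        have e1 : lineCoeff z (Complex.exp (θ * Complex.I) • w) =
            Complex.exp (θ * Complex.I) * lineCoeff z w := by
          rw [lineCoeff, lineCoeff, inner_smul_right, mul_div_assoc]
        rw [e1, inner_smul_left, mul_pow, ← Complex.exp_conj, ← Complex.exp_nat_mul]
        simp only [map_mul, Complex.conj_ofReal, Complex.conj_I, mul_neg]
        ring
      simp only [hint, intervalIntegral.integral_mul_const, key]
      have e3 : (lineCoeff z w) ^ k * (inner ℂ w z) ^ k =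
          (((‖z‖ ^ (2 * k))⁻¹ * ‖(inner ℂ w z : ℂ)‖ ^ (2 * k) : ℝ) : ℂ) := by
        have e4 : inner ℂ z w * inner ℂ w z = ((‖(inner ℂ w z : ℂ)‖ : ℂ)) ^ 2 := by
          rw [← inner_conj_symm z w, Complex.conj_mul']
        rw [← mul_pow, lineCoeff, div_mul_eq_mul_div, e4]
        push_cast
        rw [div_pow, pow_mul, pow_mul, div_eq_inv_mul]
      rw [← e3]; ring)
  rw [e1, e2, integral_const_mul, integral_complex_ofReal, integral_const_mul]

/-! ### Moments of the Gaussian, of the sphere and of the ball -/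

lemma finrank_Cn (n : ℕ) : Module.finrank ℝ (Cn n) = 2 * n := by
  rw [finrank_real_of_complex, finrank_euclideanSpace, Fintype.card_fin]

lemma integral_gaussian_Cn (n : ℕ) {s : ℝ} (hs : 0 < s) :
    ∫ w : Cn n, Real.exp (-s * ‖w‖ ^ 2) = (Real.pi / s) ^ n := by
  have := GaussianFourier.integral_rexp_neg_mul_sq_norm (V := Cn n) hs
  rw [this, finrank_Cn]
  push_cast
  rw [mul_div_cancel_left₀ _ (two_ne_zero), Real.rpow_natCast]

lemma integrable_gaussian_Cn (n : ℕ) {s : ℝ} (hs : 0 < s) :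
    Integrable fun w : Cn n => Real.exp (-s * ‖w‖ ^ 2) := by
  -- A non-integrable function has Bochner integral 0 by convention, so a nonzero value proves
  -- integrability.
  refine not_imp_comm.1 integral_undef ?_
  rw [integral_gaussian_Cn n hs]
  positivity

lemma measurePreserving_smul_Cn {u : ℂ} (hu : ‖u‖ = 1) :
    MeasurePreserving (fun w : Cn n => u • w) volume volume := by
  obtain ⟨T, hT⟩ := exists_isometry_smul (n := n) hu
  rw [← funext hT]
  exact T.measurePreserving

/-- The Gaussian moments of a linear functional. -/
lemma integral_inner_pow_gaussian (z : Cn n) (k : ℕ) :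
    ∫ w : Cn n, ‖(inner ℂ w z : ℂ)‖ ^ (2 * k) * Real.exp (-‖w‖ ^ 2) =
      k.factorial * Real.pi ^ n * ‖z‖ ^ (2 * k) := by
  have hk0 : (k.factorial : ℂ) ≠ 0 := by exact_mod_cast k.factorial_ne_zero
  -- The integral of `F` is evaluated twice. Averaging over rotations extracts the `k`-th term of
  -- the exponential and gives the moment divided by `k!`; translating by `z` first gives `π^n
  -- ‖z‖^(2k)`.
  set F : Cn n → ℂ := fun w => (inner ℂ w z) ^ k * Complex.exp (inner ℂ z w) *
    (Real.exp (-‖w‖ ^ 2) : ℝ) with hFdef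
  have hF : Integrable F := by
    refine Integrable.mono' (g := fun w : Cn n => k.factorial * Real.exp (2 * ‖z‖ ^ 2) *
      Real.exp (-(1 / 2) * ‖w‖ ^ 2)) ((integrable_gaussian_Cn n (by norm_num)).const_mul _)
      (Continuous.aestronglyMeasurable (by rw [hFdef]; fun_prop)) (ae_of_all _ fun w => ?_)
    have h1 : ‖(inner ℂ w z : ℂ)‖ ≤ ‖w‖ * ‖z‖ := norm_inner_le_norm w z
    have h2 : ‖(inner ℂ w z : ℂ)‖ ^ k ≤ k.factorial * Real.exp (‖w‖ * ‖z‖) := by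
      have := Real.pow_div_factorial_le_exp (‖w‖ * ‖z‖) (by positivity) k
      rw [div_le_iff₀ (by positivity)] at this
      calc _ ≤ (‖w‖ * ‖z‖) ^ k := by gcongr
        _ ≤ _ := by linarith
    have h3 : ‖Complex.exp (inner ℂ z w)‖ ≤ Real.exp (‖w‖ * ‖z‖) := by
      rw [Complex.norm_exp]
      refine Real.exp_le_exp.2 ((Complex.re_le_norm _).trans ?_)
      rw [mul_comm]; exact norm_inner_le_norm z w
    rw [hFdef]
    simp only [norm_mul, norm_pow, Complex.norm_real, Real.norm_eq_abs, Real.abs_exp]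
    calc _ ≤ (k.factorial * Real.exp (‖w‖ * ‖z‖)) * Real.exp (‖w‖ * ‖z‖) *
          Real.exp (-‖w‖ ^ 2) := by gcongr
      _ = k.factorial * Real.exp (‖w‖ * ‖z‖ + ‖w‖ * ‖z‖ + -‖w‖ ^ 2) := by
          rw [Real.exp_add, Real.exp_add]; ring
      _ ≤ k.factorial * Real.exp (2 * ‖z‖ ^ 2 + -(1 / 2) * ‖w‖ ^ 2) := by
          have h4 : ‖w‖ * ‖z‖ + ‖w‖ * ‖z‖ + -‖w‖ ^ 2 ≤ 2 * ‖z‖ ^ 2 + -(1 / 2) * ‖w‖ ^ 2 := by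
            nlinarith [sq_nonneg (2 * ‖z‖ - ‖w‖)]
          have h5 := Real.exp_le_exp.2 h4
          gcongr
      _ = _ := by rw [Real.exp_add]; ring
  obtain ⟨-, e1⟩ := integral_eq_integral_loop_average (μ := (volume : Measure (Cn n)))
    (T := fun θ w => Complex.exp (θ * Complex.I) • w)
    (G := fun w => (((k.factorial : ℝ)⁻¹ * (‖(inner ℂ w z : ℂ)‖ ^ (2 * k) *
      Real.exp (-‖w‖ ^ 2)) : ℝ) : ℂ))
    (measurable_rot n) (fun θ => measurePreserving_smul_Cn (norm_exp_I θ)) hF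
    (ae_of_all _ fun w => by
      have key := integral_circle_of_hasSum (R := ‖(inner ℂ z w : ℂ)‖ + 1) (φ := Complex.exp)
        (a := fun j => (j.factorial : ℂ)⁻¹)
        (fun t _ => by
          have := NormedSpace.expSeries_div_hasSum_exp t
          rw [← Complex.exp_eq_exp_ℂ] at this
          simpa [div_eq_inv_mul] using this) (lt_add_one _) k
      have hint : ∀ θ : ℝ, F (Complex.exp (θ * Complex.I) • w) =
          Complex.exp (Complex.exp (θ * Complex.I) * inner ℂ z w) *
            Complex.exp (-(k * (θ * Complex.I))) *
            ((inner ℂ w z) ^ k * (Real.exp (-‖w‖ ^ 2) : ℝ)) := by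
        intro θ
        rw [hFdef]
        simp only [inner_smul_left, inner_smul_right, mul_pow, ← Complex.exp_conj,
          ← Complex.exp_nat_mul, norm_smul, norm_exp_I, one_mul, map_mul, Complex.conj_ofReal,
          Complex.conj_I, mul_neg]
        ring
      simp only [hint, intervalIntegral.integral_mul_const, key]
      have e4 : inner ℂ z w * inner ℂ w z = ((‖(inner ℂ w z : ℂ)‖ : ℂ)) ^ 2 := by
        rw [← inner_conj_symm z w, Complex.conj_mul']
      push_cast
      rw [pow_mul, ← e4]
      ring)
  -- After translation by `z` the factor holomorphic in `w` cancels against the Gaussian. Up to the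
  -- radial factor `exp (-‖w‖ ^ 2)`, the remaining integrand is antiholomorphic in `w`, so its
  -- rotation average is its value at `w = 0`.
  have hT : ∫ w, F w = ∫ w, F (w + z) := (integral_add_right_eq_self F z).symm
  have hF' : Integrable fun w => F (w + z) := hF.comp_add_right z
  have hFz : ∀ w, F (w + z) = (inner ℂ w z + (‖z‖ : ℂ) ^ 2) ^ k * Complex.exp (-inner ℂ w z) *
      (Real.exp (-‖w‖ ^ 2) : ℝ) := by
    intro w
    have h2 : ((‖w + z‖ : ℝ) : ℂ) ^ 2 =
        (‖w‖ : ℂ) ^ 2 + inner ℂ w z + inner ℂ z w + (‖z‖ : ℂ) ^ 2 := by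
      have h3 : ∀ v : Cn n, ((‖v‖ : ℝ) : ℂ) ^ 2 = inner ℂ v v := fun v =>
        (inner_self_eq_norm_sq_to_K v).symm
      rw [h3, h3, h3, inner_add_left, inner_add_right, inner_add_right]; ring
    have hz2 : inner ℂ z z = (‖z‖ : ℂ) ^ 2 := inner_self_eq_norm_sq_to_K z
    rw [hFdef]
    simp only [inner_add_left, inner_add_right, hz2, Complex.ofReal_exp, Complex.ofReal_neg,
      Complex.ofReal_pow]
    rw [mul_assoc, ← Complex.exp_add, mul_assoc, ← Complex.exp_add, h2]
    congr 2; ring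
  obtain ⟨-, e2⟩ := integral_eq_integral_loop_average (μ := (volume : Measure (Cn n)))
    (T := fun θ w => Complex.exp ((-θ : ℝ) * Complex.I) • w)
    (G := fun w => ((‖z‖ ^ (2 * k) * Real.exp (-1 * ‖w‖ ^ 2) : ℝ) : ℂ))
    ((measurable_rot n).comp (measurable_fst.neg.prodMk measurable_snd))
    (fun θ => measurePreserving_smul_Cn (norm_exp_I _)) hF'
    (ae_of_all _ fun w => by
      have hd : DifferentiableOn ℂ (fun t : ℂ => (t * inner ℂ w z + (‖z‖ : ℂ) ^ 2) ^ k *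
          Complex.exp (-(t * inner ℂ w z)) * (Real.exp (-‖w‖ ^ 2) : ℝ))
          (Metric.closedBall 0 1) := by fun_prop
      have := integral_circle_mean_value hd
      have hint : ∀ θ : ℝ, F (Complex.exp ((-θ : ℝ) * Complex.I) • w + z) =
          (Complex.exp (θ * Complex.I) * inner ℂ w z + (‖z‖ : ℂ) ^ 2) ^ k *
          Complex.exp (-(Complex.exp (θ * Complex.I) * inner ℂ w z)) *
            (Real.exp (-‖w‖ ^ 2) : ℝ) := by
        intro θ
        rw [hFz, inner_smul_left, norm_smul, norm_exp_I, one_mul, ← Complex.exp_conj]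
        simp
      simp only [hint, this]
      simp [pow_mul])
  rw [hT, e2, integral_complex_ofReal, integral_complex_ofReal, integral_const_mul,
    integral_const_mul, integral_gaussian_Cn n one_pos, div_one] at e1
  have e3 := Complex.ofReal_injective e1
  have hk : (k.factorial : ℝ) ≠ 0 := by exact_mod_cast k.factorial_ne_zero
  field_simp at e3
  rw [← e3]; ring

/-- Polar coordinates for the product of a homogeneous and a radial function. -/
lemma lintegral_homogeneous_mul_radial (hn : 1 ≤ n) (z : Cn n) (k : ℕ) {ρ : ℝ → ℝ≥0∞}
    (hρ : Measurable ρ) :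
    ∫⁻ w : Cn n, ENNReal.ofReal (‖(inner ℂ w z : ℂ)‖ ^ (2 * k)) * ρ ‖w‖ =
      (∫⁻ ζ, ENNReal.ofReal (‖(inner ℂ (ζ : Cn n) z : ℂ)‖ ^ (2 * k))
        ∂(volume : Measure (Cn n)).toSphere) *
      ∫⁻ r in Set.Ioi (0 : ℝ), ENNReal.ofReal (r ^ (2 * (n + k) - 1)) * ρ r := by
  -- Since `n ≥ 1` the origin is a null set and can be removed before passing to polar coordinates.
  have : Nonempty (Fin n) := ⟨⟨0, hn⟩⟩
  have hmp := (volume : Measure (Cn n)).measurePreserving_homeomorphUnitSphereProd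
  set f : Cn n → ℝ≥0∞ := fun w => ENNReal.ofReal (‖(inner ℂ w z : ℂ)‖ ^ (2 * k)) * ρ ‖w‖ with hf
  have hfm : Measurable f := by
    rw [hf]
    refine Measurable.mul (ENNReal.continuous_ofReal.comp (by fun_prop)).measurable (hρ.comp measurable_norm)
  calc ∫⁻ w, f w = ∫⁻ w in ({0}ᶜ : Set (Cn n)), f w := by rw [restrict_compl_singleton]
    _ = ∫⁻ w : ({0}ᶜ : Set (Cn n)), f w ∂(volume.comap Subtype.val) :=
        (lintegral_subtype_comap (measurableSet_singleton _).compl f).symm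
    _ = ∫⁻ p : Metric.sphere (0 : Cn n) 1 × Set.Ioi (0 : ℝ),
        ENNReal.ofReal (‖(inner ℂ (p.1 : Cn n) z : ℂ)‖ ^ (2 * k)) *
          (ENNReal.ofReal ((p.2 : ℝ) ^ (2 * k)) * ρ p.2)
        ∂((volume : Measure (Cn n)).toSphere.prod (Measure.volumeIoiPow _)) := by
        rw [← hmp.lintegral_comp (by
          refine Measurable.mul (ENNReal.continuous_ofReal.comp (by fun_prop)).measurable ?_
          exact (ENNReal.continuous_ofReal.comp (by fun_prop)).measurable.mul
            (hρ.comp (measurable_subtype_coe.comp measurable_snd)))]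
        refine lintegral_congr fun w => ?_
        have hw : 0 < ‖(w : Cn n)‖ := norm_pos_iff.2 w.2
        rw [hf]
        simp only [homeomorphUnitSphereProd_apply_fst_coe, homeomorphUnitSphereProd_apply_snd_coe]
        rw [← mul_assoc, ← ENNReal.ofReal_mul (by positivity), ← mul_pow]
        congr 3
        rw [← Complex.coe_smul, inner_smul_left, norm_mul]
        simp
        field_simp
    _ = _ := by
        rw [lintegral_prod_mul (f := fun ζ : Metric.sphere (0 : Cn n) 1 =>
            ENNReal.ofReal (‖(inner ℂ (ζ : Cn n) z : ℂ)‖ ^ (2 * k)))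
            (g := fun r : Set.Ioi (0 : ℝ) => ENNReal.ofReal ((r : ℝ) ^ (2 * k)) * ρ r)
          (ENNReal.continuous_ofReal.comp (by fun_prop)).aemeasurable
          (((ENNReal.continuous_ofReal.comp (by fun_prop)).measurable.mul
            (hρ.comp measurable_subtype_coe)).aemeasurable)]
        congr 1
        rw [Measure.volumeIoiPow, lintegral_withDensity_eq_lintegral_mul
          (f := fun r : Set.Ioi (0 : ℝ) => ENNReal.ofReal ((r : ℝ) ^ (Module.finrank ℝ (Cn n) - 1)))
          (g := fun r : Set.Ioi (0 : ℝ) => ENNReal.ofReal ((r : ℝ) ^ (2 * k)) * ρ r) _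
          (ENNReal.continuous_ofReal.comp (by fun_prop)).measurable
          ((ENNReal.continuous_ofReal.comp (by fun_prop)).measurable.mul
            (hρ.comp measurable_subtype_coe)),
          ← lintegral_subtype_comap measurableSet_Ioi]
        refine lintegral_congr fun r => ?_
        have hr : (0 : ℝ) < r := r.2
        simp only [Pi.mul_apply]
        rw [← mul_assoc, ← ENNReal.ofReal_mul (by positivity), ← pow_add, finrank_Cn]
        congr 3; omega

lemma Gamma_add_nat {x : ℝ} (hx : 0 < x) (k : ℕ) :
    Real.Gamma (x + k) = rp x k * Real.Gamma x := by
  induction k with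
  | zero => simp [rp_zero]
  | succ k ih =>
    have : x + k ≠ 0 := by positivity
    rw [rp_succ, Nat.cast_succ, ← add_assoc, Real.Gamma_add_one this, ih]; ring

/-- The `k`-th moment of `μ_{a,b}`, so that `∫ |⟨z, w⟩|²ᵏ dμ_{a,b}(w) = moment · |z|²ᵏ`. -/
noncomputable def moment (n : ℕ) (a b : ℝ) (k : ℕ) : ℝ :=
  k.factorial * rp (b + n) k / (rp n k * rp (a + b + n + 1) k)

lemma moment_pos (hn : 1 ≤ n) {a b : ℝ} (ha : -1 < a) (hb : -(n : ℝ) < b) (k : ℕ) :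
    0 < moment n a b k := by
  have h1 : (0 : ℝ) < n := by exact_mod_cast hn
  have := rp_pos h1 k
  have := rp_pos (show 0 < b + n by linarith) k
  have := rp_pos (show 0 < a + b + n + 1 by linarith) k
  unfold moment; positivity

lemma moment_zero : moment n a b 0 = 1 := by simp [moment, rp_zero]

/-- The algebraic reason for the reproducing property: the kernel coefficients are the reciprocals
of the moments. -/
lemma hc_mul_moment (hn : 1 ≤ n) {a b : ℝ} (ha : -1 < a) (hb : -(n : ℝ) < b) (k : ℕ) :
    hc n (a + b + n + 1) (b + n) k * moment n a b k = 1 := by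
  have h1 : (0 : ℝ) < n := by exact_mod_cast hn
  have := (rp_pos h1 k).ne'
  have := (rp_pos (show 0 < b + n by linarith) k).ne'
  have := (rp_pos (show 0 < a + b + n + 1 by linarith) k).ne'
  have : (k.factorial : ℝ) ≠ 0 := by exact_mod_cast k.factorial_ne_zero
  unfold moment hc bc
  field_simp

/-- The normalizing constant of `μ_{a,b}`. -/
noncomputable def massConst (n : ℕ) (a b : ℝ) : ℝ :=
  ((n - 1).factorial : ℝ) / (Real.pi ^ n * ProbabilityTheory.beta (a + 1) (b + n))

lemma massConst_pos {a b : ℝ} (ha : -1 < a) (hb : -(n : ℝ) < b) : 0 < massConst n a b := by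
  have := ProbabilityTheory.beta_pos (show 0 < a + 1 by linarith) (show 0 < b + n by linarith)
  unfold massConst; positivity

/-- The radial profile of the density of `μ_{a,b}`, without the normalizing constant. -/
noncomputable def radial (a b r : ℝ) : ℝ := r ^ (2 * b) * (1 - r ^ 2) ^ a

lemma measurable_radial (a b : ℝ) : Measurable (radial a b) := by
  unfold radial; fun_prop

lemma radial_pos {a b r : ℝ} (h0 : 0 < r) (h1 : r < 1) : 0 < radial a b r := by
  have : 0 < 1 - r ^ 2 := by nlinarith
  unfold radial; positivity

lemma density_eq (a b : ℝ) (z : Cn n) : density n a b z = massConst n a b * radial a b ‖z‖ := rfl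

lemma measurable_density (n : ℕ) (a b : ℝ) : Measurable (density n a b) := by
  have := (measurable_radial a b).comp (measurable_norm (α := Cn n))
  exact this.const_mul (massConst n a b)

lemma measurableSet_unitBall (n : ℕ) : MeasurableSet (unitBall n) := measurableSet_ball

lemma mu_eq_withDensity (n : ℕ) (a b : ℝ) : mu n a b = volume.withDensity
    ((unitBall n).indicator fun z => ENNReal.ofReal (density n a b z)) := by
  rw [withDensity_indicator (measurableSet_unitBall n), mu]

lemma isRotInvariant_mu (n : ℕ) (a b : ℝ) : IsRotInvariant (mu n a b) where
  sfinite := by unfold mu; infer_instance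
  ae_mem := by
    unfold mu
    exact (withDensity_absolutelyContinuous _ _).ae_le (ae_restrict_mem (measurableSet_unitBall n))
  preserving T := by
    have hm : Measurable ((unitBall n).indicator fun z => ENNReal.ofReal (density n a b z)) :=
      (measurable_density n a b).ennreal_ofReal.indicator (measurableSet_unitBall n)
    refine ⟨T.continuous.measurable, Measure.ext fun s hs => ?_⟩
    rw [Measure.map_apply T.continuous.measurable hs, mu_eq_withDensity,
      withDensity_apply _ (T.continuous.measurable hs), withDensity_apply _ hs,
      ← T.measurePreserving.setLIntegral_comp_preimage hs hm]
    refine lintegral_congr fun w => ?_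
    simp only [Set.indicator, mem_unitBall, density_eq, T.norm_map]

lemma lintegral_mu {a b : ℝ} {f : Cn n → ℝ≥0∞} (hf : AEMeasurable f (volume.restrict (unitBall n))) :
    ∫⁻ z, f z ∂(mu n a b) = ∫⁻ z in unitBall n, ENNReal.ofReal (density n a b z) * f z := by
  rw [mu, lintegral_withDensity_eq_lintegral_mul₀ (measurable_density n a b).ennreal_ofReal.aemeasurable hf]
  rfl

/-- In polar coordinates the Gaussian moment is the spherical one times a radial integral equal to
`Γ(n+k)/2`; dividing isolates the spherical moment. -/
lemma lintegral_sphere_inner_pow (hn : 1 ≤ n) (z : Cn n) (k : ℕ) :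
    ∫⁻ ζ, ENNReal.ofReal (‖(inner ℂ (ζ : Cn n) z : ℂ)‖ ^ (2 * k))
        ∂(volume : Measure (Cn n)).toSphere =
      ENNReal.ofReal (2 * k.factorial * Real.pi ^ n * ‖z‖ ^ (2 * k) / Real.Gamma (n + k)) := by
  have h1 : (0 : ℝ) < n := by exact_mod_cast hn
  have hG : 0 < Real.Gamma (n + k) := Real.Gamma_pos_of_pos (by positivity)
  have h := lintegral_homogeneous_mul_radial hn z k
    (ρ := fun r => ENNReal.ofReal (Real.exp (-r ^ 2))) (by fun_prop)
  have e1 : ∫⁻ w : Cn n, ENNReal.ofReal (‖(inner ℂ w z : ℂ)‖ ^ (2 * k)) *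
      ENNReal.ofReal (Real.exp (-‖w‖ ^ 2)) =
      ENNReal.ofReal (k.factorial * Real.pi ^ n * ‖z‖ ^ (2 * k)) := by
    rw [← integral_inner_pow_gaussian, ofReal_integral_eq_lintegral_ofReal]
    · refine lintegral_congr fun w => ?_
      rw [ENNReal.ofReal_mul (by positivity)]
    -- When `z = 0` and `k > 0` the integral vanishes and says nothing about integrability, so this
    -- case is separate.
    · by_cases hz : ‖z‖ ^ (2 * k) = 0
      · obtain ⟨hz0, hk0⟩ := pow_eq_zero_iff'.1 hz
        simp [norm_eq_zero.1 hz0, zero_pow hk0]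
      · refine not_imp_comm.1 integral_undef ?_
        rw [integral_inner_pow_gaussian]
        positivity
    · exact ae_of_all _ fun w => by positivity
  have e2 : ∫⁻ r in Set.Ioi (0 : ℝ), ENNReal.ofReal (r ^ (2 * (n + k) - 1)) *
      ENNReal.ofReal (Real.exp (-r ^ 2)) = ENNReal.ofReal (Real.Gamma (n + k) / 2) := by
    have hi := integral_rpow_mul_exp_neg_rpow (p := 2) (q := 2 * (n + k) - 1) two_pos
      (by have : (0 : ℝ) ≤ k := by positivity
          linarith)
    have hI : IntegrableOn (fun x : ℝ => x ^ (2 * (n + k) - 1 : ℝ) * Real.exp (-x ^ (2 : ℝ)))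
        (Set.Ioi 0) := by
      refine not_imp_comm.1 integral_undef ?_
      rw [hi, show (2 * (n + k) - 1 + 1 : ℝ) / 2 = n + k by ring]
      positivity
    have e : Real.Gamma (n + k) / 2 = 1 / 2 * Real.Gamma ((2 * (n + k) - 1 + 1) / 2) := by
      rw [show (2 * (n + k) - 1 + 1 : ℝ) / 2 = n + k by ring]; ring
    rw [e, ← hi, ofReal_integral_eq_lintegral_ofReal hI]
    · refine setLIntegral_congr_fun measurableSet_Ioi fun r hr => ?_
      have hr' : (0 : ℝ) < r := hr
      rw [← ENNReal.ofReal_mul (by positivity)]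
      congr 2
      · rw [← Real.rpow_natCast]
        congr 1
        rw [Nat.cast_sub (by omega)]; push_cast; ring
      · norm_cast
    · filter_upwards [ae_restrict_mem measurableSet_Ioi] with r hr
      have hr' : (0 : ℝ) < r := hr
      dsimp only [Pi.zero_apply]
      positivity
  rw [e1, e2] at h
  have h3 : ENNReal.ofReal (Real.Gamma (n + k) / 2) ≠ 0 := by simpa using hG
  refine (ENNReal.mul_left_inj h3 ENNReal.ofReal_ne_top).1 ?_
  rw [← h, ← ENNReal.ofReal_mul (by positivity)]
  congr 1; field_simp

lemma lintegral_beta {α β : ℝ} (hα : 0 < α) (hβ : 0 < β) :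
    ∫⁻ x in Set.Ioo (0 : ℝ) 1, ENNReal.ofReal (x ^ (α - 1) * (1 - x) ^ (β - 1)) =
      ENNReal.ofReal (ProbabilityTheory.beta α β) := by
  have h := ProbabilityTheory.lintegral_betaPDF_eq_one hα hβ
  have hb := ProbabilityTheory.beta_pos hα hβ
  rw [ProbabilityTheory.lintegral_betaPDF] at h
  have e : ∀ x : ℝ, ENNReal.ofReal (1 / ProbabilityTheory.beta α β * x ^ (α - 1) * (1 - x) ^ (β - 1))
      = ENNReal.ofReal (1 / ProbabilityTheory.beta α β) *
        ENNReal.ofReal (x ^ (α - 1) * (1 - x) ^ (β - 1)) := fun x => by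
    rw [← ENNReal.ofReal_mul (by positivity), mul_assoc]
  simp only [e] at h
  rw [lintegral_const_mul' _ _ ENNReal.ofReal_ne_top] at h
  have h2 : ENNReal.ofReal (1 / ProbabilityTheory.beta α β) ≠ 0 := by simpa using hb
  refine (ENNReal.mul_right_inj h2 ENNReal.ofReal_ne_top).1 ?_
  rw [h, ← ENNReal.ofReal_mul (by positivity), one_div, inv_mul_cancel₀ hb.ne', ENNReal.ofReal_one]

/-- The substitution `x = r²` turns this into a beta integral. -/
lemma lintegral_radial {a b : ℝ} {m : ℕ} (hm : 1 ≤ m) (ha : -1 < a) (hb : 0 < m + b) :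
    ∫⁻ r in Set.Ioi (0 : ℝ), ENNReal.ofReal (r ^ (2 * m - 1)) *
      (Set.Iio (1 : ℝ)).indicator (fun r => ENNReal.ofReal (radial a b r)) r =
      ENNReal.ofReal (ProbabilityTheory.beta (m + b) (a + 1) / 2) := by
  have him : (fun x : ℝ => x ^ 2) '' Set.Ioo 0 1 = Set.Ioo 0 1 := by
    ext y
    constructor
    · rintro ⟨x, ⟨h0, h1⟩, rfl⟩
      exact ⟨by positivity, by dsimp only; nlinarith⟩
    · rintro ⟨h0, h1⟩
      exact ⟨√y, ⟨Real.sqrt_pos.2 h0, (Real.sqrt_lt' one_pos).2 (by simpa using h1)⟩,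
        Real.sq_sqrt h0.le⟩
  have h := lintegral_image_eq_lintegral_abs_deriv_mul (s := Set.Ioo (0 : ℝ) 1)
    (f := fun x => x ^ 2) (f' := fun x => 2 * x) measurableSet_Ioo
    (fun x _ => by simpa using (hasDerivAt_pow 2 x).hasDerivWithinAt)
    (fun x hx y hy hxy => (sq_eq_sq₀ hx.1.le hy.1.le).1 hxy)
    (fun x => ENNReal.ofReal (x ^ (m + b - 1) * (1 - x) ^ (a + 1 - 1)))
  rw [him, lintegral_beta hb (by linarith)] at h
  have e1 : ∫⁻ r in Set.Ioi (0 : ℝ), ENNReal.ofReal (r ^ (2 * m - 1)) *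
      (Set.Iio (1 : ℝ)).indicator (fun r => ENNReal.ofReal (radial a b r)) r =
      ∫⁻ r in Set.Ioo (0 : ℝ) 1, ENNReal.ofReal (r ^ (2 * m - 1)) *
        ENNReal.ofReal (radial a b r) := by
    rw [← Set.Ioi_inter_Iio, Set.inter_comm, ← Measure.restrict_restrict measurableSet_Iio,
      ← lintegral_indicator measurableSet_Iio]
    refine lintegral_congr fun r => ?_
    by_cases hr : r < 1 <;> simp [hr]
  have e2 : ∀ r ∈ Set.Ioo (0 : ℝ) 1, ENNReal.ofReal |2 * r| *
      ENNReal.ofReal ((r ^ 2) ^ (m + b - 1) * (1 - r ^ 2) ^ (a + 1 - 1)) =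
      ENNReal.ofReal 2 * (ENNReal.ofReal (r ^ (2 * m - 1)) * ENNReal.ofReal (radial a b r)) := by
    rintro r ⟨h0, h1⟩
    have h3 : 0 ≤ 1 - r ^ 2 := by nlinarith
    rw [abs_of_pos (by positivity), ← ENNReal.ofReal_mul (by positivity),
      ← ENNReal.ofReal_mul (by positivity), ← ENNReal.ofReal_mul (by positivity)]
    congr 1
    have h4 : r * (r ^ 2) ^ (m + b - 1) = r ^ (2 * m - 1) * r ^ (2 * b) := by
      rw [← Real.rpow_natCast r 2, ← Real.rpow_mul h0.le, ← Real.rpow_natCast r (2 * m - 1),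
        ← Real.rpow_add h0]
      nth_rewrite 1 [← Real.rpow_one r]
      rw [← Real.rpow_add h0]
      congr 1
      rw [Nat.cast_sub (by omega)]; push_cast; ring
    rw [radial, add_sub_cancel_right]
    linear_combination 2 * (1 - r ^ 2) ^ a * h4
  rw [setLIntegral_congr_fun measurableSet_Ioo e2, lintegral_const_mul' _ _ ENNReal.ofReal_ne_top,
    ← e1] at h
  refine (ENNReal.mul_right_inj (show ENNReal.ofReal 2 ≠ 0 by simp) ENNReal.ofReal_ne_top).1 ?_
  rw [← h, ← ENNReal.ofReal_mul (by positivity)]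
  congr 1; ring

/-- Polar coordinates again: the spherical moment times a beta integral, with the gamma factors
rewritten as rising factorials. -/
lemma lintegral_inner_pow_mu (hn : 1 ≤ n) {a b : ℝ} (ha : -1 < a) (hb : -(n : ℝ) < b) (z : Cn n)
    (k : ℕ) : ∫⁻ w, ENNReal.ofReal (‖(inner ℂ w z : ℂ)‖ ^ (2 * k)) ∂(mu n a b) =
      ENNReal.ofReal (moment n a b k * ‖z‖ ^ (2 * k)) := by
  have h1 : (0 : ℝ) < n := by exact_mod_cast hn
  have hk : (0 : ℝ) ≤ k := by positivity
  have hc := massConst_pos (n := n) ha hb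
  rw [lintegral_mu (f := fun w => ENNReal.ofReal (‖(inner ℂ w z : ℂ)‖ ^ (2 * k)))
    (ENNReal.continuous_ofReal.comp (by fun_prop)).measurable.aemeasurable,
    ← lintegral_indicator (measurableSet_unitBall n)]
  have e : ∀ w : Cn n, (unitBall n).indicator (fun w => ENNReal.ofReal (density n a b w) *
      ENNReal.ofReal (‖(inner ℂ w z : ℂ)‖ ^ (2 * k))) w = ENNReal.ofReal (massConst n a b) *
      (ENNReal.ofReal (‖(inner ℂ w z : ℂ)‖ ^ (2 * k)) *
        (Set.Iio (1 : ℝ)).indicator (fun r => ENNReal.ofReal (radial a b r)) ‖w‖) := by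
    intro w
    by_cases hw : ‖w‖ < 1
    · rw [Set.indicator_of_mem (mem_unitBall.2 hw), Set.indicator_of_mem (Set.mem_Iio.2 hw),
        density_eq, ENNReal.ofReal_mul hc.le]
      ring
    · rw [Set.indicator_of_notMem (by rwa [mem_unitBall]), Set.indicator_of_notMem (by simpa using hw)]
      simp
  simp only [e]
  rw [lintegral_const_mul' _ _ ENNReal.ofReal_ne_top, lintegral_homogeneous_mul_radial hn z k
    ((measurable_radial a b).ennreal_ofReal.indicator measurableSet_Iio),
    lintegral_sphere_inner_pow hn, lintegral_radial (by omega) ha (by push_cast; linarith)]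
  have hG := Real.Gamma_pos_of_pos (show (0 : ℝ) < n + k by positivity)
  rw [← ENNReal.ofReal_mul (by positivity), ← ENNReal.ofReal_mul hc.le]
  congr 1
  have g1 : Real.Gamma (n : ℝ) = (n - 1).factorial := by
    rw [← Real.Gamma_nat_eq_factorial, Nat.cast_sub hn]; simp
  have hbn : 0 < b + n := by linarith
  have hab : 0 < a + b + n + 1 := by linarith
  rw [massConst, ProbabilityTheory.beta, ProbabilityTheory.beta, Gamma_add_nat h1 k,
    show (((n + k : ℕ) : ℝ) + b) = (b + n) + k by push_cast; ring,
    show (b + n + k + (a + 1) : ℝ) = (a + b + n + 1) + k by ring,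
    show (a + 1 + (b + n) : ℝ) = a + b + n + 1 by ring,
    Gamma_add_nat hbn, Gamma_add_nat hab, g1, moment]
  have := (rp_pos h1 k).ne'
  have := (rp_pos hbn k).ne'
  have := (rp_pos hab k).ne'
  have := (Real.Gamma_pos_of_pos hbn).ne'
  have := (Real.Gamma_pos_of_pos hab).ne'
  have := (Real.Gamma_pos_of_pos (show 0 < a + 1 by linarith)).ne'
  have : ((n - 1).factorial : ℝ) ≠ 0 := by exact_mod_cast (n - 1).factorial_ne_zero
  field_simp

lemma isProbabilityMeasure_mu (hn : 1 ≤ n) {a b : ℝ} (ha : -1 < a) (hb : -(n : ℝ) < b) :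
    IsProbabilityMeasure (mu n a b) := by
  have := lintegral_inner_pow_mu hn ha hb (0 : Cn n) 0
  refine ⟨?_⟩
  simpa [moment_zero] using this

lemma integral_inner_pow_mu (hn : 1 ≤ n) {a b : ℝ} (ha : -1 < a) (hb : -(n : ℝ) < b) (z : Cn n)
    (k : ℕ) : ∫ w, ‖(inner ℂ w z : ℂ)‖ ^ (2 * k) ∂(mu n a b) = moment n a b k * ‖z‖ ^ (2 * k) := by
  have := moment_pos hn ha hb k
  rw [integral_eq_lintegral_of_nonneg_ae (ae_of_all _ fun w => by positivity)
    (Continuous.aestronglyMeasurable (by fun_prop)), lintegral_inner_pow_mu hn ha hb,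
    ENNReal.toReal_ofReal (by positivity)]

lemma integral_mul_inner_pow_mu (hn : 1 ≤ n) {α β : ℝ} (hα : -1 < α) (hβ : -(n : ℝ) < β) {z : Cn n}
    (hz : z ≠ 0) {g : Cn n → ℂ} (hg : DifferentiableOn ℂ g (unitBall n))
    (hint : Integrable g (mu n α β)) {a : ℕ → ℂ}
    (ha : ∀ t : ℂ, ‖t‖ * ‖z‖ < 1 → HasSum (fun k => a k * t ^ k) (g (t • z))) (k : ℕ) :
    ∫ w, g w * (inner ℂ w z) ^ k ∂(mu n α β) = a k * moment n α β k := by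
  rw [integral_mul_inner_pow (isRotInvariant_mu n α β) hz hg hint ha, integral_inner_pow_mu hn hα hβ]
  have : ‖z‖ ≠ 0 := by simpa using hz
  congr 2
  field_simp

/-! ### The reproducing property -/

/-- Termwise integration of a holomorphic function against a power series in `⟨z, w⟩`. -/
lemma hasSum_integral_mul_series (hn : 1 ≤ n) {α β : ℝ} (hα : -1 < α) (hβ : -(n : ℝ) < β) {z : Cn n}
    (hz : z ≠ 0) (hz1 : ‖z‖ < 1) {g : Cn n → ℂ} (hg : DifferentiableOn ℂ g (unitBall n))
    (hint : Integrable g (mu n α β)) {a : ℕ → ℂ}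
    (ha : ∀ t : ℂ, ‖t‖ * ‖z‖ < 1 → HasSum (fun k => a k * t ^ k) (g (t • z)))
    {c : ℕ → ℝ} (hc : ∀ r : ℝ, 0 ≤ r → r < 1 → Summable fun k => |c k| * r ^ k) {f : ℂ → ℂ}
    (hf : ∀ ξ : ℂ, ‖ξ‖ < 1 → HasSum (fun k => (c k : ℂ) * ξ ^ k) (f ξ)) :
    HasSum (fun k => (c k * moment n α β k : ℝ) * a k)
      (∫ w, g w * f (inner ℂ w z) ∂(mu n α β)) := by
  have hF : ∀ k w, w ∈ unitBall n → ‖g w * ((c k : ℂ) * (inner ℂ w z) ^ k)‖ ≤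
      ‖g w‖ * (|c k| * ‖z‖ ^ k) := by
    intro k w hw
    rw [norm_mul, norm_mul, norm_pow, Complex.norm_real, Real.norm_eq_abs]
    gcongr
    refine (norm_inner_le_norm w z).trans ?_
    have := (mem_unitBall.1 hw).le
    nlinarith [norm_nonneg z]
  have hmem := (isRotInvariant_mu n α β).ae_mem
  have hFi : ∀ k, Integrable (fun w => g w * ((c k : ℂ) * (inner ℂ w z) ^ k)) (mu n α β) := by
    intro k
    refine (hint.norm.mul_const (|c k| * ‖z‖ ^ k)).mono'
      (hint.1.mul (Continuous.aestronglyMeasurable (by fun_prop))) ?_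
    filter_upwards [hmem] with w hw using hF k w hw
  have key := hasSum_integral_of_summable_integral_norm hFi (by
    refine Summable.of_nonneg_of_le (fun k => integral_nonneg fun w => norm_nonneg _) (fun k => ?_)
      ((hc ‖z‖ (norm_nonneg z) hz1).mul_left (∫ w, ‖g w‖ ∂(mu n α β)))
    rw [← integral_mul_const]
    refine integral_mono_ae (hFi k).norm (hint.norm.mul_const _) ?_
    filter_upwards [hmem] with w hw using hF k w hw)
  have e1 : ∫ w, ∑' k, g w * ((c k : ℂ) * (inner ℂ w z) ^ k) ∂(mu n α β) =
      ∫ w, g w * f (inner ℂ w z) ∂(mu n α β) := by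
    refine integral_congr_ae ?_
    filter_upwards [hmem] with w hw
    rw [tsum_mul_left, (hf _ (norm_inner_lt_one hz1 (mem_unitBall.1 hw))).tsum_eq]
  rw [e1] at key
  convert! key using 1
  funext k
  have : ∀ w : Cn n, g w * ((c k : ℂ) * (inner ℂ w z) ^ k) = c k * (g w * (inner ℂ w z) ^ k) :=
    fun w => by ring
  simp only [this]
  rw [integral_const_mul, integral_mul_inner_pow_mu hn hα hβ hz hg hint ha]
  push_cast; ring

/-- The slice `t ↦ g (t z)` is holomorphic on the disc of radius `1/|z|`, so its Taylor series
converges on all of it. -/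
lemma exists_hasSum_slice {z : Cn n} (hz : z ≠ 0) {g : Cn n → ℂ}
    (hg : DifferentiableOn ℂ g (unitBall n)) :
    ∃ a : ℕ → ℂ, ∀ t : ℂ, ‖t‖ * ‖z‖ < 1 → HasSum (fun k => a k * t ^ k) (g (t • z)) := by
  have hz0 : 0 < ‖z‖ := norm_pos_iff.2 hz
  have hd : DifferentiableOn ℂ (fun t : ℂ => g (t • z)) (Metric.ball 0 ‖z‖⁻¹) := by
    refine hg.comp (by fun_prop) fun t ht => ?_
    rw [mem_unitBall, norm_smul, ← lt_div_iff₀ hz0, one_div]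
    simpa using ht
  refine ⟨fun k => (k.factorial : ℂ)⁻¹ * iteratedDeriv k (fun t : ℂ => g (t • z)) 0, fun t ht => ?_⟩
  have := Complex.hasSum_taylorSeries_on_ball hd (z := t)
    (by rw [← lt_div_iff₀ hz0, one_div] at ht; simpa using ht)
  convert! this using 1
  funext k
  simp only [smul_eq_mul, sub_zero]; ring

lemma exists_ne_zero (hn : 1 ≤ n) : ∃ z : Cn n, z ≠ 0 :=
  ⟨EuclideanSpace.single ⟨0, hn⟩ 1, by simp⟩

/-- The Bergman projection reproduces integrable holomorphic functions. -/
lemma proj_eq_self (hn : 1 ≤ n) {a b : ℝ} (ha : -1 < a) (hb : -(n : ℝ) < b) {g : Cn n → ℂ}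
    (hg : DifferentiableOn ℂ g (unitBall n)) (hint : Integrable g (mu n a b)) {z : Cn n}
    (hz : z ∈ unitBall n) : proj n a b g z = g z := by
  have hbn : 0 < b + n := by linarith
  by_cases hz0 : z = 0
  -- No slice passes through the origin and a point `z = 0`; any other direction `v` serves, since
  -- only the constant coefficient `g 0` matters.
  · subst hz0
    obtain ⟨v, hv⟩ := exists_ne_zero hn
    obtain ⟨s, hs⟩ := exists_hasSum_slice hv hg
    have h1 := integral_mul_inner_pow_mu hn ha hb hv hg hint hs 0
    have h2 := (hasSum_single 0 (fun k hk => by simp [hk])).unique (hs 0 (by simp))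
    have h3 : kernelFun n a b 0 = 1 := by simp [kernelFun]
    simp only [pow_zero, mul_one, zero_smul, moment_zero, Complex.ofReal_one] at h1 h2
    simp [proj, h3, h1, h2]
  · obtain ⟨s, hs⟩ := exists_hasSum_slice hz0 hg
    have hz1 := mem_unitBall.1 hz
    have h1 := hasSum_integral_mul_series hn ha hb hz0 hz1 hg hint hs
      (c := hc n (a + b + n + 1) (b + n))
      (fun r hr0 hr1 => summable_hc_mul_pow hbn hr0 hr1)
      (fun ξ hξ => hasSum_kernelFun n hbn hξ)
    simp only [hc_mul_moment hn ha hb, Complex.ofReal_one, one_mul] at h1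
    have h2 := hs 1 (by simpa using hz1)
    simp only [one_pow, mul_one, one_smul] at h2
    exact h1.unique h2

/-! ### Forelli–Rudin integrals -/

lemma differentiableOn_of_hasSum {c : ℕ → ℝ}
    (hc : ∀ r : ℝ, 0 ≤ r → r < 1 → Summable fun k => |c k| * r ^ k) {f : ℂ → ℂ}
    (hf : ∀ ξ : ℂ, ‖ξ‖ < 1 → HasSum (fun k => (c k : ℂ) * ξ ^ k) (f ξ)) :
    DifferentiableOn ℂ f (Metric.ball 0 1) := by
  intro ξ hξ
  have hξ' : ‖ξ‖ < 1 := by simpa using hξ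
  obtain ⟨r, hr1, hr2⟩ := exists_between hξ'
  have h1 : DifferentiableOn ℂ (fun ξ : ℂ => ∑' k, (c k : ℂ) * ξ ^ k) (Metric.ball 0 r) := by
    refine Complex.differentiableOn_tsum_of_summable_norm (hc r ((norm_nonneg _).trans hr1.le) hr2)
      (fun k => by fun_prop) Metric.isOpen_ball fun k w hw => ?_
    have : ‖w‖ < r := by simpa using hw
    rw [norm_mul, norm_pow, Complex.norm_real, Real.norm_eq_abs]
    gcongr
  have hr : Metric.ball (0 : ℂ) r ∈ 𝓝 ξ := Metric.isOpen_ball.mem_nhds (by simpa using hr1)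
  have h2 : DifferentiableAt ℂ (fun ξ : ℂ => ∑' k, (c k : ℂ) * ξ ^ k) ξ := h1.differentiableAt hr
  refine (h2.congr_of_eventuallyEq ?_).differentiableWithinAt
  filter_upwards [hr] with w hw
  have : ‖w‖ < r := by simpa using hw
  exact (hf w (this.trans hr2)).tsum_eq.symm

lemma differentiableOn_bs (m : ℝ) : DifferentiableOn ℂ (bs m) (Metric.ball 0 1) :=
  differentiableOn_of_hasSum (fun _ h0 h1 => summable_bc_mul_pow m h0 h1) fun _ h => bs_hasSum m h

lemma differentiableOn_kernelFun (n : ℕ) {a b : ℝ} (hb : 0 < b + n) :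
    DifferentiableOn ℂ (kernelFun n a b) (Metric.ball 0 1) :=
  differentiableOn_of_hasSum
    (fun _ h0 h1 => summable_hc_mul_pow (A := n) (B := a + b + n + 1) hb h0 h1)
    fun _ h => hasSum_kernelFun n hb h

/-- A function on the ball that is bounded on compact discs of `⟨z, w⟩`, for fixed `z`. -/
lemma aestronglyMeasurable_inner_comp {μ : Measure (Cn n)} (hμ : IsRotInvariant μ) {f : ℂ → ℂ}
    (hf : ContinuousOn f (Metric.ball 0 1)) {z : Cn n} (hz : ‖z‖ < 1) :
    AEStronglyMeasurable (fun w => f (inner ℂ w z)) μ := by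
  have h1 : ContinuousOn (fun w : Cn n => f (inner ℂ w z)) (unitBall n) :=
    hf.comp (by fun_prop) fun w hw => by
      simpa using norm_inner_lt_one hz (mem_unitBall.1 hw)
  have h2 := h1.aestronglyMeasurable (μ := μ) (measurableSet_unitBall n)
  rwa [Measure.restrict_eq_self_of_ae_mem hμ.ae_mem] at h2

/-- Parseval's formula for a power of `|1 - ⟨z, w⟩|`. -/
lemma hasSum_integral_norm_rpow (hn : 1 ≤ n) {α β : ℝ} (hα : -1 < α) (hβ : -(n : ℝ) < β) (m : ℝ)
    {z : Cn n} (hz : ‖z‖ < 1) :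
    HasSum (fun k => bc (m / 2) k ^ 2 * moment n α β k * ‖z‖ ^ (2 * k))
      (∫ w, ‖1 - (inner ℂ w z : ℂ)‖ ^ (-m) ∂(mu n α β)) := by
  have := isProbabilityMeasure_mu hn hα hβ
  by_cases hz0 : z = 0
  · subst hz0
    convert hasSum_single (f := fun k => bc (m / 2) k ^ 2 * moment n α β k * ‖(0 : Cn n)‖ ^ (2 * k)) 0
      (fun k hk => by simp [hk]) using 1
    simp [bc_zero, moment_zero]
  -- The exponent is halved because `|1 - ξ|^{-m}` is `(1 - ξ)^{-m/2}` times its conjugate: one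
  -- factor is holomorphic in `w`, the other a power series in `⟨z, w⟩`.
  · set g : Cn n → ℂ := fun w => bs (m / 2) (inner ℂ z w) with hgdef
    have hg : DifferentiableOn ℂ g (unitBall n) := by
      refine (differentiableOn_bs (m / 2)).comp (f := fun w : Cn n => inner ℂ z w) ?_ fun w hw => ?_
      · exact (innerSL ℂ z).differentiable.differentiableOn
      · simpa using norm_inner_lt_one (mem_unitBall.1 hw) hz
    have hgi : Integrable g (mu n α β) := by
      obtain ⟨M, hM⟩ := (isCompact_closedBall (0 : ℂ) ‖z‖).exists_bound_of_continuousOn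
        ((differentiableOn_bs (m / 2)).continuousOn.mono (Metric.closedBall_subset_ball hz))
      have hm := hg.continuousOn.aestronglyMeasurable (μ := mu n α β) (measurableSet_unitBall n)
      rw [Measure.restrict_eq_self_of_ae_mem (isRotInvariant_mu n α β).ae_mem] at hm
      refine (integrable_const M).mono' hm ?_
      filter_upwards [(isRotInvariant_mu n α β).ae_mem] with w hw
      refine hM _ ?_
      rw [mem_closedBall_zero_iff]
      refine (norm_inner_le_norm z w).trans ?_
      have := (mem_unitBall.1 hw).le
      nlinarith [norm_nonneg z]
    have h1 := hasSum_integral_mul_series hn hα hβ hz0 hz hg hgi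
      (a := fun k => (bc (m / 2) k : ℂ) * ((‖z‖ : ℂ) ^ 2) ^ k)
      (fun t ht => by
        have h2 : inner ℂ z (t • z) = t * (‖z‖ : ℂ) ^ 2 := by
          rw [inner_smul_right, inner_self_eq_norm_sq_to_K]; rfl
        have := bs_hasSum (m / 2) (ξ := t * (‖z‖ : ℂ) ^ 2) (by
          rw [norm_mul, norm_pow, Complex.norm_real, norm_norm, sq, ← mul_assoc]
          nlinarith [norm_nonneg z, mul_nonneg (norm_nonneg t) (norm_nonneg z)])
        rw [hgdef]
        simp only [h2]
        convert this using 1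
        funext k
        rw [mul_pow]; ring)
      (c := bc (m / 2)) (fun r h0 h1 => summable_bc_mul_pow _ h0 h1)
      (fun ξ hξ => bs_hasSum (m / 2) hξ)
    have e : ∫ w, g w * bs (m / 2) (inner ℂ w z) ∂(mu n α β) =
        ((∫ w, ‖1 - (inner ℂ w z : ℂ)‖ ^ (-m) ∂(mu n α β) : ℝ) : ℂ) := by
      rw [← integral_complex_ofReal]
      refine integral_congr_ae ?_
      filter_upwards [(isRotInvariant_mu n α β).ae_mem] with w hw
      have hlt := norm_inner_lt_one hz (mem_unitBall.1 hw)
      rw [hgdef]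
      simp only
      rw [← inner_conj_symm z w, ← conj_bs, Complex.conj_mul', norm_bs _ hlt,
        ← Complex.ofReal_pow, ← Real.rpow_natCast, ← Real.rpow_mul (norm_nonneg _)]
      congr 2; push_cast; ring
    rw [e] at h1
    refine Complex.hasSum_ofReal.1 ?_
    convert h1 using 1
    funext k
    push_cast
    rw [pow_mul]; ring

lemma moment_eq_bc (hn : 1 ≤ n) {a b : ℝ} (ha : -1 < a) (hb : -(n : ℝ) < b) (k : ℕ) :
    moment n a b k = bc (b + n) k / (bc n k * bc (a + b + n + 1) k) := by
  have h1 : (0 : ℝ) < n := by exact_mod_cast hn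
  have := (rp_pos h1 k).ne'
  have := (rp_pos (show 0 < a + b + n + 1 by linarith) k).ne'
  have : (k.factorial : ℝ) ≠ 0 := by exact_mod_cast k.factorial_ne_zero
  unfold moment bc
  field_simp

/-- The growth exponents of the four binomial coefficients add up to `s - 1`, whatever `n`, `α` and
`β` are. So the Parseval series behaves like that of `(1 - |z|²)^{-s}` for `s > 0`, and like a
logarithm for `s = 0`. -/
lemma exists_parseval_coeff_bounds (hn : 1 ≤ n) {α β : ℝ} (hα : -1 < α) (hβ : -(n : ℝ) < β) {s : ℝ}
    (hs : 0 ≤ s) : ∃ c C, 0 < c ∧ 0 < C ∧ ∀ k : ℕ,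
      c * ((k : ℝ) + 1) ^ (s - 1) ≤ bc ((n + 1 + α + s) / 2) k ^ 2 * moment n α β k ∧
      bc ((n + 1 + α + s) / 2) k ^ 2 * moment n α β k ≤ C * ((k : ℝ) + 1) ^ (s - 1) := by
  have h1 : (0 : ℝ) < n := by exact_mod_cast hn
  have hm : 0 < (n + 1 + α + s) / 2 := by linarith
  have hbn : 0 < β + n := by linarith
  have hab : 0 < α + β + n + 1 := by linarith
  obtain ⟨c1, hc1, l1⟩ := exists_le_bc hm
  obtain ⟨C1, hC1, u1⟩ := exists_bc_le ((n + 1 + α + s) / 2)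
  obtain ⟨c2, hc2, l2⟩ := exists_le_bc hbn
  obtain ⟨C2, hC2, u2⟩ := exists_bc_le (β + n)
  obtain ⟨c3, hc3, l3⟩ := exists_le_bc h1
  obtain ⟨C3, hC3, u3⟩ := exists_bc_le n
  obtain ⟨c4, hc4, l4⟩ := exists_le_bc hab
  obtain ⟨C4, hC4, u4⟩ := exists_bc_le (α + β + n + 1)
  refine ⟨c1 ^ 2 * c2 / (C3 * C4), C1 ^ 2 * C2 / (c3 * c4), by positivity, by positivity,
    fun k => ?_⟩
  have hk : (0 : ℝ) < (k : ℝ) + 1 := by positivity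
  have p1 := bc_pos hm k
  have p2 := bc_pos hbn k
  have p3 := bc_pos h1 k
  have p4 := bc_pos hab k
  have U1 := u1 k
  have U2 := u2 k
  have U3 := u3 k
  have U4 := u4 k
  rw [abs_of_pos p1] at U1
  rw [abs_of_pos p2] at U2
  rw [abs_of_pos p3] at U3
  rw [abs_of_pos p4] at U4
  have L1 := l1 k
  have L2 := l2 k
  have L3 := l3 k
  have L4 := l4 k
  have hpow : ((k : ℝ) + 1) ^ (s - 1) * (((k : ℝ) + 1) ^ ((n : ℝ) - 1) *
      ((k : ℝ) + 1) ^ (α + β + n + 1 - 1)) =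
      (((k : ℝ) + 1) ^ ((n + 1 + α + s) / 2 - 1)) ^ 2 * ((k : ℝ) + 1) ^ (β + n - 1) := by
    rw [← Real.rpow_natCast, ← Real.rpow_mul hk.le, ← Real.rpow_add hk, ← Real.rpow_add hk,
      ← Real.rpow_add hk]
    congr 1; push_cast; ring
  rw [moment_eq_bc hn hα hβ, ← mul_div_assoc]
  constructor
  · rw [le_div_iff₀ (by positivity)]
    calc c1 ^ 2 * c2 / (C3 * C4) * ((k : ℝ) + 1) ^ (s - 1) * (bc n k * bc (α + β + n + 1) k)
        ≤ c1 ^ 2 * c2 / (C3 * C4) * ((k : ℝ) + 1) ^ (s - 1) *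
          ((C3 * ((k : ℝ) + 1) ^ ((n : ℝ) - 1)) *
            (C4 * ((k : ℝ) + 1) ^ (α + β + n + 1 - 1))) := by gcongr
      _ = c1 ^ 2 * c2 * (((k : ℝ) + 1) ^ (s - 1) * (((k : ℝ) + 1) ^ ((n : ℝ) - 1) *
          ((k : ℝ) + 1) ^ (α + β + n + 1 - 1))) := by field_simp
      _ = (c1 * ((k : ℝ) + 1) ^ ((n + 1 + α + s) / 2 - 1)) ^ 2 *
          (c2 * ((k : ℝ) + 1) ^ (β + n - 1)) := by rw [hpow]; ring
      _ ≤ _ := by gcongr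
  · rw [div_le_iff₀ (by positivity)]
    calc bc ((n + 1 + α + s) / 2) k ^ 2 * bc (β + n) k
        ≤ (C1 * ((k : ℝ) + 1) ^ ((n + 1 + α + s) / 2 - 1)) ^ 2 *
          (C2 * ((k : ℝ) + 1) ^ (β + n - 1)) := by gcongr
      _ = C1 ^ 2 * C2 * (((k : ℝ) + 1) ^ (s - 1) * (((k : ℝ) + 1) ^ ((n : ℝ) - 1) *
          ((k : ℝ) + 1) ^ (α + β + n + 1 - 1))) := by rw [hpow]; ring
      _ = C1 ^ 2 * C2 / (c3 * c4) * ((k : ℝ) + 1) ^ (s - 1) *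
          ((c3 * ((k : ℝ) + 1) ^ ((n : ℝ) - 1)) *
            (c4 * ((k : ℝ) + 1) ^ (α + β + n + 1 - 1))) := by field_simp
      _ ≤ _ := by gcongr

/-- The value given by Parseval is at least its zeroth term 1, hence nonzero, and only integrable
functions have a nonzero Bochner integral. -/
lemma integrable_norm_rpow (hn : 1 ≤ n) {α β : ℝ} (hα : -1 < α) (hβ : -(n : ℝ) < β) (m : ℝ)
    {z : Cn n} (hz : ‖z‖ < 1) :
    Integrable (fun w => ‖1 - (inner ℂ w z : ℂ)‖ ^ (-m)) (mu n α β) := by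
  refine not_imp_comm.1 integral_undef ?_
  have h := hasSum_integral_norm_rpow hn hα hβ m hz
  have h0 := le_hasSum h 0 fun k _ => by
    have := moment_pos hn hα hβ k
    positivity
  simp only [bc_zero, moment_zero, mul_zero, pow_zero, mul_one, one_pow] at h0
  linarith

/-- The Forelli–Rudin estimate. -/
lemma exists_lintegral_norm_rpow_le (hn : 1 ≤ n) {α β : ℝ} (hα : -1 < α) (hβ : -(n : ℝ) < β)
    {s : ℝ} (hs : 0 < s) : ∃ C, 0 < C ∧ ∀ z : Cn n, ‖z‖ < 1 →
      ∫⁻ w, ENNReal.ofReal (‖1 - (inner ℂ w z : ℂ)‖ ^ (-(n + 1 + α + s))) ∂(mu n α β) ≤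
        ENNReal.ofReal (C * (1 - ‖z‖ ^ 2) ^ (-s)) := by
  obtain ⟨_, C, _, hC, h⟩ := exists_parseval_coeff_bounds hn hα hβ hs.le
  obtain ⟨c, hc, h'⟩ := exists_le_bc hs
  refine ⟨C / c, by positivity, fun z hz => ?_⟩
  rw [← ofReal_integral_eq_lintegral_ofReal (integrable_norm_rpow hn hα hβ _ hz)
    (ae_of_all _ fun w => by positivity)]
  refine ENNReal.ofReal_le_ofReal ?_
  have h1 := hasSum_integral_norm_rpow hn hα hβ (n + 1 + α + s) hz
  -- The comparison series: the binomial expansion of `(1 - ‖z‖²)^{-s}`, dominating term by term.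
  have h2 := (bs_ofReal s (x := ‖z‖ ^ 2) (by positivity) (by nlinarith [norm_nonneg z])).mul_left (C / c)
  refine hasSum_le (fun k => ?_) h1 h2
  rw [pow_mul, ← mul_assoc]
  refine mul_le_mul_of_nonneg_right ((h k).2.trans ?_) (by positivity)
  calc C * ((k : ℝ) + 1) ^ (s - 1) = C / c * (c * ((k : ℝ) + 1) ^ (s - 1)) := by field_simp
    _ ≤ _ := by gcongr; exact h' k

/-- The Forelli–Rudin integral diverges at the critical exponent. -/
lemma not_bounded_integral_norm_rpow (hn : 1 ≤ n) {α β : ℝ} (hα : -1 < α) (hβ : -(n : ℝ) < β)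
    {r₀ : ℝ} (hr₀ : r₀ < 1) (M : ℝ) : ∃ z : Cn n, r₀ < ‖z‖ ∧ ‖z‖ < 1 ∧
      M < ∫ w, ‖1 - (inner ℂ w z : ℂ)‖ ^ (-(n + 1 + α)) ∂(mu n α β) := by
  obtain ⟨c, _, hc, _, h⟩ := exists_parseval_coeff_bounds hn hα hβ le_rfl
  simp only [add_zero, zero_sub, Real.rpow_neg_one] at h
  by_contra! hcon
  obtain ⟨v, hv⟩ := exists_ne_zero hn
  have hv0 : 0 < ‖v‖ := norm_pos_iff.2 hv
  have key : ∀ N : ℕ, ∀ r : ℝ, max 0 r₀ < r → r < 1 →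
      ∑ k ∈ Finset.range N, c * ((k : ℝ) + 1)⁻¹ * r ^ (2 * k) ≤ M := by
    intro N r hr0 hr1
    have hr00 : 0 < r := (le_max_left _ _).trans_lt hr0
    set z : Cn n := ((r / ‖v‖ : ℝ) : ℂ) • v with hz
    have hzn : ‖z‖ = r := by
      rw [hz, norm_smul, Complex.norm_real, Real.norm_of_nonneg (by positivity)]
      field_simp
    have h1 := hasSum_integral_norm_rpow hn hα hβ (n + 1 + α) (z := z) (by rwa [hzn])
    have h2 := sum_le_hasSum (Finset.range N) (fun k _ => by
      have := moment_pos hn hα hβ k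
      positivity) h1
    refine le_trans ?_ (h2.trans (hcon z (by rw [hzn]; exact (le_max_right _ _).trans_lt hr0)
      (by rwa [hzn])))
    rw [hzn]
    refine Finset.sum_le_sum fun k _ => ?_
    exact mul_le_mul_of_nonneg_right (h k).1 (by positivity)
  have key2 : ∀ N : ℕ, ∑ k ∈ Finset.range N, c * ((k : ℝ) + 1)⁻¹ ≤ M := by
    intro N
    have hcont : Continuous fun r : ℝ => ∑ k ∈ Finset.range N, c * ((k : ℝ) + 1)⁻¹ * r ^ (2 * k) := by
      fun_prop
    -- Each partial sum is continuous at `r = 1`, so a bound near the sphere would bound the partial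
    -- sums of the harmonic series.
    have ht := (hcont.tendsto 1).mono_left (nhdsWithin_le_nhds (s := Set.Iio 1))
    simp only [one_pow, mul_one] at ht
    refine le_of_tendsto ht ?_
    filter_upwards [Ioo_mem_nhdsLT (show max 0 r₀ < 1 by simp [hr₀])] with r hr
    exact key N r hr.1 hr.2
  have hsum : Summable fun k : ℕ => c * ((k : ℝ) + 1)⁻¹ :=
    summable_of_sum_range_le (fun k => by positivity) key2
  have h3 : Summable fun k : ℕ => ((k : ℝ) + 1)⁻¹ := by
    simpa [← mul_assoc, hc.ne'] using hsum.mul_left c⁻¹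
  have h4 : Summable fun k : ℕ => (k : ℝ)⁻¹ :=
    (summable_nat_add_iff 1).1 (by simpa using h3)
  exact Real.not_summable_natCast_inv h4

/-! ### Schur's test -/

section Schur

variable {E : Type*} [MeasurableSpace E] {μ : Measure E} {D₁ D₂ : E → ℝ≥0∞}
  {H : E → E → ℝ≥0∞}

/-- A weighted Tonelli estimate. -/
lemma lintegral_lintegral_weight_le [SFinite (μ.withDensity D₁)] [SFinite (μ.withDensity D₂)]
    (hD₁ : Measurable D₁) (hD₂ : Measurable D₂)
    (hH : Measurable (Function.uncurry H)) {G F : E → ℝ≥0∞} (hG : Measurable G) (hF : Measurable F)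
    (hG0 : ∀ᵐ w ∂μ, G w ≠ 0 ∧ G w ≠ ∞) {C : ℝ≥0∞}
    (h : ∀ᵐ w ∂μ, D₁ w * ∫⁻ z, H z w * G z ∂(μ.withDensity D₂) ≤ C * D₂ w * G w) :
    ∫⁻ z, (∫⁻ w, F w * (G w)⁻¹ * H z w ∂(μ.withDensity D₁)) * G z ∂(μ.withDensity D₂) ≤
      C * ∫⁻ w, F w ∂(μ.withDensity D₂) := by
  have hH2 : ∀ z, Measurable (H z) := fun z => hH.comp measurable_prodMk_left
  have hHt : Measurable fun p : E × E => H p.2 p.1 * G p.2 :=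
    (hH.comp measurable_swap).mul (hG.comp measurable_snd)
  calc ∫⁻ z, (∫⁻ w, F w * (G w)⁻¹ * H z w ∂(μ.withDensity D₁)) * G z ∂(μ.withDensity D₂)
      = ∫⁻ z, ∫⁻ w, F w * (G w)⁻¹ * H z w * G z ∂(μ.withDensity D₁) ∂(μ.withDensity D₂) := by
        refine lintegral_congr fun z => ?_
        exact (lintegral_mul_const _ ((hF.mul hG.inv).mul (hH2 z))).symm
    _ = ∫⁻ w, ∫⁻ z, F w * (G w)⁻¹ * H z w * G z ∂(μ.withDensity D₂) ∂(μ.withDensity D₁) := by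
        refine lintegral_lintegral_swap (Measurable.aemeasurable ?_)
        exact (((hF.mul hG.inv).comp measurable_snd).mul hH).mul (hG.comp measurable_fst)
    _ = ∫⁻ w, F w * (G w)⁻¹ * ∫⁻ z, H z w * G z ∂(μ.withDensity D₂) ∂(μ.withDensity D₁) := by
        refine lintegral_congr fun w => ?_
        simp only [mul_assoc (F w * (G w)⁻¹)]
        exact lintegral_const_mul _ (hHt.comp measurable_prodMk_left)
    _ = ∫⁻ w, D₁ w * (F w * (G w)⁻¹ * ∫⁻ z, H z w * G z ∂(μ.withDensity D₂)) ∂μ := by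
        rw [lintegral_withDensity_eq_lintegral_mul _ hD₁]
        · rfl
        · exact (hF.mul hG.inv).mul hHt.lintegral_prod_right'
    _ ≤ ∫⁻ w, C * (D₂ w * F w) ∂μ := by
        refine lintegral_mono_ae ?_
        filter_upwards [h, hG0] with w hw hw0
        calc D₁ w * (F w * (G w)⁻¹ * ∫⁻ z, H z w * G z ∂(μ.withDensity D₂))
            = F w * (G w)⁻¹ * (D₁ w * ∫⁻ z, H z w * G z ∂(μ.withDensity D₂)) := by ring
          _ ≤ F w * (G w)⁻¹ * (C * D₂ w * G w) := by gcongr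
          _ = C * (D₂ w * F w) * ((G w)⁻¹ * G w) := by ring
          _ = _ := by rw [ENNReal.inv_mul_cancel hw0.1 hw0.2, mul_one]
    _ = C * ∫⁻ w, F w ∂(μ.withDensity D₂) := by
        rw [lintegral_withDensity_eq_lintegral_mul _ hD₂ hF]
        exact lintegral_const_mul _ (hD₂.mul hF)

/-- Schur's test between two measures with densities. -/
lemma schur_test [SFinite (μ.withDensity D₁)] [SFinite (μ.withDensity D₂)]
    (hD₁ : Measurable D₁) (hD₂ : Measurable D₂)
    (hH : Measurable (Function.uncurry H)) {h F : E → ℝ≥0∞} (hh : Measurable h) (hF : Measurable F)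
    (hh0 : ∀ᵐ w ∂μ, h w ≠ 0 ∧ h w ≠ ∞) {p q : ℝ} (hpq : p.HolderConjugate q) {C₁ C₂ : ℝ≥0∞}
    (h₁ : ∀ᵐ z ∂(μ.withDensity D₂), ∫⁻ w, H z w * h w ^ q ∂(μ.withDensity D₁) ≤ C₁ * h z ^ q)
    (h₂ : ∀ᵐ w ∂μ, D₁ w * ∫⁻ z, H z w * h z ^ p ∂(μ.withDensity D₂) ≤ C₂ * D₂ w * h w ^ p) :
    ∫⁻ z, (∫⁻ w, F w * H z w ∂(μ.withDensity D₁)) ^ p ∂(μ.withDensity D₂) ≤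
      C₁ ^ (p / q) * C₂ * ∫⁻ w, F w ^ p ∂(μ.withDensity D₂) := by
  have hp := hpq.pos
  have hq := hpq.symm.pos
  have hH2 : ∀ z, Measurable (H z) := fun z => hH.comp measurable_prodMk_left
  have hac : μ.withDensity D₁ ≪ μ := withDensity_absolutelyContinuous _ _
  calc ∫⁻ z, (∫⁻ w, F w * H z w ∂(μ.withDensity D₁)) ^ p ∂(μ.withDensity D₂)
      ≤ ∫⁻ z, C₁ ^ (p / q) * ((∫⁻ w, F w ^ p * (h w ^ p)⁻¹ * H z w ∂(μ.withDensity D₁)) * h z ^ p)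
          ∂(μ.withDensity D₂) := by
        refine lintegral_mono_ae ?_
        filter_upwards [h₁] with z hz
        -- Hölder is applied to the splitting `F H = (F h⁻¹ H^{1/p}) (h H^{1/q})`.
        have e : ∫⁻ w, F w * H z w ∂(μ.withDensity D₁) =
            ∫⁻ w, ((fun w => F w * (h w)⁻¹ * H z w ^ (1 / p)) * fun w => h w * H z w ^ (1 / q)) w
              ∂(μ.withDensity D₁) := by
          refine lintegral_congr_ae ?_
          filter_upwards [hac.ae_le hh0] with w hw
          simp only [Pi.mul_apply]
          have e1 : H z w ^ (1 / p) * H z w ^ (1 / q) = H z w := by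
            rw [← ENNReal.rpow_add_of_nonneg _ _ (by positivity) (by positivity), one_div, one_div,
              hpq.inv_add_inv_eq_one, ENNReal.rpow_one]
          calc F w * H z w = F w * H z w * ((h w)⁻¹ * h w) := by
                rw [ENNReal.inv_mul_cancel hw.1 hw.2, mul_one]
            _ = F w * (H z w ^ (1 / p) * H z w ^ (1 / q)) * ((h w)⁻¹ * h w) := by rw [e1]
            _ = _ := by ring
        have hol := ENNReal.lintegral_mul_le_Lp_mul_Lq (μ.withDensity D₁) hpq
          (f := fun w => F w * (h w)⁻¹ * H z w ^ (1 / p)) (g := fun w => h w * H z w ^ (1 / q))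
          ((hF.mul hh.inv).mul ((hH2 z).pow_const _)).aemeasurable
          (hh.mul ((hH2 z).pow_const _)).aemeasurable
        have e2 : ∀ w, (F w * (h w)⁻¹ * H z w ^ (1 / p)) ^ p = F w ^ p * (h w ^ p)⁻¹ * H z w := by
          intro w
          rw [ENNReal.mul_rpow_of_nonneg _ _ hp.le, ENNReal.mul_rpow_of_nonneg _ _ hp.le,
            ENNReal.inv_rpow, ← ENNReal.rpow_mul, one_div, inv_mul_cancel₀ hp.ne', ENNReal.rpow_one]
        have e3 : ∀ w, (h w * H z w ^ (1 / q)) ^ q = H z w * h w ^ q := by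
          intro w
          rw [ENNReal.mul_rpow_of_nonneg _ _ hq.le, ← ENNReal.rpow_mul, one_div,
            inv_mul_cancel₀ hq.ne', ENNReal.rpow_one, mul_comm]
        simp only [e2, e3] at hol
        rw [e]
        calc _ ≤ ((∫⁻ w, F w ^ p * (h w ^ p)⁻¹ * H z w ∂(μ.withDensity D₁)) ^ (1 / p) *
              (C₁ * h z ^ q) ^ (1 / q)) ^ p := by
              refine ENNReal.rpow_le_rpow (hol.trans ?_) hp.le
              gcongr
          _ = _ := by
              rw [ENNReal.mul_rpow_of_nonneg _ _ hp.le, ← ENNReal.rpow_mul, one_div,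
                inv_mul_cancel₀ hp.ne', ENNReal.rpow_one,
                ENNReal.mul_rpow_of_nonneg _ _ (by positivity), ENNReal.mul_rpow_of_nonneg _ _ hp.le,
                ← ENNReal.rpow_mul, ← ENNReal.rpow_mul, ← ENNReal.rpow_mul, one_div,
                mul_inv_cancel_left₀ hq.ne', inv_mul_eq_div]
              ring
    _ = C₁ ^ (p / q) * ∫⁻ z, (∫⁻ w, F w ^ p * (h w ^ p)⁻¹ * H z w ∂(μ.withDensity D₁)) * h z ^ p
          ∂(μ.withDensity D₂) := by
        refine lintegral_const_mul _ (Measurable.mul ?_ (hh.pow_const _))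
        exact ((((hF.pow_const p).mul (hh.pow_const p).inv).comp measurable_snd).mul
          hH).lintegral_prod_right'
    _ ≤ C₁ ^ (p / q) * (C₂ * ∫⁻ w, F w ^ p ∂(μ.withDensity D₂)) := by
        gcongr
        refine lintegral_lintegral_weight_le hD₁ hD₂ hH (hh.pow_const p) (hF.pow_const p) ?_ h₂
        filter_upwards [hh0] with w hw
        exact ⟨by simp [hw.1, hw.2], ENNReal.rpow_ne_top_of_nonneg hp.le hw.2⟩
    _ = _ := by ring

end Schur

/-! ### Radial weights and the positive majorant -/

/-- The kernel `|1 - ⟨z, w⟩| ^ (-m)`. -/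
noncomputable def absKernel (m : ℝ) (z w : Cn n) : ℝ≥0∞ :=
  ENNReal.ofReal (‖1 - (inner ℂ w z : ℂ)‖ ^ (-m))

lemma measurable_absKernel (n : ℕ) (m : ℝ) :
    Measurable (Function.uncurry (absKernel (n := n) m)) := by
  unfold absKernel Function.uncurry
  refine Measurable.ennreal_ofReal (Measurable.pow_const ?_ _)
  exact Continuous.measurable (by fun_prop)

lemma measurable_absKernel_left (m : ℝ) (z : Cn n) : Measurable (absKernel m z) := by
  unfold absKernel
  refine Measurable.ennreal_ofReal (Measurable.pow_const ?_ _)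
  exact Continuous.measurable (by fun_prop)

lemma absKernel_comm (m : ℝ) (z w : Cn n) : absKernel m z w = absKernel m w z := by
  unfold absKernel
  rw [← inner_conj_symm, ← Complex.norm_conj]
  simp

/-- The density as a function with values in `[0, ∞]`. -/
noncomputable def edens (n : ℕ) (a b : ℝ) (z : Cn n) : ℝ≥0∞ := ENNReal.ofReal (density n a b z)

lemma measurable_edens (n : ℕ) (a b : ℝ) : Measurable (edens n a b) :=
  (measurable_density n a b).ennreal_ofReal

lemma mu_eq (n : ℕ) (a b : ℝ) :
    mu n a b = (volume.restrict (unitBall n)).withDensity (edens n a b) := rfl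

lemma ae_restrict_unitBall (hn : 1 ≤ n) :
    ∀ᵐ w ∂(volume.restrict (unitBall n)), 0 < ‖w‖ ∧ ‖w‖ < 1 := by
  have : Nonempty (Fin n) := ⟨⟨0, hn⟩⟩
  have h0 : ∀ᵐ w ∂(volume : Measure (Cn n)), w ≠ 0 := by
    rw [ae_iff]; simp
  filter_upwards [ae_restrict_mem (measurableSet_unitBall n), ae_restrict_of_ae h0] with w h1 h2
  exact ⟨norm_pos_iff.2 h2, mem_unitBall.1 h1⟩

lemma mu_absolutelyContinuous_volume (n : ℕ) (a b : ℝ) : mu n a b ≪ volume.restrict (unitBall n) :=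
  withDensity_absolutelyContinuous _ _

lemma volume_absolutelyContinuous_mu (hn : 1 ≤ n) {a b : ℝ} (ha : -1 < a) (hb : -(n : ℝ) < b) :
    volume.restrict (unitBall n) ≪ mu n a b := by
  refine withDensity_absolutelyContinuous' (measurable_edens n a b).aemeasurable ?_
  filter_upwards [ae_restrict_unitBall hn] with w hw
  have := mul_pos (massConst_pos (n := n) ha hb) (radial_pos (a := a) (b := b) hw.1 hw.2)
  simpa [edens, density_eq] using this

lemma mu_absolutelyContinuous_mu (hn : 1 ≤ n) {a b c d : ℝ} (hc : -1 < c) (hd : -(n : ℝ) < d) :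
    mu n a b ≪ mu n c d :=
  (mu_absolutelyContinuous_volume n a b).trans (volume_absolutelyContinuous_mu hn hc hd)

lemma ae_mu (hn : 1 ≤ n) (a b : ℝ) : ∀ᵐ w ∂(mu n a b), 0 < ‖w‖ ∧ ‖w‖ < 1 :=
  (mu_absolutelyContinuous_volume n a b).ae_le (ae_restrict_unitBall hn)

lemma radial_mul_radial {a b x y r : ℝ} (h0 : 0 < r) (h1 : r < 1) :
    radial a b r * radial x y r = radial (a + x) (b + y) r := by
  have : 0 < 1 - r ^ 2 := by nlinarith
  rw [radial, radial, radial, mul_add, Real.rpow_add h0, Real.rpow_add this]; ring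

lemma radial_rpow {a b r : ℝ} (h0 : 0 < r) (h1 : r < 1) (p : ℝ) :
    radial a b r ^ p = radial (a * p) (b * p) r := by
  have : 0 < 1 - r ^ 2 := by nlinarith
  rw [radial, radial, Real.mul_rpow (by positivity) (by positivity), ← Real.rpow_mul h0.le,
    ← Real.rpow_mul this.le]
  ring_nf

/-- A radial power weight only shifts the parameters of the measure, up to a ratio of normalizing
constants. Weighted integrals thus reduce to unweighted ones for another `μ`. -/
lemma lintegral_mul_radial (hn : 1 ≤ n) {a b x y : ℝ} (ha : -1 < a) (hb : -(n : ℝ) < b)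
    (hax : -1 < a + x) (hby : -(n : ℝ) < b + y) {F : Cn n → ℝ≥0∞} (hF : Measurable F) :
    ∫⁻ w, F w * ENNReal.ofReal (radial x y ‖w‖) ∂(mu n a b) =
      ENNReal.ofReal (massConst n a b / massConst n (a + x) (b + y)) *
        ∫⁻ w, F w ∂(mu n (a + x) (b + y)) := by
  have h1 := massConst_pos (n := n) ha hb
  have h2 := massConst_pos (n := n) hax hby
  rw [mu_eq, mu_eq, lintegral_withDensity_eq_lintegral_mul _ (measurable_edens n a b)
    (g := fun w => F w * ENNReal.ofReal (radial x y ‖w‖)) (hF.mul ((measurable_radial x y).comp measurable_norm).ennreal_ofReal),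
    lintegral_withDensity_eq_lintegral_mul _ (measurable_edens n _ _) hF]
  refine Eq.trans ?_ (lintegral_const_mul _ ((measurable_edens n _ _).mul hF))
  refine lintegral_congr_ae ?_
  filter_upwards [ae_restrict_unitBall hn] with w hw
  simp only [Pi.mul_apply, edens, density_eq]
  rw [← radial_mul_radial hw.1 hw.2]
  have r1 := radial_pos (a := a) (b := b) hw.1 hw.2
  have r2 := radial_pos (a := x) (b := y) hw.1 hw.2
  calc ENNReal.ofReal (massConst n a b * radial a b ‖w‖) *
        (F w * ENNReal.ofReal (radial x y ‖w‖))
      = (ENNReal.ofReal (massConst n a b * radial a b ‖w‖) * ENNReal.ofReal (radial x y ‖w‖)) *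
        F w := by ring
    _ = (ENNReal.ofReal (massConst n a b / massConst n (a + x) (b + y)) *
        ENNReal.ofReal (massConst n (a + x) (b + y) * (radial a b ‖w‖ * radial x y ‖w‖))) * F w := by
        rw [← ENNReal.ofReal_mul (by positivity), ← ENNReal.ofReal_mul (by positivity)]
        congr 2; field_simp
    _ = _ := by ring

/-- The Forelli–Rudin estimate for the shifted measure, with `s = m - (n+1+a+x)`. The bound does not
involve `b` or `y` apart from the constant. -/
lemma exists_lintegral_absKernel_mul_radial_le (hn : 1 ≤ n) {a b x y m : ℝ} (ha : -1 < a)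
    (hb : -(n : ℝ) < b) (hax : -1 < a + x) (hby : -(n : ℝ) < b + y) (hm : n + 1 + a + x < m) :
    ∃ C, 0 < C ∧ ∀ z : Cn n, ‖z‖ < 1 →
      ∫⁻ w, absKernel m z w * ENNReal.ofReal (radial x y ‖w‖) ∂(mu n a b) ≤
        ENNReal.ofReal (C * (1 - ‖z‖ ^ 2) ^ (n + 1 + a + x - m)) := by
  obtain ⟨C, hC, h⟩ := exists_lintegral_norm_rpow_le hn hax hby
    (s := m - (n + 1 + a + x)) (by linarith)
  have h1 := massConst_pos (n := n) ha hb
  have h2 := massConst_pos (n := n) hax hby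
  refine ⟨massConst n a b / massConst n (a + x) (b + y) * C, by positivity, fun z hz => ?_⟩
  rw [lintegral_mul_radial hn ha hb hax hby (measurable_absKernel_left m z), mul_assoc,
    ENNReal.ofReal_mul (div_pos h1 h2).le]
  refine mul_le_mul_right ?_ _
  have h3 := h z hz
  have e1 : n + 1 + (a + x) + (m - (n + 1 + a + x)) = m := by ring
  have e2 : -(m - (n + 1 + a + x)) = n + 1 + a + x - m := by ring
  rw [e1, e2] at h3
  exact h3

/-- Boundedness of the positive operator majorizing the Bergman projection. -/
lemma exists_lintegral_absKernel_rpow_le (hn : 1 ≤ n) {a b c d p : ℝ} (ha : -1 < a) (hc : -1 < c)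
    (hb : -(n : ℝ) < b) (hd : -(n : ℝ) < d) (hp : 1 ≤ p) (hC : ConditionC n a b c d p) :
    ∃ C : ℝ≥0, ∀ F : Cn n → ℝ≥0∞, Measurable F →
      ∫⁻ z, (∫⁻ w, F w * absKernel (n + 1 + a) z w ∂(mu n a b)) ^ p ∂(mu n c d) ≤
        C * ∫⁻ w, F w ^ p ∂(mu n c d) := by
  obtain ⟨hC1, hC2, hC3⟩ := hC
  have m1 := massConst_pos (n := n) ha hb
  have m2 := massConst_pos (n := n) hc hd
  have sf1 : SFinite ((volume.restrict (unitBall n)).withDensity (edens n a b)) :=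
    (isRotInvariant_mu n a b).sfinite
  have sf2 : SFinite ((volume.restrict (unitBall n)).withDensity (edens n c d)) :=
    (isRotInvariant_mu n c d).sfinite
  -- the second hypothesis of the Schur test
  have second : ∀ x y : ℝ, -1 < c + p * x → c + p * x < a → -(n : ℝ) < d + p * y →
      p * y ≤ b - d → ∃ C : ℝ≥0, ∀ᵐ w ∂(volume.restrict (unitBall n)),
      edens n a b w * ∫⁻ z, absKernel (n + 1 + a) z w *
        ENNReal.ofReal (radial (p * x) (p * y) ‖z‖) ∂(mu n c d) ≤
        C * edens n c d w * ENNReal.ofReal (radial (p * x) (p * y) ‖w‖) := by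
    intro x y h1 h2 h3 h4
    obtain ⟨K, hK, hKle⟩ := exists_lintegral_absKernel_mul_radial_le hn hc hd h1 h3
      (m := n + 1 + a) (by linarith)
    refine ⟨(massConst n a b / massConst n c d * K).toNNReal, ?_⟩
    filter_upwards [ae_restrict_unitBall hn] with w hw
    have hw2 : 0 < 1 - ‖w‖ ^ 2 := by nlinarith [hw.1, hw.2]
    have r1 := radial_pos (a := a) (b := b) hw.1 hw.2
    have r2 := radial_pos (a := c) (b := d) hw.1 hw.2
    have h5 := hKle w hw.2
    simp only [absKernel_comm _ w] at h5
    refine (mul_le_mul_right h5 _).trans ?_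
    rw [edens, edens, density_eq, density_eq, ← ENNReal.ofReal_mul (by positivity)]
    change _ ≤ ENNReal.ofReal _ * _ * _
    rw [← ENNReal.ofReal_mul (by positivity), ← ENNReal.ofReal_mul (by positivity)]
    refine ENNReal.ofReal_le_ofReal ?_
    rw [mul_assoc _ (massConst n c d * _), mul_assoc (massConst n c d), radial_mul_radial hw.1 hw.2]
    have e1 : massConst n a b / massConst n c d * K *
        (massConst n c d * radial (c + p * x) (d + p * y) ‖w‖) =
        massConst n a b * K * radial (c + p * x) (d + p * y) ‖w‖ := by field_simp
    have e2 : massConst n a b * radial a b ‖w‖ *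
        (K * (1 - ‖w‖ ^ 2) ^ (n + 1 + c + p * x - (n + 1 + a))) =
        massConst n a b * K * (‖w‖ ^ (2 * b) * (1 - ‖w‖ ^ 2) ^ (c + p * x)) := by
      have : (1 - ‖w‖ ^ 2) ^ a * (1 - ‖w‖ ^ 2) ^ (n + 1 + c + p * x - (n + 1 + a)) =
          (1 - ‖w‖ ^ 2) ^ (c + p * x) := by
        rw [← Real.rpow_add hw2]; congr 1; ring
      rw [radial, ← this]; ring
    -- Because `d + p y ≤ b` and `|w| < 1`, the power of `|w|` carried by `μ_{a,b}` is the smaller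
    -- one.
    have h6 : ‖w‖ ^ (2 * b) ≤ ‖w‖ ^ (2 * (d + p * y)) :=
      Real.rpow_le_rpow_of_exponent_ge hw.1 hw.2.le (by linarith)
    rw [e1, e2, radial]
    exact mul_le_mul_of_nonneg_left (mul_le_mul_of_nonneg_right h6 (by positivity)) (by positivity)
  have hHm := measurable_absKernel n (n + 1 + a)
  rcases hp.eq_or_lt with rfl | hp1
  -- For `p = 1` the weight is constant, and (C) says exactly `c < a` and `d ≤ b`, which is what
  -- `second` asks of `x = y = 0`.
  · obtain ⟨C, hC⟩ := second 0 0 (by linarith) (by linarith) (by linarith)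
      (by linarith [hC3 rfl])
    refine ⟨C, fun F hF => ?_⟩
    have h := lintegral_lintegral_weight_le (C := C) (measurable_edens n a b) (measurable_edens n c d)
      hHm (measurable_const (a := (1 : ℝ≥0∞))) hF (ae_of_all _ fun _ => by simp) (by
        filter_upwards [hC] with w hw
        simpa [radial] using! hw)
    simpa using! h
  · have hdb := hC2 hp1
    have hpq := Real.HolderConjugate.conjExponent hp1
    set q := p.conjExponent with hq
    have hq0 := hpq.symm.pos
    have hp0 := hpq.pos
    have hqp : p = q * (p - 1) := by rw [mul_comm]; exact hpq.sub_one_mul_conj.symm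
    -- The lower bounds keep `a + q x` and `c + p x` above `-1`; the upper bounds make both
    -- Forelli–Rudin exponents supercritical. The only comparison that is not automatic, `-(a+1)/q <
    -- (a-c)/p`, is equivalent to `c + 1 < p (a + 1)`.
    obtain ⟨x, hx1, hx2⟩ : ∃ x, max (-(a + 1) / q) (-(c + 1) / p) < x ∧ x < min 0 ((a - c) / p) := by
      refine exists_between ?_
      rw [max_lt_iff, lt_min_iff, lt_min_iff]
      refine ⟨⟨?_, ?_⟩, ?_, ?_⟩
      · exact div_neg_of_neg_of_pos (by linarith) hq0
      · rw [div_lt_div_iff₀ hq0 hp0, hqp]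
        nlinarith
      · exact div_neg_of_neg_of_pos (by linarith) hp0
      · gcongr; linarith
    obtain ⟨hx1, hx1'⟩ := max_lt_iff.1 hx1
    obtain ⟨hx2, hx2'⟩ := lt_min_iff.1 hx2
    rw [div_lt_iff₀ hq0] at hx1
    rw [div_lt_iff₀ hp0] at hx1'
    rw [lt_div_iff₀ hp0] at hx2'
    obtain ⟨y, hy1, hy1', hy2, hy2'⟩ : ∃ y : ℝ, -(n : ℝ) < b + q * y ∧ -(n : ℝ) < d + p * y ∧ y ≤ 0 ∧
        p * y ≤ b - d := by
      -- The largest `y` allowed by the last two constraints. The first constraint then reduces to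
      -- `d + n < p (b + n)`, as `q (b-d)/p = (b-d)/(p-1)`.
      refine ⟨min 0 ((b - d) / p), ?_, ?_, min_le_left _ _, ?_⟩
      · rcases min_choice 0 ((b - d) / p) with h | h <;> rw [h]
        · linarith
        · have h1 : q * ((b - d) / p) * (p - 1) = b - d := by
            rw [show q * ((b - d) / p) * (p - 1) = (b - d) / p * (q * (p - 1)) by ring, ← hqp]
            field_simp
          have h2 : 0 < (b + n + q * ((b - d) / p)) * (p - 1) := by rw [add_mul, h1]; linarith
          have := (mul_pos_iff_of_pos_right (by linarith : 0 < p - 1)).1 h2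
          linarith
      · rcases min_choice 0 ((b - d) / p) with h | h <;> rw [h]
        · linarith
        · rw [mul_div_cancel₀ _ hp0.ne']; linarith
      · calc p * min 0 ((b - d) / p) ≤ p * ((b - d) / p) := by gcongr; exact min_le_right _ _
          _ = b - d := mul_div_cancel₀ _ hp0.ne'
    obtain ⟨C₂, hC₂⟩ := second x y (by linarith) (by linarith) hy1' hy2'
    obtain ⟨C₁, hC₁, hC₁le⟩ := exists_lintegral_absKernel_mul_radial_le (x := q * x) (y := q * y)
      hn ha hb (by linarith) hy1 (m := n + 1 + a) (by nlinarith)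
    refine ⟨C₁.toNNReal ^ (p / q) * C₂, fun F hF => ?_⟩
    have hpow : ∀ s : ℝ, ∀ᵐ w ∂(volume.restrict (unitBall n)),
        ENNReal.ofReal (radial x y ‖w‖) ^ s = ENNReal.ofReal (radial (s * x) (s * y) ‖w‖) := by
      intro s
      filter_upwards [ae_restrict_unitBall hn] with w hw
      rw [ENNReal.ofReal_rpow_of_pos (radial_pos hw.1 hw.2), radial_rpow hw.1 hw.2, mul_comm x,
        mul_comm y]
    have h := schur_test (C₁ := C₁.toNNReal) (C₂ := C₂) (measurable_edens n a b)
      (measurable_edens n c d) hHm (h := fun w => ENNReal.ofReal (radial x y ‖w‖))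
      ((measurable_radial x y).comp measurable_norm).ennreal_ofReal hF
      (by
        filter_upwards [ae_restrict_unitBall hn] with w hw
        exact ⟨by simpa using radial_pos hw.1 hw.2, ENNReal.ofReal_ne_top⟩) hpq
      (by
        filter_upwards [ae_mu hn c d, (mu_absolutelyContinuous_volume n c d).ae_le (hpow q)] with z hz hz'
        have e : ∫⁻ w, absKernel (n + 1 + a) z w * ENNReal.ofReal (radial x y ‖w‖) ^ q ∂(mu n a b) =
            ∫⁻ w, absKernel (n + 1 + a) z w * ENNReal.ofReal (radial (q * x) (q * y) ‖w‖)
              ∂(mu n a b) := by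
          refine lintegral_congr_ae ?_
          filter_upwards [(mu_absolutelyContinuous_volume n a b).ae_le (hpow q)] with w hw
          rw [hw]
        refine (e.trans_le (hC₁le z hz.2)).trans ?_
        rw [hz']
        change _ ≤ ENNReal.ofReal _ * _
        rw [← ENNReal.ofReal_mul hC₁.le, radial]
        refine ENNReal.ofReal_le_ofReal ?_
        have hz2 : 0 < 1 - ‖z‖ ^ 2 := by nlinarith [hz.1, hz.2]
        have e3 : (n + 1 + a + q * x - (n + 1 + a)) = q * x := by ring
        rw [e3]
        gcongr
        -- Since `y ≤ 0`, the factor `|z|^{2qy}` missing from the Forelli–Rudin bound is at least 1.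
        refine le_mul_of_one_le_left (by positivity) ?_
        exact Real.one_le_rpow_of_pos_of_le_one_of_nonpos hz.1 hz.2.le (by nlinarith))
      (by
        filter_upwards [hC₂, hpow p] with w hw hw'
        rw [hw']
        refine le_trans (le_of_eq ?_) hw
        congr 1
        refine lintegral_congr_ae ?_
        filter_upwards [(mu_absolutelyContinuous_volume n c d).ae_le (hpow p)] with z hz
        rw [hz])
    refine h.trans (le_of_eq ?_)
    rw [ENNReal.coe_mul, ENNReal.coe_rpow_of_nonneg _ (by positivity)]
    rfl

/-! ### Holomorphy and pointwise domination of the projection -/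

lemma continuousOn_kernelFun (n : ℕ) {a b : ℝ} (hb : 0 < b + n) :
    ContinuousOn (kernelFun n a b) (Metric.ball 0 1) :=
  (differentiableOn_kernelFun n hb).continuousOn

lemma exists_bound_on_disc {f : ℂ → ℂ} (hf : ContinuousOn f (Metric.ball 0 1)) {r : ℝ} (hr : r < 1) :
    ∃ M, ∀ ξ : ℂ, ‖ξ‖ ≤ r → ‖f ξ‖ ≤ M := by
  obtain ⟨M, hM⟩ := (isCompact_closedBall (0 : ℂ) r).exists_bound_of_continuousOn
    (hf.mono (Metric.closedBall_subset_ball hr))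
  exact ⟨M, fun ξ hξ => hM ξ (by simpa using hξ)⟩

lemma norm_inner_le_right {z w : Cn n} (hw : ‖w‖ < 1) : ‖(inner ℂ w z : ℂ)‖ ≤ ‖z‖ :=
  (norm_inner_le_norm w z).trans (by nlinarith [norm_nonneg z])

lemma integrable_mul_kernelFun {a b : ℝ} (hb : 0 < b + n) {f : Cn n → ℂ}
    (hf : Integrable f (mu n a b)) {z : Cn n} (hz : ‖z‖ < 1) :
    Integrable (fun w => f w * kernelFun n a b (inner ℂ w z)) (mu n a b) := by
  obtain ⟨M, hM⟩ := exists_bound_on_disc (continuousOn_kernelFun n (a := a) hb) hz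
  refine hf.mul_bdd (c := M) (aestronglyMeasurable_inner_comp (isRotInvariant_mu n a b)
    (continuousOn_kernelFun n hb) hz) ?_
  filter_upwards [(isRotInvariant_mu n a b).ae_mem] with w hw
  exact hM _ (norm_inner_le_right (mem_unitBall.1 hw))

/-- The Bergman projection of an integrable function is holomorphic. -/
lemma differentiableOn_proj {a b : ℝ} (hb : 0 < b + n) {f : Cn n → ℂ}
    (hf : Integrable f (mu n a b)) : DifferentiableOn ℂ (proj n a b f) (unitBall n) := by
  intro z₀ hz₀
  have hμ := isRotInvariant_mu n a b
  obtain ⟨r, hr1, hr2⟩ := exists_between (mem_unitBall.1 hz₀)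
  have hK := differentiableOn_kernelFun n (a := a) hb
  have hK' : ContinuousOn (deriv (kernelFun n a b)) (Metric.ball 0 1) :=
    (hK.deriv Metric.isOpen_ball).continuousOn
  obtain ⟨M, hM⟩ := exists_bound_on_disc hK' hr2
  have hz₀1 := mem_unitBall.1 hz₀
  have key := hasFDerivAt_integral_of_dominated_of_fderiv_le (𝕜 := ℂ) (μ := mu n a b)
    (F := fun z w => f w * kernelFun n a b (inner ℂ w z))
    (F' := fun z w => (f w * deriv (kernelFun n a b) (inner ℂ w z)) • innerSL ℂ w)
    (x₀ := z₀) (s := Metric.ball 0 r) (bound := fun w => ‖f w‖ * M)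
    (Metric.isOpen_ball.mem_nhds (by simpa using hr1))
    (by
      filter_upwards [Metric.isOpen_ball.mem_nhds (show z₀ ∈ Metric.ball 0 1 by simpa using hz₀1)]
        with z hz
      exact (integrable_mul_kernelFun hb hf (by simpa using hz)).1)
    (integrable_mul_kernelFun hb hf hz₀1)
    ((hf.1.mul (aestronglyMeasurable_inner_comp hμ hK' hz₀1)).smul
      (innerSL ℂ).continuous.aestronglyMeasurable)
    (by
      filter_upwards [hμ.ae_mem] with w hw z hz
      have hw1 := mem_unitBall.1 hw
      have hz1 : ‖z‖ < r := by simpa using hz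
      have hMz := hM _ ((norm_inner_le_right hw1).trans hz1.le)
      rw [norm_smul, norm_mul, innerSL_apply_norm]
      have : 0 ≤ M := (norm_nonneg _).trans hMz
      calc _ ≤ ‖f w‖ * M * 1 := by gcongr
        _ = _ := mul_one _)
    (hf.norm.mul_const M)
    (by
      filter_upwards [hμ.ae_mem] with w hw z hz
      have hw1 := mem_unitBall.1 hw
      have hz1 : ‖z‖ < 1 := (show ‖z‖ < r by simpa using hz).trans hr2
      have hd : HasDerivAt (kernelFun n a b) (deriv (kernelFun n a b) (inner ℂ w z)) (inner ℂ w z) :=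
        (hK.differentiableAt (Metric.isOpen_ball.mem_nhds
          (by simpa using norm_inner_lt_one hz1 hw1))).hasDerivAt
      have h2 := hd.comp_hasFDerivAt z (innerSL ℂ w).hasFDerivAt
      have h3 := h2.const_mul (f w)
      rw [smul_smul] at h3
      exact h3)
  exact key.differentiableAt.differentiableWithinAt

lemma aestronglyMeasurable_mu_of_differentiableOn {c d : ℝ} {g : Cn n → ℂ}
    (hg : DifferentiableOn ℂ g (unitBall n)) : AEStronglyMeasurable g (mu n c d) := by
  have := hg.continuousOn.aestronglyMeasurable (μ := mu n c d) (measurableSet_unitBall n)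
  rwa [Measure.restrict_eq_self_of_ae_mem (isRotInvariant_mu n c d).ae_mem] at this

/-- The projection is dominated by the positive operator with kernel `|1 - ⟨z, w⟩|^(-(n+1+a))`. -/
lemma exists_enorm_proj_le (n : ℕ) {a b : ℝ} (ha : -1 < a) (hb : 0 < b + n) :
    ∃ M : ℝ≥0, ∀ (f : Cn n → ℂ) (z : Cn n), ‖z‖ < 1 →
      ‖proj n a b f z‖ₑ ≤ M * ∫⁻ w, ‖f w‖ₑ * absKernel (n + 1 + a) z w ∂(mu n a b) := by
  obtain ⟨M, hM, h⟩ := exists_norm_kernelFun_le n ha hb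
  refine ⟨M.toNNReal, fun f z hz => ?_⟩
  rw [proj, ← lintegral_const_mul' _ _ ENNReal.coe_ne_top]
  refine (enorm_integral_le_lintegral_enorm _).trans (lintegral_mono_ae ?_)
  filter_upwards [(isRotInvariant_mu n a b).ae_mem] with w hw
  have h1 := h _ (norm_inner_lt_one hz (mem_unitBall.1 hw))
  rw [enorm_mul, ← mul_assoc, mul_comm (M.toNNReal : ℝ≥0∞), mul_assoc]
  refine mul_le_mul_right ?_ _
  rw [absKernel]
  change _ ≤ ENNReal.ofReal _ * _
  rw [← ENNReal.ofReal_mul hM.le, ← ofReal_norm]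
  refine ENNReal.ofReal_le_ofReal ?_
  rwa [show (n + 1 + a : ℝ) = a + n + 1 by ring]

/-! ### Sufficiency of (C) -/

section PartOne

variable {a b c d p : ℝ}

lemma lintegral_enorm_rpow_lt_top (hp : 1 ≤ p) {f : Cn n → ℂ} (hf : InLp n c d p f) :
    ∫⁻ w, ‖f w‖ₑ ^ p ∂(mu n c d) < ∞ := by
  have hp0 : 0 < p := by linarith
  have := lintegral_rpow_enorm_lt_top_of_eLpNorm_lt_top (by simpa using hp0) ENNReal.ofReal_ne_top
    (MemLp.eLpNorm_lt_top hf)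
  rwa [ENNReal.toReal_ofReal hp0.le] at this

lemma lpNorm_eq (hp : 1 ≤ p) (f : Cn n → ℂ) :
    lpNorm n c d p f = (∫⁻ w, ‖f w‖ₑ ^ p ∂(mu n c d)) ^ (1 / p) := by
  have hp0 : 0 < p := by linarith
  rw [lpNorm, eLpNorm_eq_lintegral_rpow_enorm_toReal (by simpa using hp0) ENNReal.ofReal_ne_top,
    ENNReal.toReal_ofReal hp0.le]

/-- Boundedness of the positive operator, for functions that are measurable up to a null set. -/
lemma exists_lintegral_enorm_absKernel_rpow_le (hn : 1 ≤ n) (ha : -1 < a) (hc : -1 < c)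
    (hb : -(n : ℝ) < b) (hd : -(n : ℝ) < d) (hp : 1 ≤ p) (hC : ConditionC n a b c d p) :
    ∃ C : ℝ≥0, ∀ f : Cn n → ℂ, AEStronglyMeasurable f (mu n c d) →
      ∫⁻ z, (∫⁻ w, ‖f w‖ₑ * absKernel (n + 1 + a) z w ∂(mu n a b)) ^ p ∂(mu n c d) ≤
        C * ∫⁻ w, ‖f w‖ₑ ^ p ∂(mu n c d) := by
  obtain ⟨C, h⟩ := exists_lintegral_absKernel_rpow_le hn ha hc hb hd hp hC
  refine ⟨C, fun f hf => ?_⟩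
  have e1 := hf.ae_eq_mk
  have e2 := (mu_absolutelyContinuous_mu (a := a) (b := b) hn hc hd).ae_le e1
  have h1 := h (fun w => ‖hf.mk f w‖ₑ) hf.stronglyMeasurable_mk.enorm
  have r1 : ∀ z, ∫⁻ w, ‖f w‖ₑ * absKernel (n + 1 + a) z w ∂(mu n a b) =
      ∫⁻ w, ‖hf.mk f w‖ₑ * absKernel (n + 1 + a) z w ∂(mu n a b) := fun z =>
    lintegral_congr_ae (by filter_upwards [e2] with w hw; rw [hw])
  have r2 : ∫⁻ w, ‖f w‖ₑ ^ p ∂(mu n c d) = ∫⁻ w, ‖hf.mk f w‖ₑ ^ p ∂(mu n c d) :=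
    lintegral_congr_ae (by filter_upwards [e1] with w hw; rw [hw])
  simp only [r1, r2]
  exact h1

/-- The positive operator applied to `|f|` has finite `L^p(μ_{c,d})` norm, so it is finite at some
`z` in the ball. Its kernel is bounded below there, so `|f|` itself is integrable. -/
lemma integrable_of_inLp (hn : 1 ≤ n) (ha : -1 < a) (hc : -1 < c)
    (hb : -(n : ℝ) < b) (hd : -(n : ℝ) < d) (hp : 1 ≤ p) (hC : ConditionC n a b c d p)
    {f : Cn n → ℂ} (hf : InLp n c d p f) : Integrable f (mu n a b) := by
  have hp0 : 0 < p := by linarith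
  have hn0 : (0 : ℝ) < n := by exact_mod_cast hn
  obtain ⟨C, h⟩ := exists_lintegral_enorm_absKernel_rpow_le hn ha hc hb hd hp hC
  have := isProbabilityMeasure_mu hn hc hd
  refine ⟨hf.1.mono_ac (mu_absolutelyContinuous_mu hn hc hd), ?_⟩
  have hfin : ∫⁻ z, (∫⁻ w, ‖f w‖ₑ * absKernel (n + 1 + a) z w ∂(mu n a b)) ^ p ∂(mu n c d) ≠ ∞ :=
    ((h f hf.1).trans_lt
      (ENNReal.mul_lt_top ENNReal.coe_lt_top (lintegral_enorm_rpow_lt_top hp hf))).ne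
  obtain ⟨z, hz, hzfin⟩ : ∃ z : Cn n, ‖z‖ < 1 ∧
      ∫⁻ w, ‖f w‖ₑ * absKernel (n + 1 + a) z w ∂(mu n a b) < ∞ := by
    by_contra! hcon
    refine hfin ?_
    have : ∀ᵐ z ∂(mu n c d), (∞ : ℝ≥0∞) =
        (∫⁻ w, ‖f w‖ₑ * absKernel (n + 1 + a) z w ∂(mu n a b)) ^ p := by
      filter_upwards [ae_mu hn c d] with z hz
      rw [top_le_iff.1 (hcon z hz.2), ENNReal.top_rpow_of_pos hp0]
    rw [← lintegral_congr_ae this]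
    simp
  -- On the ball `|1 - ⟨z, w⟩| ≤ 2`, so this is a lower bound for the kernel.
  set ε := ENNReal.ofReal ((2 : ℝ) ^ (-(n + 1 + a))) with hε
  have hε0 : ε ≠ 0 := by
    rw [hε]; simpa using Real.rpow_pos_of_pos two_pos _
  have hle : ε * ∫⁻ w, ‖f w‖ₑ ∂(mu n a b) ≤
      ∫⁻ w, ‖f w‖ₑ * absKernel (n + 1 + a) z w ∂(mu n a b) := by
    rw [← lintegral_const_mul' _ _ ENNReal.ofReal_ne_top]
    refine lintegral_mono_ae ?_
    filter_upwards [ae_mu hn a b] with w hw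
    rw [mul_comm]
    refine mul_le_mul_right (ENNReal.ofReal_le_ofReal ?_) _
    have h1 := norm_inner_lt_one hz hw.2
    refine Real.rpow_le_rpow_of_nonpos (norm_one_sub_pos h1) ?_ (by linarith)
    calc ‖1 - (inner ℂ w z : ℂ)‖ ≤ ‖(1 : ℂ)‖ + ‖(inner ℂ w z : ℂ)‖ := norm_sub_le _ _
      _ ≤ 2 := by rw [norm_one]; linarith
  have h2 := hle.trans_lt hzfin
  rw [HasFiniteIntegral]
  by_contra hcon
  rw [not_lt, top_le_iff] at hcon
  rw [hcon, ENNReal.mul_top hε0] at h2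
  exact lt_irrefl _ h2

lemma projBounded_of_conditionC (hn : 1 ≤ n) (ha : -1 < a) (hc : -1 < c)
    (hb : -(n : ℝ) < b) (hd : -(n : ℝ) < d) (hp : 1 ≤ p) (hC : ConditionC n a b c d p) :
    ProjBounded n a b c d p := by
  have hp0 : 0 < p := by linarith
  have hbn : 0 < b + n := by linarith
  obtain ⟨C, h⟩ := exists_lintegral_enorm_absKernel_rpow_le hn ha hc hb hd hp hC
  obtain ⟨M, hM⟩ := exists_enorm_proj_le n ha hbn
  refine ⟨M * C ^ (1 / p), fun f hf hfi => ?_⟩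
  have hle : lpNorm n c d p (proj n a b f) ≤ (M * C ^ (1 / p) : ℝ≥0) * lpNorm n c d p f := by
    rw [lpNorm_eq hp, lpNorm_eq hp]
    have h1 : ∫⁻ z, ‖proj n a b f z‖ₑ ^ p ∂(mu n c d) ≤
        (M : ℝ≥0∞) ^ p * (C * ∫⁻ w, ‖f w‖ₑ ^ p ∂(mu n c d)) := by
      calc _ ≤ ∫⁻ z, (M : ℝ≥0∞) ^ p *
            (∫⁻ w, ‖f w‖ₑ * absKernel (n + 1 + a) z w ∂(mu n a b)) ^ p ∂(mu n c d) := by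
            refine lintegral_mono_ae ?_
            filter_upwards [ae_mu hn c d] with z hz
            rw [← ENNReal.mul_rpow_of_nonneg _ _ hp0.le]
            exact ENNReal.rpow_le_rpow (hM f z hz.2) hp0.le
        _ = (M : ℝ≥0∞) ^ p * ∫⁻ z,
            (∫⁻ w, ‖f w‖ₑ * absKernel (n + 1 + a) z w ∂(mu n a b)) ^ p ∂(mu n c d) :=
            lintegral_const_mul' _ _ (ENNReal.rpow_ne_top_of_nonneg hp0.le ENNReal.coe_ne_top)
        _ ≤ _ := mul_le_mul_right (h f hf.1) _
    refine (ENNReal.rpow_le_rpow h1 (by positivity)).trans (le_of_eq ?_)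
    rw [ENNReal.mul_rpow_of_nonneg _ _ (by positivity),
      ENNReal.mul_rpow_of_nonneg _ _ (by positivity), ← ENNReal.rpow_mul, mul_one_div_cancel hp0.ne',
      ENNReal.rpow_one, ENNReal.coe_mul, ENNReal.coe_rpow_of_nonneg _ (by positivity), mul_assoc]
  refine ⟨⟨aestronglyMeasurable_mu_of_differentiableOn (differentiableOn_proj hbn hfi), ?_⟩, hle⟩
  exact hle.trans_lt (ENNReal.mul_lt_top ENNReal.coe_lt_top hf.eLpNorm_lt_top)

end PartOne

/-! ### Necessity: radial test functions -/

lemma kernelFun_zero (n : ℕ) (a b : ℝ) : kernelFun n a b 0 = 1 := by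
  simp [kernelFun]

/-- The projection of a radial function is constant on the ball. -/
lemma proj_of_radial {a b : ℝ} (hb : 0 < b + n) {ψ : ℝ → ℂ}
    (hf : Integrable (fun w : Cn n => ψ ‖w‖) (mu n a b)) {z : Cn n} (hz : ‖z‖ < 1) :
    proj n a b (fun w => ψ ‖w‖) z = ∫ w, ψ ‖w‖ ∂(mu n a b) := by
  have hμ := isRotInvariant_mu n a b
  have := hμ.sfinite
  -- The rotation runs backwards because `inner ℂ w z` is conjugate-linear in `w`; the kernel is
  -- then averaged along `e^{iθ}`, which leaves its value 1 at the origin.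
  refine (integral_eq_integral_loop_average (μ := mu n a b)
    (T := fun θ w => Complex.exp ((-θ : ℝ) * Complex.I) • w) (G := fun w => ψ ‖w‖)
    (by
      refine Continuous.measurable ?_
      simp only [Function.uncurry_def]
      fun_prop)
    (fun θ => by
      obtain ⟨T, hT⟩ := exists_isometry_smul (n := n) (norm_exp_I (-θ))
      rw [← funext hT]
      exact hμ.preserving T)
    (integrable_mul_kernelFun hb hf hz) ?_).2
  filter_upwards [hμ.ae_mem] with w hw
  have hin := norm_inner_lt_one hz (mem_unitBall.1 hw)
  have hd : DifferentiableOn ℂ (fun t : ℂ => ψ ‖w‖ * kernelFun n a b (t * inner ℂ w z))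
      (Metric.closedBall 0 1) := by
    refine DifferentiableOn.const_mul ((differentiableOn_kernelFun n hb).comp (by fun_prop) ?_) _
    intro t ht
    have ht : ‖t‖ ≤ 1 := by simpa using ht
    rw [mem_ball_zero_iff, norm_mul]
    nlinarith [norm_nonneg t, norm_nonneg (inner ℂ w z : ℂ)]
  have := integral_circle_mean_value hd
  simp only [zero_mul, kernelFun_zero, mul_one] at this
  rw [← this]
  refine intervalIntegral.integral_congr fun θ _ => ?_
  have hc : (starRingEnd ℂ) (Complex.exp ((-θ : ℝ) * Complex.I)) = Complex.exp (θ * Complex.I) := by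
    rw [← Complex.exp_conj]; simp
  simp only [norm_smul, norm_exp_I, one_mul, inner_smul_left, hc]

section PartTwo

variable {a b c d p : ℝ}

lemma lintegral_radial_mu (hn : 1 ≤ n) {x y : ℝ} (ha : -1 < a) (hb : -(n : ℝ) < b)
    (hax : -1 < a + x) (hby : -(n : ℝ) < b + y) :
    ∫⁻ w, ENNReal.ofReal (radial x y ‖w‖) ∂(mu n a b) =
      ENNReal.ofReal (massConst n a b / massConst n (a + x) (b + y)) := by
  have := isProbabilityMeasure_mu hn hax hby
  have h := lintegral_mul_radial hn ha hb hax hby (F := fun _ => 1) measurable_const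
  simpa using h

/-- Boundedness of the projection, tested on the radial power functions. -/
lemma exists_massConst_le_of_projBounded (hn : 1 ≤ n) (ha : -1 < a) (hc : -1 < c)
    (hb : -(n : ℝ) < b) (hd : -(n : ℝ) < d) (hp : 1 ≤ p) (h : ProjBounded n a b c d p) :
    ∃ M : ℝ, 0 ≤ M ∧ ∀ x y : ℝ, -1 < a + x → -(n : ℝ) < b + y → -1 < c + x * p →
      -(n : ℝ) < d + y * p →
      massConst n a b / massConst n (a + x) (b + y) ≤
        M * (massConst n c d / massConst n (c + x * p) (d + y * p)) ^ (1 / p) := by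
  obtain ⟨M, hM⟩ := h
  have hp0 : 0 < p := by linarith
  refine ⟨M, M.2, fun x y hax hby hcx hdy => ?_⟩
  have r1 := div_pos (massConst_pos (n := n) ha hb) (massConst_pos (n := n) hax hby)
  have r2 := div_pos (massConst_pos (n := n) hc hd) (massConst_pos (n := n) hcx hdy)
  have := isProbabilityMeasure_mu hn hc hd
  set f : Cn n → ℂ := fun w => ((radial x y ‖w‖ : ℝ) : ℂ) with hfdef
  have hfm : Measurable f :=
    Complex.measurable_ofReal.comp ((measurable_radial x y).comp measurable_norm)
  have hnorm : ∀ w : Cn n, 0 < ‖w‖ → ‖w‖ < 1 → ‖f w‖ₑ = ENNReal.ofReal (radial x y ‖w‖) := by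
    intro w h0 h1
    rw [hfdef, ← ofReal_norm, Complex.norm_real, Real.norm_of_nonneg (radial_pos h0 h1).le]
  have e1 : ∫⁻ w, ‖f w‖ₑ ∂(mu n a b) =
      ENNReal.ofReal (massConst n a b / massConst n (a + x) (b + y)) := by
    rw [← lintegral_radial_mu hn ha hb hax hby]
    refine lintegral_congr_ae ?_
    filter_upwards [ae_mu hn a b] with w hw
    exact hnorm w hw.1 hw.2
  have e2 : ∫⁻ w, ‖f w‖ₑ ^ p ∂(mu n c d) =
      ENNReal.ofReal (massConst n c d / massConst n (c + x * p) (d + y * p)) := by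
    rw [← lintegral_radial_mu hn hc hd hcx hdy]
    refine lintegral_congr_ae ?_
    filter_upwards [ae_mu hn c d] with w hw
    rw [hnorm w hw.1 hw.2, ENNReal.ofReal_rpow_of_pos (radial_pos hw.1 hw.2),
      radial_rpow hw.1 hw.2]
  have hfi : Integrable f (mu n a b) :=
    ⟨hfm.aestronglyMeasurable, by rw [HasFiniteIntegral, e1]; exact ENNReal.ofReal_lt_top⟩
  have hfL : lpNorm n c d p f =
      ENNReal.ofReal ((massConst n c d / massConst n (c + x * p) (d + y * p)) ^ (1 / p)) := by
    rw [lpNorm_eq hp, e2, ENNReal.ofReal_rpow_of_pos r2]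
  have hfp : InLp n c d p f :=
    ⟨hfm.aestronglyMeasurable, by
      change lpNorm n c d p f < ∞
      rw [hfL]; exact ENNReal.ofReal_lt_top⟩
  have key := (hM f hfp hfi).2
  have hI : ∫ w, f w ∂(mu n a b) =
      ((massConst n a b / massConst n (a + x) (b + y) : ℝ) : ℂ) := by
    rw [hfdef, integral_complex_ofReal]
    rw [integral_eq_lintegral_of_nonneg_ae (f := fun w : Cn n => radial x y ‖w‖)
      (by filter_upwards [ae_mu hn a b] with w hw using (radial_pos hw.1 hw.2).le)
      ((measurable_radial x y).comp measurable_norm).aestronglyMeasurable,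
      lintegral_radial_mu hn ha hb hax hby, ENNReal.toReal_ofReal r1.le]
  -- The projection of `f` is constant and `μ_{c,d}` is a probability measure, so the norm is the
  -- modulus of that constant.
  have hP : lpNorm n c d p (proj n a b f) =
      ENNReal.ofReal (massConst n a b / massConst n (a + x) (b + y)) := by
    rw [lpNorm_eq hp, lintegral_congr_ae (g := fun _ =>
      ENNReal.ofReal (massConst n a b / massConst n (a + x) (b + y)) ^ p)]
    · rw [lintegral_const, measure_univ, mul_one, ← ENNReal.rpow_mul, mul_one_div_cancel hp0.ne',
        ENNReal.rpow_one]
    · filter_upwards [(isRotInvariant_mu n c d).ae_mem] with z hz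
      rw [proj_of_radial (ψ := fun r => ((radial x y r : ℝ) : ℂ)) (by linarith) hfi
        (mem_unitBall.1 hz)]
      change ‖∫ w, f w ∂(mu n a b)‖ₑ ^ p = _
      rw [hI, ← ofReal_norm, Complex.norm_real, Real.norm_of_nonneg r1.le]
  rw [hP, hfL, ← ENNReal.ofReal_coe_nnreal, ← ENNReal.ofReal_mul M.coe_nonneg] at key
  exact (ENNReal.ofReal_le_ofReal_iff (mul_nonneg M.coe_nonneg (Real.rpow_nonneg r2.le _))).1 key

lemma continuousAt_Gamma_of_pos {x : ℝ} (hx : 0 < x) : ContinuousAt Real.Gamma x :=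
  (Real.differentiableAt_Gamma fun m h => by
    have : (0 : ℝ) ≤ m := m.cast_nonneg
    linarith).continuousAt

open ProbabilityTheory in
-- The functional equation gives `ε Γ(ε) = Γ(ε + 1)`, which removes the pole of `Γ` at 0.
lemma tendsto_mul_beta {A : ℝ} (hA : 0 < A) :
    Tendsto (fun ε => ε * beta A ε) (𝓝[>] 0) (𝓝 1) := by
  have h : Tendsto (fun ε : ℝ => Real.Gamma A * Real.Gamma (ε + 1) / Real.Gamma (A + ε)) (𝓝 0)
      (𝓝 (Real.Gamma A * Real.Gamma (0 + 1) / Real.Gamma (A + 0))) := by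
    have c1 : ContinuousAt Real.Gamma (0 + 1) := continuousAt_Gamma_of_pos (by norm_num)
    have c2 : ContinuousAt Real.Gamma (A + 0) := continuousAt_Gamma_of_pos (by linarith)
    refine (Tendsto.const_mul _ ?_).div ?_ (by rw [add_zero]; exact (Real.Gamma_pos_of_pos hA).ne')
    · exact c1.tendsto.comp (Continuous.tendsto (by fun_prop) 0)
    · exact c2.tendsto.comp (Continuous.tendsto (by fun_prop) 0)
  rw [zero_add, add_zero, Real.Gamma_one, mul_one, div_self (Real.Gamma_pos_of_pos hA).ne'] at h
  refine (h.mono_left nhdsWithin_le_nhds).congr' ?_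
  filter_upwards [self_mem_nhdsWithin] with ε hε
  rw [beta, Real.Gamma_add_one (ne_of_gt hε)]; ring

open ProbabilityTheory in
lemma tendsto_mul_beta_affine {C e p : ℝ} (hC : 0 < C) (he : 0 < e) :
    Tendsto (fun ε => ε * beta C (p * ε + e)) (𝓝[>] 0) (𝓝 0) := by
  have c1 : ContinuousAt Real.Gamma e := continuousAt_Gamma_of_pos he
  have c2 : ContinuousAt Real.Gamma (C + e) := continuousAt_Gamma_of_pos (by linarith)
  have h : Tendsto (fun ε : ℝ => beta C (p * ε + e)) (𝓝 0) (𝓝 (beta C e)) := by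
    unfold beta
    refine (Tendsto.const_mul _ ?_).div ?_ (Real.Gamma_pos_of_pos (by positivity)).ne'
    · exact c1.tendsto.comp (Continuous.tendsto' (by fun_prop) _ _ (by simp))
    · exact c2.tendsto.comp (Continuous.tendsto' (by fun_prop) _ _ (by simp))
  have := (tendsto_id (x := 𝓝 (0 : ℝ))).mul h
  rw [zero_mul] at this
  exact this.mono_left nhdsWithin_le_nhds

open ProbabilityTheory in
/-- The singularity of `β(A, ε)` at `ε = 0` is too strong to be dominated by the `p`-th root of a
Beta value unless `p = 1` and `e = 0`. -/
lemma not_forall_beta_le {A C e K p : ℝ} (hA : 0 < A) (hC : 0 < C) (he : 0 ≤ e) (hp : 1 ≤ p)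
    (hpe : 1 < p ∨ 0 < e) :
    ¬ ∀ ε > 0, beta A ε ≤ K * beta C (p * ε + e) ^ (1 / p) := by
  intro h
  have hp0 : 0 < p := by linarith
  -- The limit is `ℓ = 0` when `e > 0`, where the beta value stays bounded, and `ℓ = 1/p` when `e =
  -- 0`, in which case `p > 1`.
  obtain ⟨ℓ, hℓ, h0⟩ : ∃ ℓ, Tendsto (fun ε => ε * beta C (p * ε + e)) (𝓝[>] 0) (𝓝 ℓ) ∧
      (1 < p ∨ ℓ = 0) := by
    rcases he.lt_or_eq with he | rfl
    · exact ⟨0, tendsto_mul_beta_affine hC he, Or.inr rfl⟩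
    · refine ⟨p⁻¹ * 1, ?_, Or.inl (by simpa using hpe)⟩
      have ht : Tendsto (fun ε => p * ε) (𝓝[>] 0) (𝓝[>] 0) := by
        refine tendsto_nhdsWithin_iff.2 ⟨?_, ?_⟩
        · exact (Continuous.tendsto' (by fun_prop) _ _ (by simp)).mono_left nhdsWithin_le_nhds
        · filter_upwards [self_mem_nhdsWithin] with ε hε
          exact mul_pos hp0 hε
      refine (((tendsto_mul_beta hC).comp ht).const_mul p⁻¹).congr fun ε => ?_
      simp only [Function.comp, add_zero]
      field_simp
  have hq : 0 ≤ 1 - 1 / p := by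
    rw [sub_nonneg, div_le_one hp0]; exact hp
  -- The inequality is multiplied by `ε = ε^{1 - 1/p} ε^{1/p}`. The right side then tends to 0,
  -- through its first factor if `p > 1` and its second if `ℓ = 0`, while the left side tends to 1.
  have hR : Tendsto (fun ε => K * (ε ^ (1 - 1 / p) * (ε * beta C (p * ε + e)) ^ (1 / p)))
      (𝓝[>] 0) (𝓝 0) := by
    have h1 : Tendsto (fun ε : ℝ => ε ^ (1 - 1 / p)) (𝓝[>] 0) (𝓝 ((0 : ℝ) ^ (1 - 1 / p))) :=
      (Real.continuousAt_rpow_const 0 _ (Or.inr hq)).tendsto.mono_left nhdsWithin_le_nhds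
    have h2 := hℓ.rpow_const (p := 1 / p) (Or.inr (by positivity))
    convert (h1.mul h2).const_mul K using 2
    rcases h0 with h0 | rfl
    · rw [Real.zero_rpow (ne_of_gt (by rw [sub_pos, div_lt_one hp0]; exact h0))]; ring
    · rw [Real.zero_rpow (one_div_pos.2 hp0).ne']; ring
  refine absurd (le_of_tendsto_of_tendsto (tendsto_mul_beta hA) hR ?_) (by norm_num)
  filter_upwards [self_mem_nhdsWithin] with ε hε
  have hε : 0 < ε := hε
  have hβ := beta_pos hC (show 0 < p * ε + e by positivity)
  rw [Real.mul_rpow hε.le hβ.le, ← mul_assoc (ε ^ _), ← Real.rpow_add hε, sub_add_cancel,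
    Real.rpow_one]
  nlinarith [mul_le_mul_of_nonneg_left (h ε hε) hε.le]

lemma massConst_div (n : ℕ) (a b a' b' : ℝ) :
    massConst n a b / massConst n a' b' =
      ProbabilityTheory.beta (a' + 1) (b' + n) / ProbabilityTheory.beta (a + 1) (b + n) := by
  have h1 : ((n - 1).factorial : ℝ) ≠ 0 := by positivity
  have h2 : Real.pi ^ n ≠ 0 := by positivity
  unfold massConst
  rw [div_div_div_eq, mul_left_comm, mul_right_comm (Real.pi ^ n), mul_assoc,
    mul_div_mul_left _ _ h2, mul_div_mul_left _ _ h1]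

lemma beta_comm (x y : ℝ) : ProbabilityTheory.beta x y = ProbabilityTheory.beta y x := by
  rw [ProbabilityTheory.beta, ProbabilityTheory.beta, mul_comm, add_comm]

open ProbabilityTheory in
/-- The projection is not bounded if the density of the target is too small at the origin or at the
sphere, apart from the limiting exponents for `p = 1`. -/
lemma lt_of_projBounded (hn : 1 ≤ n) (ha : -1 < a) (hc : -1 < c)
    (hb : -(n : ℝ) < b) (hd : -(n : ℝ) < d) (hp : 1 ≤ p) (h : ProjBounded n a b c d p) :
    (∀ e, e = d + n - p * (b + n) → 0 ≤ e → ¬ (1 < p ∨ 0 < e)) ∧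
      (∀ e, e = c + 1 - p * (a + 1) → 0 ≤ e → ¬ (1 < p ∨ 0 < e)) := by
  obtain ⟨M, hM, hle⟩ := exists_massConst_le_of_projBounded hn ha hc hb hd hp h
  have hp0 : 0 < p := by linarith
  have q1 := beta_pos (show 0 < a + 1 by linarith) (show 0 < b + n by linarith)
  have q2 := beta_pos (show 0 < c + 1 by linarith) (show 0 < d + n by linarith)
  simp only [massConst_div] at hle
  have hfin : ∀ {X Y : ℝ}, 0 < Y → X / beta (a + 1) (b + n) ≤
      M * (Y / beta (c + 1) (d + n)) ^ (1 / p) →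
      X ≤ beta (a + 1) (b + n) * M * (beta (c + 1) (d + n))⁻¹ ^ (1 / p) * Y ^ (1 / p) := by
    intro X Y hY hXY
    rw [div_le_iff₀ q1, div_eq_mul_inv, Real.mul_rpow hY.le (by positivity)] at hXY
    linarith
  constructor
  · intro e he he0 hpe
    refine not_forall_beta_le (A := a + 1) (C := c + 1) (by linarith) (by linarith) he0 hp hpe
      (K := beta (a + 1) (b + n) * M * (beta (c + 1) (d + n))⁻¹ ^ (1 / p)) fun ε hε => ?_
    have hpε : 0 < p * ε := by positivity
    have e1 : d + (ε - (b + n)) * p + n = p * ε + e := by rw [he]; ring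
    -- The power of `|w|` is chosen so that the shifted `b + n` equals `ε`; the shifted `d + n` is
    -- then `p ε + e`.
    have h1 := hle 0 (ε - (b + n)) (by linarith) (by linarith) (by linarith) (by linarith)
    rw [e1, show b + (ε - (b + n)) + n = ε by ring, zero_mul, add_zero, add_zero] at h1
    exact hfin (beta_pos (by linarith) (by linarith)) h1
  · intro e he he0 hpe
    refine not_forall_beta_le (A := b + n) (C := d + n) (by linarith) (by linarith) he0 hp hpe
      (K := beta (a + 1) (b + n) * M * (beta (c + 1) (d + n))⁻¹ ^ (1 / p)) fun ε hε => ?_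
    have hpε : 0 < p * ε := by positivity
    have e1 : c + (ε - (a + 1)) * p + 1 = p * ε + e := by rw [he]; ring
    -- The same test at the sphere: the shifted `a + 1` equals `ε` and the shifted `c + 1` is `p ε +
    -- e`.
    have h1 := hle (ε - (a + 1)) 0 (by linarith) (by linarith) (by linarith) (by linarith)
    rw [e1, show a + (ε - (a + 1)) + 1 = ε by ring, zero_mul, add_zero, add_zero, beta_comm ε,
      beta_comm _ (d + n)] at h1
    exact hfin (beta_pos (by linarith) (by linarith)) h1

/-! ### Necessity: the endpoint `p = 1`, `c = a` -/

/-- Averages of the kernel over small balls approximate the kernel, uniformly in the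
other variable. -/
lemma exists_radius_norm_proj_indicator_sub_le (hn : 1 ≤ n) (ha : -1 < a) (hb : -(n : ℝ) < b)
    {w₀ : Cn n} (hw₀ : ‖w₀‖ < 1) {δ₀ : ℝ} (hδ₀ : 0 < δ₀) :
    ∃ δ, 0 < δ ∧ δ ≤ δ₀ ∧ ∀ z : Cn n, ‖z‖ < 1 →
      ‖proj n a b ((Metric.ball w₀ δ).indicator fun _ => 1) z -
        (mu n a b).real (Metric.ball w₀ δ) • kernelFun n a b (inner ℂ w₀ z)‖ ≤
        (mu n a b).real (Metric.ball w₀ δ) := by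
  have hb' : 0 < b + n := by linarith
  have := isProbabilityMeasure_mu hn ha hb
  obtain ⟨r, hr1, hr2⟩ := exists_between hw₀
  have hu := (isCompact_closedBall (0 : ℂ) r).uniformContinuousOn_of_continuous
    ((continuousOn_kernelFun n (a := a) hb').mono (Metric.closedBall_subset_ball hr2))
  obtain ⟨η, hη, hu⟩ := Metric.uniformContinuousOn_iff.1 hu 1 one_pos
  -- The bound `r - ‖w₀‖` keeps the ball inside radius `r < 1`, so that `|⟨z, w⟩| ≤ r` for every `z`
  -- in the unit ball; the bound `η` comes from uniform continuity of the kernel there with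
  -- tolerance 1.
  refine ⟨min δ₀ (min η (r - ‖w₀‖)), by
    refine lt_min hδ₀ (lt_min hη (by linarith)), min_le_left _ _, fun z hz => ?_⟩
  set δ := min δ₀ (min η (r - ‖w₀‖))
  have hδη : δ ≤ η := (min_le_right _ _).trans (min_le_left _ _)
  have hδr : δ ≤ r - ‖w₀‖ := (min_le_right _ _).trans (min_le_right _ _)
  have hmem : ∀ w : Cn n, ‖w‖ ≤ r → (inner ℂ w z : ℂ) ∈ Metric.closedBall (0 : ℂ) r := by
    intro w hw
    rw [mem_closedBall_zero_iff]
    exact (norm_inner_le_norm w z).trans (by nlinarith [norm_nonneg z, norm_nonneg w])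
  have hint : IntegrableOn (fun w => kernelFun n a b (inner ℂ w z)) (Metric.ball w₀ δ)
      (mu n a b) := by
    have := integrable_mul_kernelFun hb' (integrable_const (1 : ℂ) (μ := mu n a b)) hz
    simp only [one_mul] at this
    exact this.integrableOn
  have e1 : proj n a b ((Metric.ball w₀ δ).indicator fun _ => 1) z =
      ∫ w in Metric.ball w₀ δ, kernelFun n a b (inner ℂ w z) ∂(mu n a b) := by
    rw [proj, ← integral_indicator measurableSet_ball]
    refine integral_congr_ae (ae_of_all _ fun w => ?_)
    by_cases hw : w ∈ Metric.ball w₀ δ <;> simp [hw]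
  rw [e1, ← setIntegral_const, ← integral_sub hint (integrable_const _)]
  refine (norm_setIntegral_le_of_norm_le_const (C := 1) (measure_lt_top _ _) fun w hw => ?_).trans
    (one_mul _).le
  have hw' : ‖w - w₀‖ < δ := by rwa [← dist_eq_norm]
  have hwr : ‖w‖ ≤ r := by
    have := norm_sub_norm_le w w₀
    linarith
  have := hu _ (hmem w hwr) _ (hmem w₀ hr1.le) (by
    rw [dist_eq_norm, ← inner_sub_left]
    refine lt_of_le_of_lt (norm_inner_le_norm _ _) ?_
    nlinarith [norm_nonneg z, norm_nonneg (w - w₀)])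
  rw [dist_eq_norm] at this
  exact this.le

lemma mu_ball_pos (hn : 1 ≤ n) (ha : -1 < a) (hb : -(n : ℝ) < b) {w₀ : Cn n} (hw₀ : ‖w₀‖ < 1)
    {δ : ℝ} (hδ : 0 < δ) : 0 < mu n a b (Metric.ball w₀ δ) := by
  refine pos_iff_ne_zero.2 fun h => ?_
  have h1 := volume_absolutelyContinuous_mu hn ha hb h
  rw [Measure.restrict_apply measurableSet_ball] at h1
  have ho : IsOpen (Metric.ball w₀ δ ∩ unitBall n) := Metric.isOpen_ball.inter Metric.isOpen_ball
  exact ho.measure_ne_zero volume ⟨w₀, Metric.mem_ball_self hδ, mem_unitBall.2 hw₀⟩ h1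

/-- Away from the origin, `μ_{a,d}` is dominated by `μ_{a,b}`. -/
lemma exists_mu_le_mu (hn : 1 ≤ n) (ha : -1 < a) (hb : -(n : ℝ) < b) (hd : -(n : ℝ) < d)
    (hdb : d ≤ b) {r₀ : ℝ} (hr₀ : 0 < r₀) :
    ∃ D : ℝ≥0, ∀ S : Set (Cn n), MeasurableSet S → (∀ w ∈ S, r₀ ≤ ‖w‖) →
      mu n a d S ≤ D * mu n a b S := by
  have hq : 0 < r₀ ^ (2 * (b - d)) := by positivity
  refine ⟨(1 / r₀ ^ (2 * (b - d))).toNNReal * (massConst n a d / massConst n a b).toNNReal,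
    fun S hS hw => ?_⟩
  have h := lintegral_mul_radial hn ha hd (x := 0) (y := b - d) (by simpa using ha) (by simpa using hb)
    (F := S.indicator 1) (measurable_one.indicator hS)
  rw [lintegral_indicator_one hS, add_zero, add_sub_cancel] at h
  rw [ENNReal.coe_mul, mul_assoc]
  change _ ≤ ENNReal.ofReal (1 / r₀ ^ (2 * (b - d))) * (ENNReal.ofReal _ * _)
  rw [← h, ← lintegral_const_mul' _ _ ENNReal.ofReal_ne_top, ← lintegral_indicator_one hS]
  refine lintegral_mono_ae ?_
  filter_upwards [ae_mu hn a d] with w hw1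
  by_cases hwS : w ∈ S
  · rw [Set.indicator_of_mem hwS, Pi.one_apply, one_mul, ← ENNReal.ofReal_mul (by positivity),
      ENNReal.one_le_ofReal, radial, Real.rpow_zero, mul_one, div_mul_eq_mul_div, one_mul,
      one_le_div hq]
    exact Real.rpow_le_rpow hr₀.le (hw w hwS) (by linarith)
  · simp [hwS]

/-- On `L^1(μ_{a,d})` the projection is not bounded. -/
lemma not_projBounded_one (hn : 1 ≤ n) (ha : -1 < a) (hb : -(n : ℝ) < b) (hd : -(n : ℝ) < d)
    (hdb : d ≤ b) (hQ : ∀ ξ : ℂ, ‖ξ‖ ≤ 1 → Q n a b ξ ≠ 0) : ¬ ProjBounded n a b a d 1 := by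
  rintro ⟨M, hM⟩
  have hab := isProbabilityMeasure_mu hn ha hb
  have had := isProbabilityMeasure_mu hn ha hd
  obtain ⟨κ, hκ, hK⟩ := exists_le_norm_kernelFun n ha (show 0 < b + n by linarith) hQ
  obtain ⟨D, hD⟩ := exists_mu_le_mu hn ha hb hd hdb (show (0 : ℝ) < 1 / 4 by norm_num)
  -- Boundedness will give at most `M D + 1` for `κ` times this integral: `M D` from the norm of the
  -- test function and 1 from the approximation error. Taking `|w₀| > 1/2` and radius at most `1/4`
  -- keeps the test ball at distance `1/4` from the origin, where `μ_{a,d}` is dominated by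
  -- `μ_{a,b}`.
  obtain ⟨w₀, hw1, hw2, hbig⟩ := not_bounded_integral_norm_rpow hn ha hd
    (show (1 / 2 : ℝ) < 1 by norm_num) ((M * D + 1 : ℝ≥0) / κ)
  obtain ⟨δ, hδ, hδ4, hclose⟩ := exists_radius_norm_proj_indicator_sub_le hn ha hb hw2
    (show (0 : ℝ) < 1 / 4 by norm_num)
  set B := Metric.ball w₀ δ with hB
  set f : Cn n → ℂ := B.indicator fun _ => 1 with hf
  set m := mu n a b B with hm
  have hm0 : m ≠ 0 := (mu_ball_pos hn ha hb hw2 hδ).ne'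
  have hmtop : m ≠ ∞ := measure_ne_top _ _
  have hBmeas : MeasurableSet B := measurableSet_ball
  have hnorm1 : lpNorm n a d 1 f = mu n a d B := by
    rw [lpNorm, ENNReal.ofReal_one, hf, eLpNorm_indicator_const hBmeas one_ne_zero ENNReal.one_ne_top]
    simp
  have hDB : mu n a d B ≤ D * m := by
    refine hD B hBmeas fun w hw => ?_
    have h1 : ‖w - w₀‖ < δ := by rwa [← dist_eq_norm]
    have h2 := norm_sub_norm_le w₀ w
    rw [norm_sub_rev] at h2
    linarith
  have hproj := (hM f (memLp_indicator_const _ hBmeas _ (Or.inr (measure_ne_top _ _)))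
    ((integrable_const _).indicator hBmeas)).2
  -- The projection of the indicator is the mass `m` times the kernel at `w₀`, up to an error `m`;
  -- the zero-free lower bound on the kernel enters here.
  have hpt : ∀ᵐ z ∂(mu n a d), m * ENNReal.ofReal (κ * ‖1 - (inner ℂ z w₀ : ℂ)‖ ^ (-(n + 1 + a))) ≤
      ‖proj n a b f z‖ₑ + m := by
    filter_upwards [(isRotInvariant_mu n a d).ae_mem] with z hz
    have hz1 := mem_unitBall.1 hz
    have h1 := hK _ (norm_inner_lt_one hz1 hw2)
    have h2 : ‖1 - (inner ℂ z w₀ : ℂ)‖ = ‖1 - (inner ℂ w₀ z : ℂ)‖ := by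
      rw [← inner_conj_symm, ← Complex.norm_conj]; simp
    have h3 := hclose z hz1
    have h4 : (mu n a b).real B * ‖kernelFun n a b (inner ℂ w₀ z)‖ ≤
        ‖proj n a b f z‖ + (mu n a b).real B := by
      have := norm_sub_norm_le ((mu n a b).real B • kernelFun n a b (inner ℂ w₀ z))
        (proj n a b f z)
      rw [norm_sub_rev, norm_smul, Real.norm_of_nonneg measureReal_nonneg] at this
      linarith
    have h5 : m = ENNReal.ofReal ((mu n a b).real B) := (ofReal_measureReal hmtop).symm
    rw [h5, ← ENNReal.ofReal_mul measureReal_nonneg, ← ofReal_norm,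
      ← ENNReal.ofReal_add (norm_nonneg _) measureReal_nonneg]
    refine ENNReal.ofReal_le_ofReal (le_trans ?_ h4)
    refine mul_le_mul_of_nonneg_left ?_ measureReal_nonneg
    rw [h2, show (-(n + 1 + a) : ℝ) = -(a + n + 1) by ring]
    exact h1
  have hI := integrable_norm_rpow hn ha hd (n + 1 + a) hw2
  have hint : m * ENNReal.ofReal
      (κ * ∫ z, ‖1 - (inner ℂ z w₀ : ℂ)‖ ^ (-(n + 1 + a)) ∂(mu n a d)) ≤ m * (M * D + 1 : ℝ≥0) := by
    rw [← integral_const_mul, ofReal_integral_eq_lintegral_ofReal (hI.const_mul κ)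
      (ae_of_all _ fun z => by positivity), ← lintegral_const_mul' _ _ hmtop]
    refine (lintegral_mono_ae hpt).trans ?_
    rw [lintegral_add_right _ measurable_const, lintegral_const, measure_univ, mul_one]
    have e : ∫⁻ z, ‖proj n a b f z‖ₑ ∂(mu n a d) = lpNorm n a d 1 (proj n a b f) := by
      rw [lpNorm, ENNReal.ofReal_one, eLpNorm_one_eq_lintegral_enorm]
    rw [e]
    calc _ ≤ (M : ℝ≥0∞) * (D * m) + m := by
          refine add_le_add_left (hproj.trans ?_) _
          rw [hnorm1]; exact mul_le_mul_right hDB _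
      _ = _ := by push_cast; ring
  rw [ENNReal.mul_le_mul_iff_right hm0 hmtop] at hint
  rw [← ENNReal.ofReal_coe_nnreal, ENNReal.ofReal_le_ofReal_iff (NNReal.coe_nonneg _)] at hint
  rw [div_lt_iff₀ hκ] at hbig
  linarith

/-- The conditions that are necessary for the projection to be bounded. -/
lemma conditionC_of_projBounded (hn : 1 ≤ n) (ha : -1 < a) (hc : -1 < c)
    (hb : -(n : ℝ) < b) (hd : -(n : ℝ) < d) (hp : 1 ≤ p)
    (hQ : ∀ ξ : ℂ, ‖ξ‖ ≤ 1 → Q n a b ξ ≠ 0) (h : ProjBounded n a b c d p) :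
    ConditionC n a b c d p := by
  obtain ⟨h1, h2⟩ := lt_of_projBounded hn ha hc hb hd hp h
  have h1' := h1 _ rfl
  have h2' := h2 _ rfl
  have hdb : p = 1 → d ≤ b := by
    rintro rfl
    by_contra! hcon
    exact h1' (by linarith) (Or.inr (by linarith))
  refine ⟨?_, fun hp1 => ?_, hdb⟩
  · by_contra! hcon
    rcases hp.lt_or_eq with hp1 | rfl
    · exact h2' (by linarith) (Or.inl hp1)
    · rcases hcon.lt_or_eq with hlt | heq
      · exact h2' (by linarith) (Or.inr (by linarith))
      -- The radial tests say nothing at equality for `p = 1`, so the kernel's divergence is needed.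
      · obtain rfl : c = a := by linarith
        exact not_projBounded_one hn ha hb hd (hdb rfl) hQ h
  · by_contra! hcon
    exact h1' (by linarith) (Or.inl hp1)

end PartTwo

end ModBergman

theorem corollary2p6 (n : ℕ) (hn : 1 ≤ n) (a b c d p : ℝ)
    (ha : -1 < a) (hc : -1 < c) (hb : -(n : ℝ) < b) (hd : -(n : ℝ) < d) (hp : 1 ≤ p) :
    (ModBergman.ConditionC n a b c d p →
      -- the projection is defined on all of `L^p(dμ_{c,d})`, and bounded there
      (∀ f : ModBergman.Cn n → ℂ, ModBergman.InLp n c d p f →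
        Integrable f (ModBergman.mu n a b)) ∧
      ModBergman.ProjBounded n a b c d p ∧
      -- it maps into `A^p_{c,d}`, and onto it
      (∀ f : ModBergman.Cn n → ℂ, ModBergman.InLp n c d p f →
        ModBergman.InBergman n c d p (ModBergman.proj n a b f)) ∧
      (∀ g : ModBergman.Cn n → ℂ, ModBergman.InBergman n c d p g →
        ∃ f : ModBergman.Cn n → ℂ, ModBergman.InLp n c d p f ∧
          Set.EqOn (ModBergman.proj n a b f) g (ModBergman.unitBall n))) ∧
    ((∀ ξ : ℂ, ‖ξ‖ ≤ 1 → ModBergman.Q n a b ξ ≠ 0) →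
      ModBergman.ProjBounded n a b c d p →
      ModBergman.ConditionC n a b c d p) := by
  refine ⟨fun hC => ?_, fun hQ h =>
    ModBergman.conditionC_of_projBounded hn ha hc hb hd hp hQ h⟩
  have hint : ∀ f : ModBergman.Cn n → ℂ, ModBergman.InLp n c d p f →
      Integrable f (ModBergman.mu n a b) :=
    fun f hf => ModBergman.integrable_of_inLp hn ha hc hb hd hp hC hf
  have hbd := ModBergman.projBounded_of_conditionC hn ha hc hb hd hp hC
  refine ⟨hint, hbd, fun f hf => ⟨ModBergman.differentiableOn_proj (by linarith) (hint f hf), ?_⟩,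
    -- Each function of the Bergman space is its own preimage, by the reproducing property.
    fun g hg => ⟨g, hg.2, fun z hz => ModBergman.proj_eq_self hn ha hb hg.1 (hint g hg.2) hz⟩⟩
  obtain ⟨M, hM⟩ := hbd
  exact (hM f hf (hint f hf)).1
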